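/- Let $M$ be a smooth ($C^\infty$, Hausdorff, second countable, without boundary) manifold of dimension $n\ge 2$, let $\pi\colon TM\to M$ be its tangent bundle and $TM\setminus\{0\}$ the set of nonzero tangent vectors. Let $S$ be a spray on $M$: a smooth vector field on $TM\setminus\{0\}$ with $D\pi\circ S=\mathrm{id}$ and $[\mathbb C,S]=S$, where $\mathbb C(\xi)=\partial_s((1+s)\xi)|_{s=0}$ is the Liouville vector field. In the coordinates $(x,y)$ of $TM$ induced by local coordinates $x$ of $M$, $S=y^i\frac{\partial}{\partial x^i}-2G^i(x,y)\frac{\partial}{\partial y^i}$; put $N^i_j=\partial G^i/\partial y^j$. A geodesic on an open interval $I$ is a smooth curve $c\colon I\to M$ with $c'(t)\neq0$ for all $t$ and $c''=S\circ c'$; a geodesic on a compact interval is a curve that extends to a geodesic on an open interval. For a vector field $X$ and a $(1,1)$-tensor $J$ along a geodesic $c$, the dynamical covariant derivative is given in local coordinates by $$(\nabla X)^i=\frac{dX^i}{dt}+N^i_j(c')X^j,\qquad (\nabla J)^i_j=\frac{dJ^i_j}{dt}+N^i_k(c')J^k_j-J^i_kN^k_j(c'),$$ and $X$ is parallel if $\nabla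 X=0$. The Jacobi endomorphism along $c$ is $\Phi^i_j=\big(2\frac{\partial G^i}{\partial x^j}-S\big(\frac{\partial G^i}{\partial y^j}\big)-\frac{\partial G^i}{\partial y^r}\frac{\partial G^r}{\partial y^j}\big)_{c'(t)}$. A Jacobi tensor along $c$ is a smooth $(1,1)$-tensor $J$ along $c$ with $\nabla^2J+\Phi\circ J=0$. (On a compact interval, smoothness and derivatives at the end points are one-sided.) An $(n-1)$-parameter geodesic variation of $c\colon I\to M$ ($I$ an open interval) is a smooth map $V\colon I\times(-\varepsilon,\varepsilon)^{n-1}\to M$, for some $\varepsilon>0$, with $V(t,0,\dots,0)=c(t)$ for $t\in I$ and such that $t\mapsto V(t,s)$ is a geodesic for every $s=(s^1,\dots,s^{n-1})$. For a geodesic $c\colon I\to M$ on an interval $I\ni 0$, call $e_1,\dots,e_{n-1}$ a transversal parallel frame along $c$ if the $e_a$ are smooth parallel vector fields along $c$ such that $e_1(0),\dots,e_{n-1}(0)$ are a basis of an $(n-1)$-dimensional subspace $W\subset T_{c(0)}M$ with $c'(0)\notin W$, and put $W_t=\operatorname{span}\{e_1(t),\dots,e_{n-1}(t)\}$. Consider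 the conditions $$J(c'(t))=0,\qquad J(e_a(t))=(\partial_{s^a}V)(t,0,\dots,0),\quad a=1,\dots,n-1,\ t\in I.\tag{$*$}$$ (i) Let $I\ni 0$ be an open interval (possibly unbounded), let $V\colon I\times(-\varepsilon,\varepsilon)^{n-1}\to M$ be an $(n-1)$-parameter geodesic variation of $c(t)=V(t,0,\dots,0)$, and let $e_1,\dots,e_{n-1}$ be a transversal parallel frame along $c$. Then there is exactly one $(1,1)$-tensor $J$ along $c$ satisfying $(*)$, and it is a (smooth) Jacobi tensor along $c$. (ii) Conversely, let $I=[a,b]\ni 0$ with $a<b$, let $c\colon I\to M$ be a geodesic, let $e_1,\dots,e_{n-1}$ be a transversal parallel frame along $c$, and let $J$ be a Jacobi tensor along $c$ that is transversal with respect to $W_t$, i.e. $J(c'(t))=0$ and $\operatorname{Im}J(t)\subset W_t$ for all $t\in I$. Then there are an open interval $I^*\supset I$, an $\varepsilon>0$ and an $(n-1)$-parameter geodesic variation $V\colon I^*\times(-\varepsilon,\varepsilon)^{n-1}\to M$ of a geodesic on $I^*$ extending $c$, such that $(*)$ holds for all $t\in I$. -/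

import Mathlib

open Set Topology Manifold ContDiff

noncomputable section

namespace SprayGeometry

/-- The model space `ℝⁿ`. -/
abbrev Model (n : ℕ) : Type := EuclideanSpace ℝ (Fin n)

section Basic

variable {n : ℕ} {M : Type*} [TopologicalSpace M] [ChartedSpace (Model n) M]
  [IsManifold 𝓘(ℝ, Model n) ∞ M]

/-- The tangent bundle `TM`. -/
abbrev TM (n : ℕ) (M : Type*) [TopologicalSpace M] [ChartedSpace (Model n) M]
    [IsManifold 𝓘(ℝ, Model n) ∞ M] :=
  TangentBundle 𝓘(ℝ, Model n) M

/-- The model with corners of the manifold `TM`. -/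
abbrev modelTM (n : ℕ) := (𝓘(ℝ, Model n)).tangent

/-- The slashed tangent bundle `TM \ {0}`. -/
def slashed (n : ℕ) (M : Type*) [TopologicalSpace M] [ChartedSpace (Model n) M]
    [IsManifold 𝓘(ℝ, Model n) ∞ M] : Set (TM n M) :=
  {v | v.2 ≠ 0}

/-- A (not necessarily smooth) section of `T(TM) → TM`. Only its values on the slashed tangent
bundle will be used. -/
abbrev SecondOrderField (n : ℕ) (M : Type*) [TopologicalSpace M] [ChartedSpace (Model n) M]
    [IsManifold 𝓘(ℝ, Model n) ∞ M] :=
  ∀ v : TM n M, TangentSpace (modelTM n) v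

/-- The Liouville vector field `C(ξ) = ∂ₛ((1 + s) ξ)|ₛ₌₀` on `TM`. -/
def liouville (n : ℕ) (M : Type*) [TopologicalSpace M] [ChartedSpace (Model n) M]
    [IsManifold 𝓘(ℝ, Model n) ∞ M] : SecondOrderField n M := fun ξ =>
  (mfderiv 𝓘(ℝ, ℝ) (modelTM n) (fun s : ℝ => (⟨ξ.proj, (1 + s) • ξ.2⟩ : TM n M)) 0 (1 : ℝ) :
    Model n × Model n)

/-- A semispray on `M`: a smooth vector field on the slashed tangent bundle with
`Dπ ∘ S = id`. -/
structure IsSemispray (S : SecondOrderField n M) : Prop where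
  smooth : ContMDiffOn (modelTM n) (modelTM n).tangent ∞
    (fun v : TM n M => (⟨v, S v⟩ : TangentBundle (modelTM n) (TM n M))) (slashed n M)
  proj : ∀ v ∈ slashed n M,
    mfderiv (modelTM n) 𝓘(ℝ, Model n) (fun w : TM n M => w.proj) v (S v) = v.2

/-- A spray on `M`: a semispray with `[C, S] = S` on the slashed tangent bundle. -/
structure IsSpray (S : SecondOrderField n M) : Prop extends IsSemispray S where
  homogeneous : ∀ v ∈ slashed n M,
    VectorField.mlieBracket (modelTM n) (liouville n M) S v = S v

/-- The tangent `γ' : t ↦ γ'(t) ∈ TM` of a curve. -/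
def velocity (γ : ℝ → M) (t : ℝ) : TM n M :=
  ⟨γ t, mfderiv 𝓘(ℝ, ℝ) 𝓘(ℝ, Model n) γ t (1 : ℝ)⟩

/-- The curve `γ` is a geodesic of `S` on the open set `I` of times: it is smooth and regular
there, and `γ'' = S ∘ γ'`. -/
structure IsGeodesicOn (S : SecondOrderField n M) (γ : ℝ → M) (I : Set ℝ) : Prop where
  smooth : ContMDiffOn 𝓘(ℝ, ℝ) 𝓘(ℝ, Model n) ∞ γ I
  regular : ∀ t ∈ I, (velocity γ t : TM n M) ∈ slashed n M
  eqn : ∀ t ∈ I,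
    mfderiv 𝓘(ℝ, ℝ) (modelTM n) (velocity γ : ℝ → TM n M) t (1 : ℝ) = S (velocity γ t)

/-- An open interval of `ℝ`, possibly unbounded. -/
def IsOpenInterval (I : Set ℝ) : Prop := IsOpen I ∧ I.OrdConnected

/-- A geodesic on a compact interval is one that extends to a geodesic on an open interval. Here
`c : ℝ → M` already stands for such an extension. -/
def IsGeodesicOnCompact (S : SecondOrderField n M) (c : ℝ → M) (K : Set ℝ) : Prop :=
  ∃ U : Set ℝ, IsOpenInterval U ∧ K ⊆ U ∧ IsGeodesicOn S c U

/-- The open cube `(-ε, ε)ᵏ`. -/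
def cube (k : ℕ) (ε : ℝ) : Set (Fin k → ℝ) := {s | ∀ a, s a ∈ Ioo (-ε) ε}

/-- `V : I × (-ε, ε)ᵏ → M` is a `k`-parameter geodesic variation of `c : I → M`. -/
structure IsGeodesicVariation (S : SecondOrderField n M) {k : ℕ} (c : ℝ → M) (I : Set ℝ) (ε : ℝ)
    (V : ℝ × (Fin k → ℝ) → M) : Prop where
  pos : 0 < ε
  smooth : ContMDiffOn 𝓘(ℝ, ℝ × (Fin k → ℝ)) 𝓘(ℝ, Model n) ∞ V (I ×ˢ cube k ε)
  base : ∀ t ∈ I, V (t, 0) = c t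
  geodesic : ∀ s ∈ cube k ε, IsGeodesicOn S (fun t => V (t, s)) I

/-- `(∂V/∂sᵃ)(t, 0, …, 0)`, an element of `TM` over `V(t, 0, …, 0)`. -/
def paramDeriv {k : ℕ} (V : ℝ × (Fin k → ℝ) → M) (a : Fin k) (t : ℝ) : TM n M :=
  ⟨V (t, 0), mfderiv 𝓘(ℝ, Fin k → ℝ) 𝓘(ℝ, Model n) (fun s : Fin k → ℝ => V (t, s)) 0
    (Pi.single a (1 : ℝ) : Fin k → ℝ)⟩

/-! ### Local coordinates

Below `φ` is a local coordinate system (an element of the maximal atlas), `(x, y)` are the induced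
coordinates of `TM`, and indices are suppressed. -/

/-- The induced coordinates `(x, y)` of an element of `TM`. -/
def coordTM (φ : OpenPartialHomeomorph M (Model n)) (v : TM n M) : Model n × Model n :=
  (φ v.proj, mfderiv 𝓘(ℝ, Model n) 𝓘(ℝ, Model n) φ v.proj v.2)

/-- The element of `TM` with coordinates `(x, y)`. -/
def ofCoordTM (φ : OpenPartialHomeomorph M (Model n)) (z : Model n × Model n) : TM n M :=
  ⟨φ.symm z.1, mfderiv 𝓘(ℝ, Model n) 𝓘(ℝ, Model n) φ.symm z.1 z.2⟩

/-- The coefficients `Gⁱ(x, y)`, determined by `S = (x, y, y, -2 G(x, y))` in coordinates. -/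
def sprayCoeff (S : SecondOrderField n M) (φ : OpenPartialHomeomorph M (Model n))
    (z : Model n × Model n) : Model n :=
  (-(1 / 2) : ℝ) •
    (mfderiv (modelTM n) 𝓘(ℝ, Model n × Model n) (coordTM φ) (ofCoordTM φ z)
      (S (ofCoordTM φ z)) : Model n × Model n).2

/-- The functions `Nⁱⱼ = ∂Gⁱ/∂yʲ`, as an endomorphism of `ℝⁿ`. -/
def connCoeff (S : SecondOrderField n M) (φ : OpenPartialHomeomorph M (Model n))
    (z : Model n × Model n) : Model n →L[ℝ] Model n :=
  (fderiv ℝ (sprayCoeff S φ) z).comp (ContinuousLinearMap.inr ℝ (Model n) (Model n))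

/-- The components `Φⁱⱼ = 2 ∂Gⁱ/∂xʲ - S(∂Gⁱ/∂yʲ) - (∂Gⁱ/∂yʳ)(∂Gʳ/∂yʲ)` of the Jacobi
endomorphism, where `S(f) = yᵏ ∂f/∂xᵏ - 2 Gᵏ ∂f/∂yᵏ`. -/
def jacobiEndo (S : SecondOrderField n M) (φ : OpenPartialHomeomorph M (Model n))
    (z : Model n × Model n) : Model n →L[ℝ] Model n :=
  (2 : ℝ) • (fderiv ℝ (sprayCoeff S φ) z).comp (ContinuousLinearMap.inl ℝ (Model n) (Model n))
    - fderiv ℝ (connCoeff S φ) z (z.2, (-2 : ℝ) • sprayCoeff S φ z)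
    - (connCoeff S φ z).comp (connCoeff S φ z)

/-- A vector field along the curve `c`. -/
abbrev FieldAlong (n : ℕ) {M : Type*} [TopologicalSpace M] [ChartedSpace (Model n) M]
    (c : ℝ → M) := ∀ t : ℝ, TangentSpace 𝓘(ℝ, Model n) (c t)

/-- A `(1,1)`-tensor along the curve `c`, as a family of endomorphisms of `T_{c(t)}M`. -/
abbrev TensorAlong (n : ℕ) {M : Type*} [TopologicalSpace M] [ChartedSpace (Model n) M]
    (c : ℝ → M) :=
  ∀ t : ℝ, TangentSpace 𝓘(ℝ, Model n) (c t) →L[ℝ] TangentSpace 𝓘(ℝ, Model n) (c t)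

/-- The components `Xⁱ(t)` of a vector field along `c`. -/
def fieldCoord {c : ℝ → M} (φ : OpenPartialHomeomorph M (Model n)) (X : FieldAlong n c) (t : ℝ) :
    Model n :=
  mfderiv 𝓘(ℝ, Model n) 𝓘(ℝ, Model n) φ (c t) (X t)

/-- The components `Jⁱⱼ(t)` of a `(1,1)`-tensor along `c`. -/
def tensorCoord {c : ℝ → M} (φ : OpenPartialHomeomorph M (Model n)) (J : TensorAlong n c) (t : ℝ) :
    Model n →L[ℝ] Model n :=
  ((mfderiv 𝓘(ℝ, Model n) 𝓘(ℝ, Model n) φ (c t)).comp (J t)).comp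
    (mfderiv 𝓘(ℝ, Model n) 𝓘(ℝ, Model n) φ (c t)).inverse

/-- The dynamical covariant derivative on components of vector fields along `c`:
`(∇X)ⁱ = dXⁱ/dt + Nⁱⱼ(c') Xʲ`. At the end points of a compact interval `I` the derivative is
one-sided; for open `I` it is the ordinary derivative. -/
def nablaField (S : SecondOrderField n M) (c : ℝ → M) (I : Set ℝ)
    (φ : OpenPartialHomeomorph M (Model n)) (x : ℝ → Model n) (t : ℝ) : Model n :=
  derivWithin x I t + connCoeff S φ (coordTM φ (velocity c t)) (x t)

/-- The dynamical covariant derivative on components of `(1,1)`-tensors along `c`: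
`(∇J)ⁱⱼ = dJⁱⱼ/dt + Nⁱₖ(c') Jᵏⱼ - Jⁱₖ Nᵏⱼ(c')`. -/
def nablaTensor (S : SecondOrderField n M) (c : ℝ → M) (I : Set ℝ)
    (φ : OpenPartialHomeomorph M (Model n)) (A : ℝ → Model n →L[ℝ] Model n) (t : ℝ) :
    Model n →L[ℝ] Model n :=
  derivWithin A I t + (connCoeff S φ (coordTM φ (velocity c t))).comp (A t)
    - (A t).comp (connCoeff S φ (coordTM φ (velocity c t)))

/-- The smooth vector field `X` along `c` is parallel on `I`: `∇X = 0` in all coordinates. -/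
structure IsParallel (S : SecondOrderField n M) (c : ℝ → M) (I : Set ℝ) (X : FieldAlong n c) :
    Prop where
  smooth : ContMDiffOn 𝓘(ℝ, ℝ) (modelTM n) ∞ (fun t => (⟨c t, X t⟩ : TM n M)) I
  parallel : ∀ φ ∈ IsManifold.maximalAtlas 𝓘(ℝ, Model n) ∞ M, ∀ t ∈ I, c t ∈ φ.source →
    nablaField S c I φ (fieldCoord φ X) t = 0

/-- The smooth `(1,1)`-tensor `J` along `c` is a Jacobi tensor on `I`: `∇²J + Φ ∘ J = 0` in all
coordinates. -/
structure IsJacobiTensor (S : SecondOrderField n M) (c : ℝ → M) (I : Set ℝ) (J : TensorAlong n c) :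
    Prop where
  smooth : ∀ φ ∈ IsManifold.maximalAtlas 𝓘(ℝ, Model n) ∞ M,
    ContDiffOn ℝ ∞ (tensorCoord φ J) (I ∩ c ⁻¹' φ.source)
  jacobi : ∀ φ ∈ IsManifold.maximalAtlas 𝓘(ℝ, Model n) ∞ M, ∀ t ∈ I, c t ∈ φ.source →
    nablaTensor S c I φ (nablaTensor S c I φ (tensorCoord φ J)) t
      + (jacobiEndo S φ (coordTM φ (velocity c t))).comp (tensorCoord φ J t) = 0

/-- The subspace `W_t = span {e_1(t), …, e_{n-1}(t)}` of `T_{c(t)}M`. -/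
def planeAt {c : ℝ → M} {k : ℕ} (e : Fin k → FieldAlong n c) (t : ℝ) :
    Submodule ℝ (TangentSpace 𝓘(ℝ, Model n) (c t)) :=
  Submodule.span ℝ (range fun a => e a t)

/-- `e_1, …, e_{n-1}` are parallel along `c : I → M`, and at time `0` they are a basis of an
`(n-1)`-dimensional subspace `W = W_0` of `T_{c(0)}M` with `c'(0) ∉ W`. -/
structure IsTransversalFrame (S : SecondOrderField n M) (c : ℝ → M) (I : Set ℝ)
    (e : Fin (n - 1) → FieldAlong n c) : Prop where
  parallel : ∀ a, IsParallel S c I (e a)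
  independent : LinearIndependent ℝ (fun a => e a 0)
  transversal : (velocity c 0 : TM n M).2 ∉ planeAt e 0

/-- `J` is transversal with respect to `W_t`: `J(c') = 0` and `Im J(t) ⊆ W_t`. -/
def IsTransversalTensor (c : ℝ → M) (I : Set ℝ) (e : Fin (n - 1) → FieldAlong n c)
    (J : TensorAlong n c) : Prop :=
  ∀ t ∈ I, J t (velocity c t : TM n M).2 = 0 ∧ ∀ w, J t w ∈ planeAt e t

/-- The conditions `J(c'(t)) = 0` and `J(e_a(t)) = (∂V/∂sᵃ)(t, 0, …, 0)` for `t ∈ I`; the latter is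
an equation in `TM`, so that it includes `V(t, 0, …, 0) = c(t)`. -/
def IsInducedTensor (c : ℝ → M) (I : Set ℝ) (e : Fin (n - 1) → FieldAlong n c)
    (V : ℝ × (Fin (n - 1) → ℝ) → M) (J : TensorAlong n c) : Prop :=
  ∀ t ∈ I, J t (velocity c t : TM n M).2 = 0 ∧
    ∀ a, (⟨c t, J t (e a t)⟩ : TM n M) = paramDeriv V a t

end Basic

end SprayGeometry

end

/-! In the induced coordinates `(x, y)` a spray is the first order field `F = (y, -2G)`, and the
velocities of geodesics are its integral curves. Everything rests on one identity: along a geodesic,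
`∇²X + Φ(X)` equals `X''` minus the second component of `DF(X, X')`, because the terms of `Φ` cancel
the derivatives of `N` that `∇²` produces (`nablaField_nablaField_add_jacobiEndo`). So a field `X`
along `c` is a Jacobi field exactly when `(X, X')` solves the linearized geodesic equation, which is
what differentiating a family of geodesics in a parameter yields (`hasDerivAt_variation`).

For (i), homogeneity gives `N(y) = 2G`, so `c'` is itself parallel. A constant-coefficient
combination of `c'` and the `e_a` that vanishes at one time vanishes at time `0`, hence is trivial;
thus `c', e_1, …, e_{n-1}` is a basis at every time. The conditions prescribe `J` on this basis,
which settles existence, uniqueness and smoothness. On a parallel field `X` the Leibniz rule gives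
`(∇²J + Φ ∘ J)(X) = ∇²(JX) + Φ(JX)`, and this vanishes on the basis because `JX` is zero or a
variation field.

For (ii), the fields `J(e_a)` are Jacobi fields. Let `p_a` be the value and ordinary derivative of
`J(e_a)` at time `0` in a chart, and shoot geodesics with initial velocity `c'(0) + Σ sᵃ p_a` in
coordinates. The variation fields have the same initial data as the `J(e_a)`, so they agree by
uniqueness for linear equations (`SolvesJacobi.eq`). Existence of the variation on a neighbourhood
of all of `[a, b]` comes from local flows, restarted and glued from chart to chart while the
parameter cube shrinks (`IsGeodesicOn.exists_variation_Icc`).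

Smooth dependence of solutions on initial values is derived from the inverse function theorem in the
Banach space of continuous curves (`exists_smooth_flow_of_contDiff`); this needs composition with a
smooth map to be a smooth operation on curves. -/

noncomputable section

namespace SprayGeometry

/-! ### Superposition operators on spaces of continuous maps. -/

section Nemytskii

universe u

variable {K : Type*} [TopologicalSpace K] [CompactSpace K] {E F : Type u}
  [NormedAddCommGroup E] [NormedSpace ℝ E] [NormedAddCommGroup F] [NormedSpace ℝ F]

/-- Pointwise application of a family of operators to a family of vectors. -/
def pointwiseApply (K : Type*) [TopologicalSpace K] [CompactSpace K] (E F : Type u)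
    [NormedAddCommGroup E] [NormedSpace ℝ E] [NormedAddCommGroup F] [NormedSpace ℝ F] :
    C(K, E →L[ℝ] F) →L[ℝ] C(K, E) →L[ℝ] C(K, F) :=
  LinearMap.mkContinuous₂
    (LinearMap.mk₂ ℝ (fun (L : C(K, E →L[ℝ] F)) (h : C(K, E)) =>
      (⟨fun t => L t (h t), L.continuous.clm_apply h.continuous⟩ : C(K, F)))
      (by intros; ext; simp) (by intros; ext; simp) (by intros; ext; simp) (by intros; ext; simp))
    1 (by
      intro L h
      rw [one_mul, ContinuousMap.norm_le _ (by positivity)]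
      intro t
      exact (L t).le_of_opNorm_le_of_le (L.norm_coe_le_norm t) (h.norm_coe_le_norm t))

/-- Composition with `fderiv ℝ f` is continuous for the sup norm, so near `α` the derivative of `f`
varies by less than `ε` uniformly in `t`. The mean value inequality on each ball around `α t` then
bounds the remainder by `ε * ‖β - α‖`. -/
theorem hasFDerivAt_continuousMap_comp {f : E → F} (hf : ContDiff ℝ 1 f) (α : C(K, E)) :
    HasFDerivAt (fun β : C(K, E) => (⟨f, hf.continuous⟩ : C(E, F)).comp β)
      (pointwiseApply K E F
        ((⟨fderiv ℝ f, hf.continuous_fderiv one_ne_zero⟩ : C(E, E →L[ℝ] F)).comp α)) α := by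
  set f' : C(E, E →L[ℝ] F) := ⟨fderiv ℝ f, hf.continuous_fderiv one_ne_zero⟩
  rw [hasFDerivAt_iff_isLittleO, Asymptotics.isLittleO_iff]
  intro ε hε
  have hcont : Continuous (fun β : C(K, E) => f'.comp β) := f'.continuous_postcomp
  obtain ⟨δ, hδ, hclose⟩ := (Metric.continuous_iff (α := C(K, E)) (β := C(K, E →L[ℝ] F))).1 hcont α ε hε
  filter_upwards [Metric.ball_mem_nhds α hδ] with β hβ
  rw [ContinuousMap.norm_le _ (by positivity)]
  intro t
  have hβt : ‖β t - α t‖ ≤ ‖β - α‖ := (β - α).norm_coe_le_norm t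
  have hβ' : ‖β - α‖ < δ := by simpa [dist_eq_norm] using hβ
  have key := (convex_ball (α t) δ).norm_image_sub_le_of_norm_fderiv_le' (f := f) (𝕜 := ℝ)
    (C := ε) (φ := f' (α t)) (x := α t) (y := β t)
    (fun x _ => (hf.differentiable one_ne_zero) x) ?_ (Metric.mem_ball_self hδ)
    (by rw [Metric.mem_ball, dist_eq_norm]; exact hβt.trans_lt hβ')
  · calc _ = ‖f (β t) - f (α t) - f' (α t) (β t - α t)‖ := rfl
      _ ≤ ε * ‖β t - α t‖ := key
      _ ≤ ε * ‖β - α‖ := by gcongr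
  · intro x hx
    -- Uniform closeness is available for curves only; translating `α` by the constant `x - α t`
    -- gives a curve that passes through `x` at `t`.
    have h1 := hclose (α + ContinuousMap.const K (x - α t)) (by
      rw [dist_eq_norm, add_sub_cancel_left]
      rw [Metric.mem_ball, dist_eq_norm] at hx
      refine lt_of_le_of_lt ?_ hx
      rw [ContinuousMap.norm_le _ (norm_nonneg _)]
      intro _
      simp)
    have h2 := (ContinuousMap.dist_apply_le_dist (f := f'.comp (α + ContinuousMap.const K (x - α t)))
      (g := f'.comp α) t).trans h1.le
    rw [dist_eq_norm] at h2
    simpa [f'] using h2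

/-- The derivative of the superposition operator of `f` is the superposition operator of `fderiv ℝ
f` followed by a continuous linear map, so induction applies. The target must vary in the induction,
as it passes from `F` to `E →L[ℝ] F`; this is why `E` and `F` share a universe. -/
theorem contDiff_nat_continuousMap_comp (m : ℕ) :
    ∀ {F : Type u} [NormedAddCommGroup F] [NormedSpace ℝ F] {f : E → F} (hf : ContDiff ℝ m f),
      ContDiff ℝ m (fun β : C(K, E) => (⟨f, hf.continuous⟩ : C(E, F)).comp β) := by
  induction m with
  | zero =>
    intro F _ _ f hf
    exact contDiff_zero.2 (ContinuousMap.continuous_postcomp _)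
  | succ m ih =>
    intro F _ _ f hf
    have hf1 : ContDiff ℝ 1 f := hf.of_le (by exact_mod_cast Nat.le_add_left 1 m)
    have hf' : ContDiff ℝ m (fderiv ℝ f) := hf.fderiv_right (by simp)
    refine contDiff_succ_iff_hasFDerivAt.2 ⟨fun α => pointwiseApply K E F
      ((⟨fderiv ℝ f, hf1.continuous_fderiv one_ne_zero⟩ : C(E, E →L[ℝ] F)).comp α), ?_,
      fun α => hasFDerivAt_continuousMap_comp hf1 α⟩
    exact (pointwiseApply K E F).contDiff.comp (ih hf')

theorem contDiff_continuousMap_comp {f : E → F} (hf : ContDiff ℝ ∞ f) :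
    ContDiff ℝ ∞ (fun β : C(K, E) => (⟨f, hf.continuous⟩ : C(E, F)).comp β) :=
  contDiff_infty.2 fun m => contDiff_nat_continuousMap_comp m (contDiff_infty.1 hf m)

end Nemytskii

/-! ### The integral operator on the unit interval. -/

section Flow

universe u

variable {E : Type u} [NormedAddCommGroup E] [NormedSpace ℝ E]

/-- The primitive vanishing at `0` of a continuous function on the unit interval. -/
def primitive (E : Type u) [NormedAddCommGroup E] [NormedSpace ℝ E] :
    C(Icc (0 : ℝ) 1, E) →L[ℝ] C(Icc (0 : ℝ) 1, E) :=
  LinearMap.mkContinuous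
    { toFun := fun α =>
        ⟨fun t => ∫ u in (0 : ℝ)..t, IccExtend zero_le_one α u, by
          have h : Continuous (IccExtend zero_le_one (α : Icc (0 : ℝ) 1 → E)) :=
            α.continuous.Icc_extend'
          exact (intervalIntegral.continuous_primitive
            (fun a b => h.intervalIntegrable a b) 0).comp continuous_subtype_val⟩
      map_add' := by
        intro α β
        ext t
        simp only [ContinuousMap.coe_mk, ContinuousMap.add_apply]
        rw [← intervalIntegral.integral_add]
        · rfl
        · exact (α.continuous.Icc_extend').intervalIntegrable _ _
        · exact (β.continuous.Icc_extend').intervalIntegrable _ _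
      map_smul' := by
        intro r α
        ext t
        simp only [ContinuousMap.coe_mk, ContinuousMap.smul_apply, RingHom.id_apply]
        rw [← intervalIntegral.integral_smul]
        rfl }
    1 (by
      intro α
      rw [one_mul, ContinuousMap.norm_le _ (norm_nonneg _)]
      intro t
      have h := intervalIntegral.norm_integral_le_of_norm_le_const (a := 0) (b := (t : ℝ))
        (f := IccExtend zero_le_one α) (C := ‖α‖) (fun x _ => α.norm_coe_le_norm _)
      refine h.trans ?_
      have : |(t : ℝ) - 0| ≤ 1 := by rw [sub_zero, abs_of_nonneg t.2.1]; exact t.2.2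
      exact mul_le_of_le_one_right (norm_nonneg _) this)

/-- Restriction of a curve on the unit interval to `[0, l]`, reparametrized by `[0, 1]`. -/
def rescale (l : Icc (0 : ℝ) 1) (α : C(Icc (0 : ℝ) 1, E)) : C(Icc (0 : ℝ) 1, E) :=
  α.comp ⟨fun t => l * t, by fun_prop⟩

/-- The substitution `u ↦ l * u`. It cuts a solution for time `τ` down to a solution for time `l *
τ`. -/
theorem primitive_rescale (l : Icc (0 : ℝ) 1) (α : C(Icc (0 : ℝ) 1, E)) :
    (l : ℝ) • primitive E (rescale l α) = rescale l (primitive E α) := by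
  ext t
  change (l : ℝ) • ∫ u in (0 : ℝ)..t, IccExtend zero_le_one (rescale l α) u =
    ∫ u in (0 : ℝ)..(l * t : ℝ), IccExtend zero_le_one α u
  have h := intervalIntegral.smul_integral_comp_mul_left (a := 0) (b := (t : ℝ))
    (IccExtend zero_le_one (α : Icc (0 : ℝ) 1 → E)) (l : ℝ)
  rw [mul_zero] at h
  rw [← h]
  congr 1
  apply intervalIntegral.integral_congr
  intro u hu
  rw [uIcc_of_le t.2.1] at hu
  have hu' : u ∈ Icc (0 : ℝ) 1 := ⟨hu.1, hu.2.trans t.2.2⟩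
  have hlu : (l : ℝ) * u ∈ Icc (0 : ℝ) 1 :=
    ⟨mul_nonneg l.2.1 hu'.1, mul_le_one₀ l.2.2 hu'.1 hu'.2⟩
  simp only [IccExtend_of_mem _ _ hu', IccExtend_of_mem _ _ hlu]
  rfl

end Flow
end SprayGeometry
end

noncomputable section

namespace SprayGeometry

/-! ### Smooth flows from the inverse function theorem. -/

section Flow

universe u

variable {E : Type u} [NormedAddCommGroup E] [NormedSpace ℝ E]

/-- The map `(x, τ, α) ↦ (x, τ, α - x - τ ∫ f ∘ α)`, whose fibres over `(x, τ, 0)` are the solutions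
of `α' = τ f(α)`, `α(0) = x` on the unit interval. -/
def shootingMap {f : E → E} (hf : ContDiff ℝ ∞ f) (p : E × ℝ × C(Icc (0 : ℝ) 1, E)) :
    E × ℝ × C(Icc (0 : ℝ) 1, E) :=
  (p.1, p.2.1, p.2.2 - ContinuousLinearMap.const ℝ (Icc (0 : ℝ) 1) p.1
    - p.2.1 • primitive E ((⟨f, hf.continuous⟩ : C(E, E)).comp p.2.2))

theorem contDiff_shootingMap {f : E → E} (hf : ContDiff ℝ ∞ f) :
    ContDiff ℝ ∞ (shootingMap hf) := by
  have h1 : ContDiff ℝ ∞ (fun p : E × ℝ × C(Icc (0 : ℝ) 1, E) =>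
      (⟨f, hf.continuous⟩ : C(E, E)).comp p.2.2) :=
    (contDiff_continuousMap_comp hf).comp (contDiff_snd.comp contDiff_snd)
  have h2 := (primitive E).contDiff.comp h1
  have h3 : ContDiff ℝ ∞ (fun p : E × ℝ × C(Icc (0 : ℝ) 1, E) =>
      ContinuousLinearMap.const ℝ (Icc (0 : ℝ) 1) p.1) :=
    (ContinuousLinearMap.const ℝ (M := E) (Icc (0 : ℝ) 1)).contDiff.comp contDiff_fst
  refine contDiff_fst.prodMk ((contDiff_fst.comp contDiff_snd).prodMk ?_)
  exact ((contDiff_snd.comp contDiff_snd).sub h3).sub ((contDiff_fst.comp contDiff_snd).smul h2)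

/-- The shear `(x, τ, α) ↦ (x, τ, α - x - τ w)`. -/
def shear (w : C(Icc (0 : ℝ) 1, E)) :
    (E × ℝ × C(Icc (0 : ℝ) 1, E)) ≃L[ℝ] (E × ℝ × C(Icc (0 : ℝ) 1, E)) :=
  ContinuousLinearEquiv.equivOfInverse
    ((ContinuousLinearMap.fst ℝ _ _).prod
      (((ContinuousLinearMap.fst ℝ _ _).comp (ContinuousLinearMap.snd ℝ _ _)).prod
        ((ContinuousLinearMap.snd ℝ _ _).comp (ContinuousLinearMap.snd ℝ _ _)
          - (ContinuousLinearMap.const ℝ (Icc (0 : ℝ) 1)).comp (ContinuousLinearMap.fst ℝ _ _)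
          - ((ContinuousLinearMap.fst ℝ _ _).comp (ContinuousLinearMap.snd ℝ _ _)).smulRight w)))
    ((ContinuousLinearMap.fst ℝ _ _).prod
      (((ContinuousLinearMap.fst ℝ _ _).comp (ContinuousLinearMap.snd ℝ _ _)).prod
        ((ContinuousLinearMap.snd ℝ _ _).comp (ContinuousLinearMap.snd ℝ _ _)
          + (ContinuousLinearMap.const ℝ (Icc (0 : ℝ) 1)).comp (ContinuousLinearMap.fst ℝ _ _)
          + ((ContinuousLinearMap.fst ℝ _ _).comp (ContinuousLinearMap.snd ℝ _ _)).smulRight w)))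
    (by rintro ⟨x, τ, α⟩; simp; abel) (by rintro ⟨x, τ, α⟩; simp; abel)

/-- At `τ = 0` the factor `τ` kills the derivative of the integral term in `α`. What remains is a
shear, invertible whatever `f` is, so no contraction estimate is needed. -/
theorem hasFDerivAt_shootingMap {f : E → E} (hf : ContDiff ℝ ∞ f) (x : E)
    (α : C(Icc (0 : ℝ) 1, E)) :
    HasFDerivAt (shootingMap hf)
      (shear (primitive E ((⟨f, hf.continuous⟩ : C(E, E)).comp α)) :
        (E × ℝ × C(Icc (0 : ℝ) 1, E)) →L[ℝ] (E × ℝ × C(Icc (0 : ℝ) 1, E))) (x, 0, α) := by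
  have h1 : DifferentiableAt ℝ (fun p : E × ℝ × C(Icc (0 : ℝ) 1, E) =>
      primitive E ((⟨f, hf.continuous⟩ : C(E, E)).comp p.2.2)) (x, 0, α) :=
    (((primitive E).contDiff.comp ((contDiff_continuousMap_comp hf).comp
      (contDiff_snd.comp contDiff_snd))).differentiable (by simp)) _
  have hfst : HasFDerivAt (fun p : E × ℝ × C(Icc (0 : ℝ) 1, E) => p.1)
    (ContinuousLinearMap.fst ℝ _ _) (x, 0, α) := hasFDerivAt_fst
  have hτ : HasFDerivAt (fun p : E × ℝ × C(Icc (0 : ℝ) 1, E) => p.2.1)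
    ((ContinuousLinearMap.fst ℝ _ _).comp (ContinuousLinearMap.snd ℝ _ _)) (x, 0, α) :=
    hasFDerivAt_fst.comp _ hasFDerivAt_snd
  have hα : HasFDerivAt (fun p : E × ℝ × C(Icc (0 : ℝ) 1, E) => p.2.2)
    ((ContinuousLinearMap.snd ℝ _ _).comp (ContinuousLinearMap.snd ℝ _ _)) (x, 0, α) :=
    hasFDerivAt_snd.comp _ hasFDerivAt_snd
  have hc := (ContinuousLinearMap.const ℝ (M := E) (Icc (0 : ℝ) 1)).hasFDerivAt.comp
    (x, (0 : ℝ), α) hfst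
  have h := hfst.prodMk (hτ.prodMk ((hα.sub hc).sub (hτ.smul h1.hasFDerivAt)))
  refine h.congr_fderiv ?_
  ext <;> simp [shear]

theorem snd_snd_eq_of_shootingMap_eq {f : E → E} (hf : ContDiff ℝ ∞ f) {x : E} {τ : ℝ}
    {p : E × ℝ × C(Icc (0 : ℝ) 1, E)} (h : shootingMap hf p = (x, τ, 0)) :
    p = (x, τ, p.2.2) ∧ p.2.2 = ContinuousLinearMap.const ℝ (Icc (0 : ℝ) 1) x
      + τ • primitive E ((⟨f, hf.continuous⟩ : C(E, E)).comp p.2.2) := by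
  obtain ⟨y, σ, α⟩ := p
  simp only [shootingMap, Prod.mk.injEq] at h
  obtain ⟨rfl, rfl, h⟩ := h
  refine ⟨rfl, ?_⟩
  rw [sub_sub, sub_eq_zero] at h
  exact h

theorem shootingMap_rescale {f : E → E} (hf : ContDiff ℝ ∞ f) {x : E} {τ : ℝ}
    {α : C(Icc (0 : ℝ) 1, E)} (h : α = ContinuousLinearMap.const ℝ (Icc (0 : ℝ) 1) x
      + τ • primitive E ((⟨f, hf.continuous⟩ : C(E, E)).comp α)) (l : Icc (0 : ℝ) 1) :
    shootingMap hf (x, l * τ, rescale l α) = (x, l * τ, 0) := by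
  simp only [shootingMap, Prod.mk.injEq, true_and]
  have h1 : (⟨f, hf.continuous⟩ : C(E, E)).comp (rescale l α)
      = rescale l ((⟨f, hf.continuous⟩ : C(E, E)).comp α) := rfl
  rw [h1, mul_comm, mul_smul, primitive_rescale, sub_sub, sub_eq_zero]
  conv_lhs => rw [h]
  rfl

/-- Keeps a rescaled solution in the ball where the shooting map is injective. -/
theorem norm_rescale_sub_const_le (l : Icc (0 : ℝ) 1) (α : C(Icc (0 : ℝ) 1, E)) (x : E) :
    ‖rescale l α - ContinuousLinearMap.const ℝ (Icc (0 : ℝ) 1) x‖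
      ≤ ‖α - ContinuousLinearMap.const ℝ (Icc (0 : ℝ) 1) x‖ := by
  rw [ContinuousMap.norm_le _ (norm_nonneg _)]
  intro t
  exact (α - ContinuousLinearMap.const ℝ (Icc (0 : ℝ) 1) x).norm_coe_le_norm (l * t)

variable [CompleteSpace E]

theorem hasDerivWithinAt_of_eq_primitive {f : E → E} (hf : ContDiff ℝ ∞ f) {x : E} {τ : ℝ}
    {α : C(Icc (0 : ℝ) 1, E)} (h : α = ContinuousLinearMap.const ℝ (Icc (0 : ℝ) 1) x
      + τ • primitive E ((⟨f, hf.continuous⟩ : C(E, E)).comp α)) {l : ℝ} (hl : l ∈ Icc (0 : ℝ) 1) :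
    HasDerivWithinAt (IccExtend zero_le_one α) (τ • f (IccExtend zero_le_one α l))
      (Icc (0 : ℝ) 1) l := by
  have hcont : Continuous (fun u : ℝ => f (IccExtend zero_le_one α u)) :=
    hf.continuous.comp α.continuous.Icc_extend'
  have h1 : HasDerivAt (fun u : ℝ => x + τ • ∫ v in (0 : ℝ)..u, f (IccExtend zero_le_one α v))
      (τ • f (IccExtend zero_le_one α l)) l :=
    ((hcont.integral_hasStrictDerivAt 0 l).hasDerivAt.const_smul τ).const_add x
  have h2 : ∀ u ∈ Icc (0 : ℝ) 1, IccExtend zero_le_one α u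
      = x + τ • ∫ v in (0 : ℝ)..u, f (IccExtend zero_le_one α v) := by
    intro u hu
    rw [IccExtend_of_mem _ _ hu]
    conv_lhs => rw [h]
    rfl
  exact h1.hasDerivWithinAt.congr h2 (h2 l hl)

/-- Local inversion of the shooting map at the constant curve gives a solution curve on `[0, 1]`
depending smoothly on `(x, τ)`, and the flow is its value at `1`. That this value solves the
equation in `τ` is not built in: by injectivity, the curves for different `τ` are rescaled pieces of
one another, so `Fl (l * τ, x)` is the curve for `τ` at parameter `l`. -/
theorem exists_smooth_flow_of_contDiff {f : E → E} (hf : ContDiff ℝ ∞ f) (x₀ : E) :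
    ∃ δ > (0 : ℝ), ∃ W : Set E, IsOpen W ∧ x₀ ∈ W ∧ ∃ Fl : ℝ × E → E,
      ContDiffOn ℝ ∞ Fl (Ioo (-δ) δ ×ˢ W) ∧ (∀ x ∈ W, Fl (0, x) = x) ∧
      ∀ x ∈ W, ∀ t ∈ Ioo (-δ) δ, HasDerivAt (fun u => Fl (u, x)) (f (Fl (t, x))) t := by
  set α₀ : C(Icc (0 : ℝ) 1, E) := ContinuousLinearMap.const ℝ (Icc (0 : ℝ) 1) x₀ with hα₀
  have hsm := contDiff_shootingMap hf
  have hder := hasFDerivAt_shootingMap hf x₀ α₀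
  set P := hsm.contDiffAt.toOpenPartialHomeomorph (shootingMap hf) hder (by simp) with hP
  have hPcoe : (P : _ → _) = shootingMap hf := rfl
  have hmem : (x₀, (0 : ℝ), α₀) ∈ P.source := hsm.contDiffAt.mem_toOpenPartialHomeomorph_source hder (by simp)
  have hval : P (x₀, (0 : ℝ), α₀) = (x₀, 0, 0) := by
    rw [hPcoe]; simp [shootingMap, hα₀]
  -- a neighbourhood of the base point on which the derivative is invertible
  have hinv : ∀ᶠ p in 𝓝 (x₀, (0 : ℝ), α₀), fderiv ℝ (shootingMap hf) p ∈
      range (ContinuousLinearEquiv.toContinuousLinearMap :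
        ((E × ℝ × C(Icc (0 : ℝ) 1, E)) ≃L[ℝ] (E × ℝ × C(Icc (0 : ℝ) 1, E))) → _) := by
    have hc : ContinuousAt (fderiv ℝ (shootingMap hf)) (x₀, (0 : ℝ), α₀) :=
      (hsm.continuous_fderiv (by simp)).continuousAt
    apply hc
    rw [hder.fderiv]
    exact ContinuousLinearEquiv.nhds _
  obtain ⟨r, hr, hball⟩ := Metric.eventually_nhds_iff_ball.1
    (hinv.and (P.open_source.mem_nhds hmem))
  -- the parameters whose solution lies in this neighbourhood
  have hsymm : ContinuousAt P.symm (x₀, (0 : ℝ), (0 : C(Icc (0 : ℝ) 1, E))) := by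
    rw [← hval]
    exact P.continuousAt_symm (P.map_source hmem)
  have hsymmval : P.symm (x₀, (0 : ℝ), (0 : C(Icc (0 : ℝ) 1, E))) = (x₀, 0, α₀) := by
    rw [← hval, P.left_inv hmem]
  have hev : ∀ᶠ q : ℝ × E in 𝓝 ((0 : ℝ), x₀),
      (q.2, q.1, (0 : C(Icc (0 : ℝ) 1, E))) ∈ P.target ∧
      P.symm (q.2, q.1, (0 : C(Icc (0 : ℝ) 1, E))) ∈ Metric.ball (x₀, (0 : ℝ), α₀) r := by
    have hcont : ContinuousAt (fun q : ℝ × E => (q.2, q.1, (0 : C(Icc (0 : ℝ) 1, E))))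
      ((0 : ℝ), x₀) := by fun_prop
    refine (hcont.eventually (P.open_target.mem_nhds ?_)).and
      ((ContinuousAt.comp (f := fun q : ℝ × E => (q.2, q.1, (0 : C(Icc (0 : ℝ) 1, E))))
        (g := P.symm) hsymm hcont).eventually (Metric.isOpen_ball.mem_nhds ?_))
    · change (x₀, (0 : ℝ), (0 : C(Icc (0 : ℝ) 1, E))) ∈ P.target
      rw [← hval]; exact P.map_source hmem
    · change P.symm (x₀, (0 : ℝ), (0 : C(Icc (0 : ℝ) 1, E))) ∈ _
      rw [hsymmval]; exact Metric.mem_ball_self hr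
  obtain ⟨ρ, hρ, hρball⟩ := Metric.eventually_nhds_iff_ball.1 hev
  have hdom : ∀ t ∈ Ioo (-ρ) ρ, ∀ x ∈ Metric.ball x₀ ρ, (t, x) ∈ Metric.ball ((0 : ℝ), x₀) ρ := by
    intro t ht x hx
    rw [← ball_prod_same]
    exact ⟨by simpa [Real.ball_eq_Ioo] using ht, hx⟩
  set sol : ℝ × E → E × ℝ × C(Icc (0 : ℝ) 1, E) := fun q => P.symm (q.2, q.1, 0) with hsol
  have hsolspec : ∀ t ∈ Ioo (-ρ) ρ, ∀ x ∈ Metric.ball x₀ ρ,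
      shootingMap hf (sol (t, x)) = (x, t, 0) := fun t ht x hx => by
    rw [← hPcoe]; exact P.right_inv (hρball _ (hdom t ht x hx)).1
  have hscale : ∀ t ∈ Ioo (-ρ) ρ, ∀ x ∈ Metric.ball x₀ ρ, ∀ l : Icc (0 : ℝ) 1,
      (sol (l * t, x)).2.2 = rescale l (sol (t, x)).2.2 := by
    intro t ht x hx l
    have hlt : (l : ℝ) * t ∈ Ioo (-ρ) ρ := by
      rw [mem_Ioo, ← abs_lt] at ht ⊢
      rw [abs_mul, abs_of_nonneg l.2.1]
      exact (mul_le_of_le_one_left (abs_nonneg t) l.2.2).trans_lt ht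
    obtain ⟨he, hfix⟩ := snd_snd_eq_of_shootingMap_eq hf (hsolspec t ht x hx)
    have hin : sol (t, x) ∈ Metric.ball (x₀, (0 : ℝ), α₀) r := (hρball _ (hdom t ht x hx)).2
    have hin' : (x, (l : ℝ) * t, rescale l (sol (t, x)).2.2) ∈ Metric.ball (x₀, (0 : ℝ), α₀) r := by
      rw [he] at hin
      simp only [Metric.mem_ball, Prod.dist_eq, max_lt_iff] at hin ⊢
      simp only [dist_eq_norm] at hin ⊢
      refine ⟨hin.1, ?_, (norm_rescale_sub_const_le l _ x₀).trans_lt hin.2.2⟩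
      rw [sub_zero, Real.norm_eq_abs, abs_mul, abs_of_nonneg l.2.1]
      have := hin.2.1
      rw [sub_zero, Real.norm_eq_abs] at this
      exact (mul_le_of_le_one_left (abs_nonneg t) l.2.2).trans_lt this
    have heq : sol (l * t, x) = (x, (l : ℝ) * t, rescale l (sol (t, x)).2.2) := by
      apply P.injOn (hball _ (hρball _ (hdom _ hlt x hx)).2).2 (hball _ hin').2
      rw [hPcoe]
      exact (hsolspec _ hlt x hx).trans (shootingMap_rescale hf hfix l).symm
    rw [heq]
  have hone : (1 : ℝ) ∈ Icc (0 : ℝ) 1 := by simp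
  have hsmooth : ContDiffOn ℝ ∞ (fun q : ℝ × E => (sol q).2.2 ⟨1, hone⟩)
      (Ioo (-ρ) ρ ×ˢ Metric.ball x₀ ρ) := by
    rintro ⟨t, x⟩ ⟨ht, hx⟩
    obtain ⟨hq1, hq2⟩ := hρball _ (hdom t ht x hx)
    obtain ⟨e, he⟩ := (hball _ hq2).1
    have h1 : ContDiffAt ℝ ∞ P.symm (x, t, (0 : C(Icc (0 : ℝ) 1, E))) :=
      P.contDiffAt_symm hq1 (f₀' := e) (by
        rw [he]
        exact ((hsm.differentiable (by simp)) _).hasFDerivAt) hsm.contDiffAt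
    have h2 : ContDiffAt ℝ ∞ sol (t, x) :=
      ContDiffAt.comp (g := P.symm) (t, x) h1
        (contDiffAt_snd.prodMk (contDiffAt_fst.prodMk contDiffAt_const))
    exact (((ContinuousMap.evalCLM ℝ (⟨1, hone⟩ : Icc (0 : ℝ) 1)).contDiff.contDiffAt).comp _
      (contDiffAt_snd.comp _ (contDiffAt_snd.comp _ h2))).contDiffWithinAt
  refine ⟨ρ, hρ, Metric.ball x₀ ρ, Metric.isOpen_ball, Metric.mem_ball_self hρ,
    fun q => (sol q).2.2 ⟨1, hone⟩, hsmooth, ?_, ?_⟩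
  · intro x hx
    have h0 : (0 : ℝ) ∈ Ioo (-ρ) ρ := by simp [hρ]
    have h := (snd_snd_eq_of_shootingMap_eq hf (hsolspec 0 h0 x hx)).2
    rw [zero_smul, add_zero] at h
    change (sol (0, x)).2.2 ⟨1, hone⟩ = x
    rw [h]
    rfl
  · intro x hx t ht
    -- The midpoint between `t` and the end of the interval on the side of `t` lies beyond `t` and
    -- is nonzero even when `t = 0`.
    obtain ⟨τ, hτ, hτ0, l, hl, htl⟩ :
        ∃ τ ∈ Ioo (-ρ) ρ, τ ≠ 0 ∧ ∃ l ∈ Icc (0 : ℝ) 1, l * τ = t := by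
      rcases le_or_gt 0 t with h0 | h0
      · refine ⟨(t + ρ) / 2, ⟨by linarith [ht.2], by linarith [ht.2]⟩, by linarith,
          t / ((t + ρ) / 2), ⟨by positivity, ?_⟩, ?_⟩
        · rw [div_le_one (by linarith)]; linarith [ht.2]
        · field_simp
      · refine ⟨(t - ρ) / 2, ⟨by linarith [ht.1], by linarith [ht.1]⟩, by linarith,
          t / ((t - ρ) / 2), ⟨?_, ?_⟩, ?_⟩
        · exact div_nonneg_of_nonpos h0.le (by linarith)
        · rw [div_le_one_of_neg (by linarith)]; linarith [ht.1]
        · have : t - ρ ≠ 0 := by linarith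
          field_simp
    have hfix := (snd_snd_eq_of_shootingMap_eq hf (hsolspec τ hτ x hx)).2
    set α := (sol (τ, x)).2.2 with hα
    have hFl : ∀ u : ℝ, u / τ ∈ Icc (0 : ℝ) 1 →
        (sol (u, x)).2.2 ⟨1, hone⟩ = IccExtend zero_le_one α (u / τ) := by
      intro u hu
      have h1 := hscale τ hτ x hx ⟨u / τ, hu⟩
      rw [show ((⟨u / τ, hu⟩ : Icc (0 : ℝ) 1) : ℝ) * τ = u from div_mul_cancel₀ u hτ0] at h1
      rw [h1, IccExtend_of_mem _ _ hu]
      change α (⟨u / τ, hu⟩ * 1) = _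
      rw [mul_one]
    set s : Set ℝ := (fun u => u / τ) ⁻¹' Icc (0 : ℝ) 1 with hs
    have hts : t ∈ s := by
      change t / τ ∈ Icc (0 : ℝ) 1
      rwa [← htl, mul_div_cancel_right₀ _ hτ0]
    have hlt : t / τ = l := by rw [← htl, mul_div_cancel_right₀ _ hτ0]
    have hd := hasDerivWithinAt_of_eq_primitive hf hfix (l := t / τ) (by rwa [hlt])
    have hd2 : HasDerivWithinAt (fun u => IccExtend zero_le_one α (u / τ))
        (f (IccExtend zero_le_one α (t / τ))) s t := by
      have h1 := hd.scomp (h := fun u : ℝ => u / τ) (s := s) t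
        (((hasDerivAt_id t).div_const τ).hasDerivWithinAt) (fun u hu => hu)
      rwa [smul_smul, one_div, inv_mul_cancel₀ hτ0, one_smul] at h1
    have hd3 : HasDerivWithinAt (fun u => (sol (u, x)).2.2 ⟨1, hone⟩)
        (f ((sol (t, x)).2.2 ⟨1, hone⟩)) s t := by
      rw [hFl t hts]
      exact hd2.congr (fun u hu => hFl u hu) (hFl t hts)
    -- The time `t = 0` is an end point of `s`, where the curve `α` yields only a one-sided
    -- derivative. Joint smoothness supplies the two-sided one, and unique differentiability of `s`
    -- identifies the two.
    have hdiff : DifferentiableAt ℝ (fun u => (sol (u, x)).2.2 ⟨1, hone⟩) t := by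
      have h1 : DifferentiableAt ℝ (fun q : ℝ × E => (sol q).2.2 ⟨1, hone⟩) (t, x) :=
        (hsmooth.contDiffAt ((isOpen_Ioo.prod Metric.isOpen_ball).mem_nhds ⟨ht, hx⟩)
          ).differentiableAt (by simp)
      exact h1.comp (f := fun u : ℝ => (u, x)) t (by fun_prop)
    have huniq : UniqueDiffWithinAt ℝ s t := by
      have hconv : Convex ℝ s := (convex_Icc (0 : ℝ) 1).linear_preimage
        ((LinearMap.id : ℝ →ₗ[ℝ] ℝ).smulRight (τ⁻¹))
      refine uniqueDiffWithinAt_convex hconv ⟨τ / 2, ?_⟩ (subset_closure hts)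
      rw [mem_interior_iff_mem_nhds]
      apply (continuous_id.div_const τ).continuousAt
      apply Icc_mem_nhds <;> simp only [id] <;> field_simp <;> norm_num
    rw [← huniq.eq_deriv _ hdiff.hasDerivAt.hasDerivWithinAt hd3]
    exact hdiff.hasDerivAt

end Flow
end SprayGeometry
end

noncomputable section

namespace SprayGeometry

/-! ### Local flows of fields on open sets, and uniqueness of solutions. -/

section LocalFlow

universe u

variable {E : Type u} [NormedAddCommGroup E] [NormedSpace ℝ E]

/-- Multiplication by a bump function supported in a closed ball inside `U`. It makes a field on an
open set global, as the flow construction requires. -/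
theorem exists_contDiff_eventuallyEq [FiniteDimensional ℝ E] {f : E → E} {U : Set E}
    (hU : IsOpen U) (hf : ContDiffOn ℝ ∞ f U) {x₀ : E} (hx₀ : x₀ ∈ U) :
    ∃ g : E → E, ContDiff ℝ ∞ g ∧ g =ᶠ[𝓝 x₀] f := by
  obtain ⟨r, hr, hrU⟩ := Metric.nhds_basis_closedBall.mem_iff.1 (hU.mem_nhds hx₀)
  let χ : ContDiffBump x₀ := ⟨r / 2, r, by positivity, by linarith⟩
  refine ⟨fun x => χ x • f x, ?_, ?_⟩
  · rw [contDiff_iff_contDiffAt]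
    intro x
    by_cases hx : x ∈ U
    · exact χ.contDiff.contDiffAt.smul (hf.contDiffAt (hU.mem_nhds hx))
    · have hx' : x ∉ tsupport χ := by
        rw [χ.tsupport_eq]
        exact fun h => hx (hrU h)
      have h0 : (fun x => χ x • f x) =ᶠ[𝓝 x] fun _ => 0 := by
        filter_upwards [(isClosed_tsupport (χ : E → ℝ)).isOpen_compl.mem_nhds hx'] with y hy
        rw [image_eq_zero_of_notMem_tsupport hy, zero_smul]
      exact contDiffAt_const.congr_of_eventuallyEq h0
  · filter_upwards [χ.eventuallyEq_one] with x hx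
    simp [hx]

/-- Existence of a smooth local flow. -/
theorem exists_smooth_flow [FiniteDimensional ℝ E] {f : E → E} {U : Set E}
    (hU : IsOpen U) (hf : ContDiffOn ℝ ∞ f U) {x₀ : E} (hx₀ : x₀ ∈ U) :
    ∃ δ > (0 : ℝ), ∃ W : Set E, IsOpen W ∧ x₀ ∈ W ∧ ∃ Fl : ℝ × E → E,
      ContDiffOn ℝ ∞ Fl (Ioo (-δ) δ ×ˢ W) ∧ (∀ x ∈ W, Fl (0, x) = x) ∧
      ∀ x ∈ W, ∀ t ∈ Ioo (-δ) δ, Fl (t, x) ∈ U ∧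
        HasDerivAt (fun u => Fl (u, x)) (f (Fl (t, x))) t := by
  have : CompleteSpace E := FiniteDimensional.complete ℝ E
  obtain ⟨g, hg, hgf⟩ := exists_contDiff_eventuallyEq hU hf hx₀
  obtain ⟨δ, hδ, W, hW, hxW, Fl, hsm, hzero, hode⟩ := exists_smooth_flow_of_contDiff hg x₀
  have h0 : (0 : ℝ) ∈ Ioo (-δ) δ := by simp [hδ]
  have hcont : ContinuousAt Fl (0, x₀) :=
    hsm.continuousOn.continuousAt ((isOpen_Ioo.prod hW).mem_nhds ⟨h0, hxW⟩)
  -- For small times and nearby points the flow stays where the cut-off field `g` agrees with `f`.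
  have hev : ∀ᶠ q in 𝓝 ((0 : ℝ), x₀), g (Fl q) = f (Fl q) ∧ Fl q ∈ U := by
    rw [ContinuousAt, hzero x₀ hxW] at hcont
    exact hcont.eventually (hgf.and (hU.mem_nhds hx₀))
  obtain ⟨ρ, hρ, hball⟩ := Metric.eventually_nhds_iff_ball.1 hev
  have hIoo : Ioo (-min δ ρ) (min δ ρ) ⊆ Ioo (-δ) δ :=
    Ioo_subset_Ioo (neg_le_neg (min_le_left _ _)) (min_le_left _ _)
  refine ⟨min δ ρ, lt_min hδ hρ, W ∩ Metric.ball x₀ ρ, hW.inter Metric.isOpen_ball,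
    ⟨hxW, Metric.mem_ball_self hρ⟩, Fl, hsm.mono (prod_mono hIoo inter_subset_left),
    fun x hx => hzero x hx.1, fun x hx t ht => ?_⟩
  have hmem : (t, x) ∈ Metric.ball ((0 : ℝ), x₀) ρ := by
    rw [← ball_prod_same]
    refine ⟨?_, hx.2⟩
    rw [Real.ball_eq_Ioo]
    exact ⟨by linarith [ht.1, min_le_right δ ρ], by linarith [ht.2, min_le_right δ ρ]⟩
  refine ⟨(hball _ hmem).2, ?_⟩
  rw [← (hball _ hmem).1]
  exact hode x hx.1 t (hIoo ht)

/-- Uniqueness of integral curves of a `C¹` vector field on an open set. -/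
theorem eqOn_of_hasDerivAt_of_contDiffOn {f : E → E} {U : Set E} (hU : IsOpen U)
    (hf : ContDiffOn ℝ 1 f U) {I : Set ℝ} (hI : IsOpen I) (hI' : IsPreconnected I)
    {z w : ℝ → E} (hz : ∀ t ∈ I, z t ∈ U ∧ HasDerivAt z (f (z t)) t)
    (hw : ∀ t ∈ I, w t ∈ U ∧ HasDerivAt w (f (w t)) t) {t₀ : ℝ} (ht₀ : t₀ ∈ I)
    (h₀ : z t₀ = w t₀) : EqOn z w I := by
  have hloc : ∀ t ∈ I, z t = w t → z =ᶠ[𝓝 t] w := by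
    intro t ht hzw
    obtain ⟨K, s, hs, hlip⟩ := (hf.contDiffAt (hU.mem_nhds (hz t ht).1)).exists_lipschitzOnWith
    refine ODE_solution_unique_of_eventually (v := fun _ => f) (s := fun _ => s) (K := K)
      (Filter.Eventually.of_forall fun _ => hlip) ?_ ?_ hzw
    · filter_upwards [hI.mem_nhds ht, (hz t ht).2.continuousAt.eventually hs] with u hu hus
      exact ⟨(hz u hu).2, hus⟩
    · rw [hzw] at hs
      filter_upwards [hI.mem_nhds ht, (hw t ht).2.continuousAt.eventually hs] with u hu hus
      exact ⟨(hw u hu).2, hus⟩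
  -- Agreement near a time is an open condition. It is closed in `I` because distinct values at `t`
  -- would, by continuity, stay distinct near `t`.
  have hsub : I ⊆ {t | z =ᶠ[𝓝 t] w} := by
    refine hI'.subset_of_closure_inter_subset isOpen_setOfPred_eventually_nhds
      ⟨t₀, ht₀, hloc t₀ ht₀ h₀⟩ ?_
    rintro t ⟨htc, ht⟩
    apply hloc t ht
    by_contra hne
    have hne' : ∀ᶠ u in 𝓝 t, z u ≠ w u :=
      ((hz t ht).2.continuousAt.prodMk (hw t ht).2.continuousAt).eventually
        (isOpen_ne_fun continuous_fst continuous_snd |>.mem_nhds hne)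
    obtain ⟨u, hu, hu'⟩ := mem_closure_iff_nhds.1 htc _ hne'
    exact hu hu'.self_of_nhds
  exact fun t ht => (hsub ht).self_of_nhds

/-- A solution of a homogeneous linear equation that vanishes somewhere vanishes. -/
theorem eq_zero_of_hasDerivWithinAt_linear {I : Set ℝ} (hI : I.OrdConnected)
    {A : ℝ → E →L[ℝ] E} (hA : ContinuousOn A I) {u : ℝ → E}
    (hu : ∀ t ∈ I, HasDerivWithinAt u (A t (u t)) I t) {t₀ : ℝ} (ht₀ : t₀ ∈ I) (h₀ : u t₀ = 0) :
    ∀ t ∈ I, u t = 0 := by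
  -- On compact subintervals `A` is bounded, so the right-hand side is uniformly Lipschitz there.
  have hbound : ∀ a ∈ I, ∀ b ∈ I, ∃ K : NNReal, ∀ t ∈ Icc a b,
      LipschitzOnWith K (fun x => A t x) univ := by
    intro a ha b hb
    obtain ⟨K, hK⟩ := isCompact_Icc.exists_bound_of_continuousOn (hA.mono (hI.out ha hb))
    refine ⟨K.toNNReal, fun t ht => ?_⟩
    exact ((A t).lipschitz.weaken (by
      rw [← NNReal.coe_le_coe, coe_nnnorm]
      exact (hK t ht).trans (Real.le_coe_toNNReal K))).lipschitzOnWith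
  intro t ht
  have hcont : ContinuousOn u I := fun t ht => (hu t ht).continuousWithinAt
  have hzero : ∀ s : Set ℝ, ∀ r, HasDerivWithinAt (fun _ => (0 : E)) (A r 0) s r := fun s r => by
    rw [map_zero]; exact hasDerivWithinAt_const ..
  rcases le_total t₀ t with h | h
  · obtain ⟨K, hK⟩ := hbound t₀ ht₀ t ht
    refine ODE_solution_unique_of_mem_Icc_right (v := fun t x => A t x) (s := fun _ => univ)
      (g := fun _ => 0) (fun r hr => hK r (Ico_subset_Icc_self hr)) (hcont.mono (hI.out ht₀ ht))
      (fun r hr => ?_) (fun _ _ => mem_univ _) continuousOn_const (fun r _ => hzero _ r)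
      (fun _ _ => mem_univ _) h₀ ⟨h, le_rfl⟩
    have hrI := hI.out ht₀ ht (Ico_subset_Icc_self hr)
    exact (hu r hrI).mono_of_mem_nhdsWithin
      (Filter.mem_of_superset (Icc_mem_nhdsGE hr.2) (hI.out hrI ht))
  · obtain ⟨K, hK⟩ := hbound t ht t₀ ht₀
    refine ODE_solution_unique_of_mem_Icc_left (v := fun t x => A t x) (s := fun _ => univ)
      (g := fun _ => 0) (fun r hr => hK r (Ioc_subset_Icc_self hr)) (hcont.mono (hI.out ht ht₀))
      (fun r hr => ?_) (fun _ _ => mem_univ _) continuousOn_const (fun r _ => hzero _ r)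
      (fun _ _ => mem_univ _) h₀ ⟨le_rfl, h⟩
    have hrI := hI.out ht ht₀ (Ioc_subset_Icc_self hr)
    exact (hu r hrI).mono_of_mem_nhdsWithin
      (Filter.mem_of_superset (Icc_mem_nhdsLE hr.1) (hI.out ht hrI))

end LocalFlow

end SprayGeometry
end

noncomputable section

namespace SprayGeometry

/-! ### Sprays in induced coordinates. -/

section Coordinates

set_option linter.unusedSectionVars false

variable {n : ℕ} {M : Type*} [TopologicalSpace M] [ChartedSpace (Model n) M]
  [IsManifold 𝓘(ℝ, Model n) ∞ M]

theorem isOpen_proj_preimage (φ : OpenPartialHomeomorph M (Model n)) :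
    IsOpen ((fun v : TM n M => v.proj) ⁻¹' φ.source) :=
  φ.open_source.preimage (FiberBundle.continuous_proj (Model n) (TangentSpace 𝓘(ℝ, Model n)))

variable {φ : OpenPartialHomeomorph M (Model n)}

theorem mdifferentiable_chart (hφ : φ ∈ IsManifold.maximalAtlas 𝓘(ℝ, Model n) ∞ M) :
    φ.MDifferentiable 𝓘(ℝ, Model n) 𝓘(ℝ, Model n) :=
  ⟨(contMDiffOn_of_mem_maximalAtlas hφ).mdifferentiableOn (by simp),
    (contMDiffOn_symm_of_mem_maximalAtlas hφ).mdifferentiableOn (by simp)⟩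

theorem contMDiffOn_coordTM (hφ : φ ∈ IsManifold.maximalAtlas 𝓘(ℝ, Model n) ∞ M) :
    ContMDiffOn (modelTM n) 𝓘(ℝ, Model n × Model n) ∞ (coordTM φ)
      ((fun v : TM n M => v.proj) ⁻¹' φ.source) := by
  have hφs := contMDiffOn_of_mem_maximalAtlas hφ
  have h1 : ContMDiffOn (modelTM n) 𝓘(ℝ, Model n) ∞ (fun v : TM n M => φ v.proj)
      ((fun v : TM n M => v.proj) ⁻¹' φ.source) :=
    hφs.comp (Bundle.contMDiff_proj (TangentSpace 𝓘(ℝ, Model n))).contMDiffOn (fun v hv => hv)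
  have h2 := hφs.contMDiffOn_tangentMapWithin (m := ∞) (by simp) φ.open_source.uniqueMDiffOn
  have h3 := (contMDiff_snd_tangentBundle_modelSpace (n := ∞) (Model n) 𝓘(ℝ, Model n)).comp_contMDiffOn h2
  refine h1.prodMk_space (h3.congr ?_)
  intro v hv
  simp only [Function.comp, tangentMapWithin]
  rw [mfderivWithin_of_isOpen φ.open_source hv]

theorem contMDiff_mk_tangentBundle_model :
    ContMDiff 𝓘(ℝ, Model n × Model n) (modelTM n) ∞
      (fun z : Model n × Model n => (⟨z.1, z.2⟩ : TangentBundle 𝓘(ℝ, Model n) (Model n))) := by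
  have h := contMDiff_tangentBundleModelSpaceHomeomorph_symm (n := ∞) (I := 𝓘(ℝ, Model n))
  rw [tangentBundleModelSpaceHomeomorph_coe_symm] at h
  rw [modelWithCornersSelf_prod]
  exact h

theorem contMDiffOn_ofCoordTM (hφ : φ ∈ IsManifold.maximalAtlas 𝓘(ℝ, Model n) ∞ M) :
    ContMDiffOn 𝓘(ℝ, Model n × Model n) (modelTM n) ∞ (ofCoordTM φ : _ → TM n M)
      (φ.target ×ˢ univ) := by
  have hφs := contMDiffOn_symm_of_mem_maximalAtlas hφ
  have h2 := hφs.contMDiffOn_tangentMapWithin (m := ∞) (by simp) φ.open_target.uniqueMDiffOn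
  have h3 := h2.comp (contMDiff_mk_tangentBundle_model (n := n)).contMDiffOn
    (s := φ.target ×ˢ univ) (fun z hz => hz.1)
  refine h3.congr ?_
  intro z hz
  simp only [Function.comp, tangentMapWithin]
  rw [mfderivWithin_of_isOpen φ.open_target hz.1]
  rfl

theorem coordTM_ofCoordTM (hφ : φ ∈ IsManifold.maximalAtlas 𝓘(ℝ, Model n) ∞ M)
    {z : Model n × Model n} (hz : z.1 ∈ φ.target) : coordTM φ (ofCoordTM φ z : TM n M) = z := by
  have h := (mdifferentiable_chart hφ).comp_symm_deriv hz
  refine Prod.ext (φ.right_inv hz) ?_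
  exact congrArg (fun L => L z.2) h

/-- The fibre components have different types, but every tangent space is by definition the model
space; comparing them there avoids transport along the equality of base points. -/
theorem ext_TM {v w : TM n M} (h : v.proj = w.proj) (h' : (v.2 : Model n) = (w.2 : Model n)) :
    v = w := by
  obtain ⟨x, y⟩ := v
  obtain ⟨x', y'⟩ := w
  obtain rfl : x = x' := h
  obtain rfl : y = y' := h'
  rfl

theorem ofCoordTM_coordTM (hφ : φ ∈ IsManifold.maximalAtlas 𝓘(ℝ, Model n) ∞ M)
    {v : TM n M} (hv : v.proj ∈ φ.source) : ofCoordTM φ (coordTM φ v) = v := by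
  have h := (mdifferentiable_chart hφ).symm_comp_deriv hv
  exact ext_TM (φ.left_inv hv) (congrArg (fun L => L v.2) h)

theorem ofCoordTM_mem_slashed (hφ : φ ∈ IsManifold.maximalAtlas 𝓘(ℝ, Model n) ∞ M)
    {z : Model n × Model n} (hz : z.1 ∈ φ.target) (hz' : z.2 ≠ 0) :
    (ofCoordTM φ z : TM n M) ∈ slashed n M := by
  intro h
  apply hz'
  have h1 : mfderiv 𝓘(ℝ, Model n) 𝓘(ℝ, Model n) φ (φ.symm z.1) (ofCoordTM φ z : TM n M).2 = 0 := by
    rw [h]; exact map_zero _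
  have h2 := congrArg Prod.snd (coordTM_ofCoordTM hφ hz)
  exact h2.symm.trans h1

theorem coordTM_snd_ne_zero (hφ : φ ∈ IsManifold.maximalAtlas 𝓘(ℝ, Model n) ∞ M)
    {v : TM n M} (hv : v.proj ∈ φ.source) (hv' : v ∈ slashed n M) : (coordTM φ v).2 ≠ 0 := by
  intro h
  apply hv'
  have h2 := congrArg (fun L => L v.2)
    ((mdifferentiable_chart hφ).symm_comp_deriv hv)
  have h3 : mfderiv 𝓘(ℝ, Model n) 𝓘(ℝ, Model n) φ v.proj v.2 = 0 := h
  simp only [ContinuousLinearMap.comp_apply, h3, map_zero] at h2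
  exact h2.symm

theorem mdifferentiableAt_coordTM (hφ : φ ∈ IsManifold.maximalAtlas 𝓘(ℝ, Model n) ∞ M)
    {v : TM n M} (hv : v.proj ∈ φ.source) :
    MDifferentiableAt (modelTM n) 𝓘(ℝ, Model n × Model n) (coordTM φ) v :=
  ((contMDiffOn_coordTM hφ).contMDiffAt ((isOpen_proj_preimage φ).mem_nhds hv)).mdifferentiableAt
    (by simp)

theorem contMDiffAt_ofCoordTM (hφ : φ ∈ IsManifold.maximalAtlas 𝓘(ℝ, Model n) ∞ M)
    {z : Model n × Model n} (hz : z.1 ∈ φ.target) :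
    ContMDiffAt 𝓘(ℝ, Model n × Model n) (modelTM n) ∞ (ofCoordTM φ : _ → TM n M) z :=
  (contMDiffOn_ofCoordTM hφ).contMDiffAt ((φ.open_target.prod isOpen_univ).mem_nhds ⟨hz, mem_univ _⟩)

theorem mfderiv_coordTM_comp_mfderiv_ofCoordTM
    (hφ : φ ∈ IsManifold.maximalAtlas 𝓘(ℝ, Model n) ∞ M) {z : Model n × Model n}
    (hz : z.1 ∈ φ.target) :
    (mfderiv (modelTM n) 𝓘(ℝ, Model n × Model n) (coordTM φ) (ofCoordTM φ z : TM n M)).comp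
      (mfderiv 𝓘(ℝ, Model n × Model n) (modelTM n) (ofCoordTM φ : _ → TM n M) z)
      = ContinuousLinearMap.id ℝ (Model n × Model n) := by
  rw [← mfderiv_comp z (mdifferentiableAt_coordTM hφ (φ.map_target hz))
    ((contMDiffAt_ofCoordTM hφ hz).mdifferentiableAt (by simp))]
  have h : (coordTM φ ∘ (ofCoordTM φ : _ → TM n M)) =ᶠ[𝓝 z] id := by
    filter_upwards [(φ.open_target.prod isOpen_univ).mem_nhds
      (show z ∈ φ.target ×ˢ (univ : Set (Model n)) from ⟨hz, mem_univ _⟩)] with w hw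
    exact coordTM_ofCoordTM hφ hw.1
  rw [h.mfderiv_eq, mfderiv_id]
  rfl

theorem mfderiv_ofCoordTM_comp_mfderiv_coordTM
    (hφ : φ ∈ IsManifold.maximalAtlas 𝓘(ℝ, Model n) ∞ M) {v : TM n M}
    (hv : v.proj ∈ φ.source) :
    (mfderiv 𝓘(ℝ, Model n × Model n) (modelTM n) (ofCoordTM φ : _ → TM n M) (coordTM φ v)).comp
      (mfderiv (modelTM n) 𝓘(ℝ, Model n × Model n) (coordTM φ) v)
      = ContinuousLinearMap.id ℝ (Model n × Model n) := by
  have hz : (coordTM φ v).1 ∈ φ.target := φ.map_source hv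
  have h1 : MDifferentiableAt 𝓘(ℝ, Model n × Model n) (modelTM n) (ofCoordTM φ : _ → TM n M)
    (coordTM φ v) := (contMDiffAt_ofCoordTM hφ hz).mdifferentiableAt (by simp)
  have h2 := (mfderiv_comp v h1 (mdifferentiableAt_coordTM hφ hv))
  have h : ((ofCoordTM φ : _ → TM n M) ∘ coordTM φ) =ᶠ[𝓝 v] id := by
    filter_upwards [(isOpen_proj_preimage φ).mem_nhds hv] with w hw
    exact ofCoordTM_coordTM hφ hw
  rw [h.mfderiv_eq, mfderiv_id] at h2
  exact h2.symm

/-- The coordinate expression of a vector field on `TM`. -/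
def fieldInCoord (S : SecondOrderField n M) (φ : OpenPartialHomeomorph M (Model n))
    (z : Model n × Model n) : Model n × Model n :=
  mfderiv (modelTM n) 𝓘(ℝ, Model n × Model n) (coordTM φ) (ofCoordTM φ z) (S (ofCoordTM φ z))

variable {S : SecondOrderField n M}

theorem isOpen_coordDomain (φ : OpenPartialHomeomorph M (Model n)) :
    IsOpen (φ.target ×ˢ ({0}ᶜ : Set (Model n))) :=
  φ.open_target.prod isOpen_compl_singleton

theorem contDiffOn_fieldInCoord (hS : IsSemispray S)
    (hφ : φ ∈ IsManifold.maximalAtlas 𝓘(ℝ, Model n) ∞ M) :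
    ContDiffOn ℝ ∞ (fieldInCoord S φ) (φ.target ×ˢ {0}ᶜ) := by
  have h1 : ContMDiffOn 𝓘(ℝ, Model n × Model n) (modelTM n) ∞ (ofCoordTM φ : _ → TM n M)
      (φ.target ×ˢ {0}ᶜ) := (contMDiffOn_ofCoordTM hφ).mono (prod_mono_right (subset_univ _))
  have h2 := hS.smooth.comp h1 (fun z hz => ofCoordTM_mem_slashed hφ hz.1 hz.2)
  have h3 := (contMDiffOn_coordTM hφ).contMDiffOn_tangentMapWithin (m := ∞) (by simp)
    (isOpen_proj_preimage φ).uniqueMDiffOn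
  have h4 := h3.comp h2 (fun z hz => φ.map_target hz.1)
  have h5 := (contMDiff_snd_tangentBundle_modelSpace (n := ∞) (Model n × Model n)
    𝓘(ℝ, Model n × Model n)).comp_contMDiffOn h4
  rw [contMDiffOn_iff_contDiffOn] at h5
  refine h5.congr ?_
  intro z hz
  simp only [Function.comp, tangentMapWithin]
  rw [mfderivWithin_of_isOpen (isOpen_proj_preimage φ) (φ.map_target hz.1)]
  rfl

/-- This is `Dπ ∘ S = id`, seen by differentiating `Prod.fst ∘ coordTM φ = φ ∘ π`. -/
theorem fieldInCoord_fst (hS : IsSemispray S)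
    (hφ : φ ∈ IsManifold.maximalAtlas 𝓘(ℝ, Model n) ∞ M) {z : Model n × Model n}
    (hz : z ∈ φ.target ×ˢ ({0}ᶜ : Set (Model n))) : (fieldInCoord S φ z).1 = z.2 := by
  set v : TM n M := ofCoordTM φ z with hv
  have hvs : v.proj ∈ φ.source := φ.map_target hz.1
  have hπ : MDifferentiableAt (modelTM n) 𝓘(ℝ, Model n) (fun w : TM n M => w.proj) v :=
    (Bundle.contMDiff_proj (n := 1) (TangentSpace 𝓘(ℝ, Model n))).mdifferentiableAt (by simp)
  have h1 := mfderiv_comp v (g := φ)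
    ((mdifferentiable_chart hφ).mdifferentiableAt hvs) hπ
  have h2 := mfderiv_comp v (g := (Prod.fst : Model n × Model n → Model n)) (f := coordTM φ)
    (I'' := 𝓘(ℝ, Model n)) (differentiableAt_fst.mdifferentiableAt)
    (mdifferentiableAt_coordTM hφ hvs)
  have h3 : Prod.fst ∘ coordTM φ = φ ∘ (fun w : TM n M => w.proj) := rfl
  rw [h3, h1] at h2
  have h4 : mfderiv 𝓘(ℝ, Model n) 𝓘(ℝ, Model n) φ v.proj
      (mfderiv (modelTM n) 𝓘(ℝ, Model n) (fun w : TM n M => w.proj) v (S v))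
      = fderiv ℝ (Prod.fst : Model n × Model n → Model n) (coordTM φ v) (fieldInCoord S φ z) := by
    rw [← mfderiv_eq_fderiv]
    exact congrArg (fun L => L (S v)) h2
  rw [hS.proj v (ofCoordTM_mem_slashed hφ hz.1 hz.2), fderiv_fst] at h4
  exact h4.symm.trans (congrArg Prod.snd (coordTM_ofCoordTM hφ hz.1))

theorem inverse_mfderiv_coordTM (hφ : φ ∈ IsManifold.maximalAtlas 𝓘(ℝ, Model n) ∞ M) {v : TM n M}
    (hv : v.proj ∈ φ.source) :
    (mfderiv (modelTM n) 𝓘(ℝ, Model n × Model n) (coordTM φ) v).inverse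
      = mfderiv 𝓘(ℝ, Model n × Model n) (modelTM n) (ofCoordTM φ : _ → TM n M) (coordTM φ v) := by
  apply ContinuousLinearMap.inverse_eq
  · have h := mfderiv_coordTM_comp_mfderiv_ofCoordTM hφ (z := coordTM φ v) (φ.map_source hv)
    rwa [ofCoordTM_coordTM hφ hv] at h
  · exact mfderiv_ofCoordTM_comp_mfderiv_coordTM hφ hv

/-- A map of a vector space to itself, as a vector field. -/
def asVectorField (F : Model n × Model n → Model n × Model n) :
    ∀ z : Model n × Model n, TangentSpace 𝓘(ℝ, Model n × Model n) z := F

/-- Presents a field on `TM` as a pull-back from the model, so that naturality of the Lie bracket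
moves `[C, S] = S` into coordinates. -/
theorem mpullback_coordTM_fieldInCoord (hφ : φ ∈ IsManifold.maximalAtlas 𝓘(ℝ, Model n) ∞ M)
    (S : SecondOrderField n M) {v : TM n M} (hv : v.proj ∈ φ.source) :
    VectorField.mpullback (modelTM n) 𝓘(ℝ, Model n × Model n) (coordTM φ)
      (asVectorField (fieldInCoord S φ)) v = S v := by
  rw [VectorField.mpullback_apply, inverse_mfderiv_coordTM hφ hv, asVectorField, fieldInCoord,
    ofCoordTM_coordTM hφ hv]
  exact congrArg (fun L => L (S v)) (mfderiv_ofCoordTM_comp_mfderiv_coordTM hφ hv)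

theorem fieldInCoord_liouville (hφ : φ ∈ IsManifold.maximalAtlas 𝓘(ℝ, Model n) ∞ M)
    {z : Model n × Model n} (hz : z.1 ∈ φ.target) :
    fieldInCoord (liouville n M) φ z = (0, z.2) := by
  set v : TM n M := ofCoordTM φ z with hv
  set γ : ℝ → TM n M := fun s => ⟨v.proj, (1 + s) • v.2⟩ with hγ
  have hγ0 : γ 0 = v := by simp [hγ]
  have hγ' : γ = fun s => ofCoordTM φ (z.1, (1 + s) • z.2) := by
    funext s
    refine ext_TM rfl ?_
    exact (map_smul (mfderiv 𝓘(ℝ, Model n) 𝓘(ℝ, Model n) φ.symm z.1) (1 + s) z.2).symm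
  have hlin : HasDerivAt (fun s : ℝ => (z.1, (1 + s) • z.2)) ((0 : Model n), z.2) 0 := by
    have h := ((hasDerivAt_id (0 : ℝ)).const_add 1).smul_const z.2
    rw [one_smul] at h
    exact (hasDerivAt_const 0 z.1).prodMk h
  have hγd : MDifferentiableAt 𝓘(ℝ, ℝ) (modelTM n) γ 0 := by
    rw [hγ']
    have h1 : MDifferentiableAt 𝓘(ℝ, Model n × Model n) (modelTM n) (ofCoordTM φ : _ → TM n M)
      (z.1, (1 + (0 : ℝ)) • z.2) :=
      (contMDiffAt_ofCoordTM hφ (z := (z.1, (1 + (0 : ℝ)) • z.2)) hz).mdifferentiableAt (by simp)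
    exact h1.comp (f := fun s : ℝ => (z.1, (1 + s) • z.2)) 0
      hlin.differentiableAt.mdifferentiableAt
  have hvs : (γ 0).proj ∈ φ.source := φ.map_target hz
  have h1 := mfderiv_comp (0 : ℝ) (mdifferentiableAt_coordTM hφ hvs) hγd
  have h2 : coordTM φ ∘ γ = fun s => (z.1, (1 + s) • z.2) := by
    funext s
    rw [hγ']
    exact coordTM_ofCoordTM hφ hz
  rw [h2, mfderiv_eq_fderiv] at h1
  have h3 : fderiv ℝ (fun s : ℝ => (z.1, (1 + s) • z.2)) 0 1 = ((0 : Model n), z.2) := hlin.deriv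
  have h4 := congrArg (fun L => L (1 : ℝ)) h1
  rw [← h3]
  rw [hγ0] at h4
  exact h4.symm

/-- In coordinates the Liouville field is the linear map `L = (0, y)`, so its bracket with `F` is
`DF(L z) - L(F z)`. Naturality of the bracket turns `[C, S] = S` into `DF(L z) - L(F z) = F z`. -/
theorem fderiv_fieldInCoord_homogeneous (hS : IsSpray S)
    (hφ : φ ∈ IsManifold.maximalAtlas 𝓘(ℝ, Model n) ∞ M) {z : Model n × Model n}
    (hz : z ∈ φ.target ×ˢ ({0}ᶜ : Set (Model n))) :
    fderiv ℝ (fieldInCoord S φ) z (0, z.2) = fieldInCoord S φ z + (0, (fieldInCoord S φ z).2) := by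
  set v : TM n M := ofCoordTM φ z with hv
  have hvs : v.proj ∈ φ.source := φ.map_target hz.1
  have hvz : coordTM φ v = z := coordTM_ofCoordTM hφ hz.1
  set L : Model n × Model n →L[ℝ] Model n × Model n :=
    (0 : Model n × Model n →L[ℝ] Model n).prod (ContinuousLinearMap.snd ℝ _ _) with hL
  have hmin : minSmoothness ℝ 2 ≤ ∞ := by
    rw [minSmoothness_of_isRCLikeNormedField]
    exact ENat.LEInfty.out
  have : IsManifold (modelTM n) (minSmoothness ℝ 2) (TM n M) := IsManifold.of_le (n := ∞) hmin
  have hpull := VectorField.mpullback_mlieBracket (I := modelTM n)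
    (I' := 𝓘(ℝ, Model n × Model n)) (n := ∞) (f := coordTM φ) (V := asVectorField (fun z => L z))
    (W := asVectorField (fieldInCoord S φ)) (x₀ := v) ?_ ?_
    ((contMDiffOn_coordTM hφ).contMDiffAt ((isOpen_proj_preimage φ).mem_nhds hvs)) hmin
  · have hC : VectorField.mpullback (modelTM n) 𝓘(ℝ, Model n × Model n) (coordTM φ)
        (asVectorField (fun z => L z)) =ᶠ[𝓝 v] liouville n M := by
      filter_upwards [(isOpen_proj_preimage φ).mem_nhds hvs] with w hw
      rw [← mpullback_coordTM_fieldInCoord hφ (liouville n M) hw]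
      have hLw : L (coordTM φ w) = fieldInCoord (liouville n M) φ (coordTM φ w) :=
        (fieldInCoord_liouville hφ (z := coordTM φ w) (φ.map_source hw)).symm
      exact congrArg
        (mfderiv (modelTM n) 𝓘(ℝ, Model n × Model n) (coordTM φ) w).inverse hLw
    have hSS : VectorField.mpullback (modelTM n) 𝓘(ℝ, Model n × Model n) (coordTM φ)
        (asVectorField (fieldInCoord S φ)) =ᶠ[𝓝 v] S := by
      filter_upwards [(isOpen_proj_preimage φ).mem_nhds hvs] with w hw
      exact mpullback_coordTM_fieldInCoord hφ S hw
    rw [hC.mlieBracket_vectorField_eq hSS,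
      hS.homogeneous v (ofCoordTM_mem_slashed hφ hz.1 hz.2),
      VectorField.mpullback_apply,
      inverse_mfderiv_coordTM hφ hvs] at hpull
    -- Both sides are values of the inverse derivative; the derivative of `coordTM φ` removes it.
    have h1 := congrArg (mfderiv (modelTM n) 𝓘(ℝ, Model n × Model n) (coordTM φ) v) hpull
    have h2 : ∀ w : Model n × Model n, mfderiv (modelTM n) 𝓘(ℝ, Model n × Model n) (coordTM φ) v
        (mfderiv 𝓘(ℝ, Model n × Model n) (modelTM n) (ofCoordTM φ : _ → TM n M) z w) = w :=
      fun w => congrArg (fun L => L w) (mfderiv_coordTM_comp_mfderiv_ofCoordTM hφ hz.1)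
    rw [hvz] at h1
    have hbr : VectorField.mlieBracket 𝓘(ℝ, Model n × Model n) (asVectorField (fun z => L z))
        (asVectorField (fieldInCoord S φ)) z
        = VectorField.lieBracket ℝ (fun z => L z) (fieldInCoord S φ) z :=
      (congrFun (VectorField.mlieBracketWithin_eq_lieBracketWithin (𝕜 := ℝ)
        (V := asVectorField (fun z => L z)) (W := asVectorField (fieldInCoord S φ))
        (s := univ)) z).trans (congrFun (VectorField.lieBracketWithin_univ (𝕜 := ℝ)
        (V := fun z => L z) (W := fieldInCoord S φ)) z)
    have h3 : VectorField.lieBracket ℝ (fun z => L z) (fieldInCoord S φ) z = fieldInCoord S φ z :=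
      hbr.symm.trans ((h2 _).symm.trans h1)
    rw [VectorField.lieBracket_eq] at h3
    have h4 : fderiv ℝ (fun z => L z) z = L := L.fderiv
    simp only [h4] at h3
    exact sub_eq_iff_eq_add.1 h3
  · rw [hvz]
    exact ((contMDiffAt_vectorSpace_iff_contDiffAt (n := 1)).2 L.contDiff.contDiffAt).mdifferentiableAt
      (by simp)
  · rw [hvz]
    exact ((contMDiffAt_vectorSpace_iff_contDiffAt (n := 1)).2
      (((contDiffOn_fieldInCoord hS.toIsSemispray hφ).contDiffAt
      ((isOpen_coordDomain φ).mem_nhds hz)).of_le ENat.LEInfty.out)).mdifferentiableAt (by simp)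

theorem fieldInCoord_eq (hS : IsSemispray S)
    (hφ : φ ∈ IsManifold.maximalAtlas 𝓘(ℝ, Model n) ∞ M) {z : Model n × Model n}
    (hz : z ∈ φ.target ×ˢ ({0}ᶜ : Set (Model n))) :
    fieldInCoord S φ z = (z.2, (-2 : ℝ) • sprayCoeff S φ z) := by
  refine Prod.ext (fieldInCoord_fst hS hφ hz) ?_
  change _ = (-2 : ℝ) • ((-(1 / 2) : ℝ) • (fieldInCoord S φ z).2)
  rw [smul_smul]
  norm_num

theorem contDiffOn_sprayCoeff (hS : IsSemispray S)
    (hφ : φ ∈ IsManifold.maximalAtlas 𝓘(ℝ, Model n) ∞ M) :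
    ContDiffOn ℝ ∞ (sprayCoeff S φ) (φ.target ×ˢ {0}ᶜ) :=
  (contDiff_snd.comp_contDiffOn (contDiffOn_fieldInCoord hS hφ)).const_smul (-(1 / 2) : ℝ)

theorem contDiffOn_connCoeff (hS : IsSemispray S)
    (hφ : φ ∈ IsManifold.maximalAtlas 𝓘(ℝ, Model n) ∞ M) :
    ContDiffOn ℝ ∞ (connCoeff S φ) (φ.target ×ˢ {0}ᶜ) :=
  ((contDiffOn_sprayCoeff hS hφ).fderiv_of_isOpen (isOpen_coordDomain φ) (by simp)).clm_comp
    contDiffOn_const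

/-- The Euler relation for the spray coefficients, which are positively homogeneous of degree two. -/
theorem connCoeff_apply_self (hS : IsSpray S)
    (hφ : φ ∈ IsManifold.maximalAtlas 𝓘(ℝ, Model n) ∞ M) {z : Model n × Model n}
    (hz : z ∈ φ.target ×ˢ ({0}ᶜ : Set (Model n))) :
    connCoeff S φ z z.2 = (2 : ℝ) • sprayCoeff S φ z := by
  have hFd : DifferentiableAt ℝ (fieldInCoord S φ) z :=
    ((contDiffOn_fieldInCoord hS.toIsSemispray hφ).contDiffAt
      ((isOpen_coordDomain φ).mem_nhds hz)).differentiableAt (by simp)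
  have h1 : HasFDerivAt (sprayCoeff S φ) ((-(1 / 2) : ℝ) •
      (ContinuousLinearMap.snd ℝ (Model n) (Model n)).comp (fderiv ℝ (fieldInCoord S φ) z)) z :=
    (hasFDerivAt_snd.comp z hFd.hasFDerivAt).const_smul (-(1 / 2) : ℝ)
  have h2 : connCoeff S φ z z.2 = (-(1 / 2) : ℝ) • (fderiv ℝ (fieldInCoord S φ) z (0, z.2)).2 := by
    rw [connCoeff, h1.fderiv]
    rfl
  rw [h2, fderiv_fieldInCoord_homogeneous hS hφ hz]
  change (-(1 / 2) : ℝ) • ((fieldInCoord S φ z).2 + (fieldInCoord S φ z).2)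
    = (2 : ℝ) • ((-(1 / 2) : ℝ) • (fieldInCoord S φ z).2)
  module

end Coordinates

end SprayGeometry
end

noncomputable section

namespace SprayGeometry

/-! ### Geodesics as integral curves in coordinates. -/

section Geodesics

set_option linter.unusedSectionVars false

variable {n : ℕ} {M : Type*} [TopologicalSpace M] [ChartedSpace (Model n) M]
  [IsManifold 𝓘(ℝ, Model n) ∞ M] {φ : OpenPartialHomeomorph M (Model n)}
  {S : SecondOrderField n M} {γ : ℝ → M} {I : Set ℝ} {t : ℝ}

theorem coordTM_velocity (hφ : φ ∈ IsManifold.maximalAtlas 𝓘(ℝ, Model n) ∞ M)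
    (hγ : MDifferentiableAt 𝓘(ℝ, ℝ) 𝓘(ℝ, Model n) γ t) (ht : γ t ∈ φ.source) :
    coordTM φ (velocity γ t) = (φ (γ t), deriv (fun u => φ (γ u)) t) := by
  refine Prod.ext rfl ?_
  have h := mfderiv_comp t ((mdifferentiable_chart hφ).mdifferentiableAt ht) hγ
  rw [mfderiv_eq_fderiv] at h
  exact (congrArg (fun L => L (1 : ℝ)) h).symm

theorem contDiffAt_chart_comp (hφ : φ ∈ IsManifold.maximalAtlas 𝓘(ℝ, Model n) ∞ M)
    {E : Type*} [NormedAddCommGroup E] [NormedSpace ℝ E] {f : E → M} {x : E}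
    (hf : ContMDiffAt 𝓘(ℝ, E) 𝓘(ℝ, Model n) ∞ f x) (hx : f x ∈ φ.source) :
    ContDiffAt ℝ ∞ (fun u => φ (f u)) x := by
  rw [← contMDiffAt_iff_contDiffAt]
  exact ((contMDiffOn_of_mem_maximalAtlas hφ).contMDiffAt (φ.open_source.mem_nhds hx)).comp x hf

theorem contDiffAt_deriv_infty {E : Type*} [NormedAddCommGroup E] [NormedSpace ℝ E] {f : ℝ → E}
    (hf : ContDiffAt ℝ ∞ f t) : ContDiffAt ℝ ∞ (deriv f) t := by
  have h := hf.fderiv_right (m := ∞) (by simp)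
  exact h.clm_apply contDiffAt_const

theorem eventually_coordTM_velocity (hφ : φ ∈ IsManifold.maximalAtlas 𝓘(ℝ, Model n) ∞ M)
    (hI : IsOpen I) (hγ : ContMDiffOn 𝓘(ℝ, ℝ) 𝓘(ℝ, Model n) ∞ γ I) (htI : t ∈ I)
    (ht : γ t ∈ φ.source) :
    ∀ᶠ u in 𝓝 t, u ∈ I ∧ γ u ∈ φ.source ∧
      coordTM φ (velocity γ u) = (φ (γ u), deriv (fun u => φ (γ u)) u) := by
  have hc : ContinuousAt γ t := hγ.continuousOn.continuousAt (hI.mem_nhds htI)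
  filter_upwards [hI.mem_nhds htI, hc.eventually (φ.open_source.mem_nhds ht)] with u hu hus
  exact ⟨hu, hus, coordTM_velocity hφ
    ((hγ.contMDiffAt (hI.mem_nhds hu)).mdifferentiableAt (by simp)) hus⟩

theorem contDiffAt_coordTM_velocity (hφ : φ ∈ IsManifold.maximalAtlas 𝓘(ℝ, Model n) ∞ M)
    (hI : IsOpen I) (hγ : ContMDiffOn 𝓘(ℝ, ℝ) 𝓘(ℝ, Model n) ∞ γ I) (htI : t ∈ I)
    (ht : γ t ∈ φ.source) :
    ContDiffAt ℝ ∞ (fun u => coordTM φ (velocity γ u)) t := by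
  have h1 := contDiffAt_chart_comp hφ (hγ.contMDiffAt (hI.mem_nhds htI)) ht
  refine (h1.prodMk (contDiffAt_deriv_infty h1)).congr_of_eventuallyEq ?_
  filter_upwards [eventually_coordTM_velocity hφ hI hγ htI ht] with u hu
  exact hu.2.2

theorem contMDiffAt_velocity (hI : IsOpen I)
    (hγ : ContMDiffOn 𝓘(ℝ, ℝ) 𝓘(ℝ, Model n) ∞ γ I) (htI : t ∈ I) :
    ContMDiffAt 𝓘(ℝ, ℝ) (modelTM n) ∞ (velocity γ : ℝ → TM n M) t := by
  set φ := chartAt (Model n) (γ t)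
  have hφ : φ ∈ IsManifold.maximalAtlas 𝓘(ℝ, Model n) ∞ M := IsManifold.chart_mem_maximalAtlas _
  have ht : γ t ∈ φ.source := mem_chart_source _ _
  have h1 := (contDiffAt_coordTM_velocity hφ hI hγ htI ht).contMDiffAt
  have h2 : ContMDiffAt 𝓘(ℝ, Model n × Model n) (modelTM n) ∞ (ofCoordTM φ : _ → TM n M)
    (coordTM φ (velocity γ t)) := contMDiffAt_ofCoordTM hφ (φ.map_source ht)
  refine (h2.comp t h1).congr_of_eventuallyEq ?_
  filter_upwards [eventually_coordTM_velocity hφ hI hγ htI ht] with u hu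
  exact (ofCoordTM_coordTM hφ (v := velocity γ u) hu.2.1).symm

theorem IsGeodesicOn.coordTM_mem (hγ : IsGeodesicOn S γ I)
    (hφ : φ ∈ IsManifold.maximalAtlas 𝓘(ℝ, Model n) ∞ M) (htI : t ∈ I) (ht : γ t ∈ φ.source) :
    coordTM φ (velocity γ t) ∈ φ.target ×ˢ ({0}ᶜ : Set (Model n)) :=
  ⟨φ.map_source ht, coordTM_snd_ne_zero hφ (v := velocity γ t) ht (hγ.regular t htI)⟩

/-- The geodesic equation in coordinates. -/
theorem IsGeodesicOn.hasDerivAt (hγ : IsGeodesicOn S γ I) (hI : IsOpen I)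
    (hφ : φ ∈ IsManifold.maximalAtlas 𝓘(ℝ, Model n) ∞ M) (htI : t ∈ I) (ht : γ t ∈ φ.source) :
    HasDerivAt (fun u => coordTM φ (velocity γ u))
      (fieldInCoord S φ (coordTM φ (velocity γ t))) t := by
  have h1 : MDifferentiableAt 𝓘(ℝ, ℝ) (modelTM n) (velocity γ : ℝ → TM n M) t :=
    (contMDiffAt_velocity hI hγ.smooth htI).mdifferentiableAt (by simp)
  have h2 : MDifferentiableAt (modelTM n) 𝓘(ℝ, Model n × Model n) (coordTM φ)
    (velocity γ t : TM n M) := mdifferentiableAt_coordTM hφ ht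
  have h3 := mfderiv_comp t h2 h1
  have h4 : deriv (fun u => coordTM φ (velocity γ u)) t
      = fieldInCoord S φ (coordTM φ (velocity γ t)) := by
    rw [mfderiv_eq_fderiv] at h3
    refine (congrArg (fun L => L (1 : ℝ)) h3).trans ?_
    rw [fieldInCoord, ofCoordTM_coordTM hφ (v := velocity γ t) ht]
    exact congrArg (mfderiv (modelTM n) 𝓘(ℝ, Model n × Model n) (coordTM φ) (velocity γ t))
      (hγ.eqn t htI)
  rw [← h4]
  exact ((contDiffAt_coordTM_velocity hφ hI hγ.smooth htI ht).differentiableAt (by simp)).hasDerivAt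

/-- A solution of the geodesic equation in coordinates gives a geodesic. -/
theorem isGeodesicOn_of_hasDerivAt (hS : IsSemispray S)
    (hφ : φ ∈ IsManifold.maximalAtlas 𝓘(ℝ, Model n) ∞ M) (hI : IsOpen I)
    {z : ℝ → Model n × Model n} (hz : ContDiffOn ℝ ∞ z I)
    (hmem : ∀ t ∈ I, z t ∈ φ.target ×ˢ ({0}ᶜ : Set (Model n)))
    (hder : ∀ t ∈ I, HasDerivAt z (fieldInCoord S φ (z t)) t) :
    IsGeodesicOn S (fun t => φ.symm (z t).1) I ∧
      ∀ t ∈ I, velocity (fun t => φ.symm (z t).1) t = (ofCoordTM φ (z t) : TM n M) := by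
  have hsmooth : ContMDiffOn 𝓘(ℝ, ℝ) 𝓘(ℝ, Model n) ∞ (fun t => φ.symm (z t).1) I :=
    (contMDiffOn_symm_of_mem_maximalAtlas hφ).comp hz.fst.contMDiffOn (fun t ht => (hmem t ht).1)
  have hvel : ∀ t ∈ I, velocity (fun t => φ.symm (z t).1) t = (ofCoordTM φ (z t) : TM n M) := by
    intro t ht
    refine ext_TM rfl ?_
    have h1 : HasDerivAt (fun t => (z t).1) (z t).2 t := by
      have := (ContinuousLinearMap.fst ℝ (Model n) (Model n)).hasFDerivAt.comp_hasDerivAt t (hder t ht)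
      rwa [ContinuousLinearMap.coe_fst', fieldInCoord_fst hS hφ (hmem t ht)] at this
    have h2 := mfderiv_comp t (g := φ.symm) (f := fun t => (z t).1) (I := 𝓘(ℝ, ℝ))
      (I' := 𝓘(ℝ, Model n)) (I'' := 𝓘(ℝ, Model n))
      ((mdifferentiable_chart hφ).mdifferentiableAt_symm (hmem t ht).1)
      h1.differentiableAt.mdifferentiableAt
    refine (congrArg (fun L => L (1 : ℝ)) h2).trans ?_
    rw [mfderiv_eq_fderiv]
    exact congrArg (mfderiv 𝓘(ℝ, Model n) 𝓘(ℝ, Model n) φ.symm (z t).1) h1.deriv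
  refine ⟨⟨hsmooth, fun t ht => ?_, fun t ht => ?_⟩, hvel⟩
  · rw [hvel t ht]
    exact ofCoordTM_mem_slashed hφ (hmem t ht).1 (hmem t ht).2
  · have hev : (velocity (fun t => φ.symm (z t).1) : ℝ → TM n M) =ᶠ[𝓝 t]
        (ofCoordTM φ : _ → TM n M) ∘ z := by
      filter_upwards [hI.mem_nhds ht] with u hu
      exact hvel u hu
    have h3 := mfderiv_comp t (g := (ofCoordTM φ : _ → TM n M)) (f := z) (I := 𝓘(ℝ, ℝ))
      ((contMDiffAt_ofCoordTM hφ (hmem t ht).1).mdifferentiableAt (by simp))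
      (hder t ht).differentiableAt.mdifferentiableAt
    rw [hev.mfderiv_eq, hvel t ht]
    refine (congrArg (fun L => L (1 : ℝ)) h3).trans ?_
    rw [mfderiv_eq_fderiv]
    refine (congrArg (mfderiv 𝓘(ℝ, Model n × Model n) (modelTM n) (ofCoordTM φ : _ → TM n M) (z t))
      (hder t ht).deriv).trans ?_
    have h5 := mfderiv_ofCoordTM_comp_mfderiv_coordTM hφ (v := (ofCoordTM φ (z t) : TM n M))
      (φ.map_target (hmem t ht).1)
    rw [coordTM_ofCoordTM hφ (hmem t ht).1] at h5
    exact congrArg (fun L => L (S (ofCoordTM φ (z t)))) h5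

theorem velocity_congr {γ' : ℝ → M} (h : γ =ᶠ[𝓝 t] γ') :
    (velocity γ t : TM n M) = velocity γ' t := by
  refine ext_TM h.self_of_nhds ?_
  exact congrArg (fun L : ℝ →L[ℝ] Model n => L 1)
    (h.mfderiv_eq (I := 𝓘(ℝ, ℝ)) (I' := 𝓘(ℝ, Model n)))

/-- Being a geodesic is a local property. -/
theorem isGeodesicOn_of_eventuallyEq
    (h : ∀ t ∈ I, ∃ γ' J, IsOpen J ∧ t ∈ J ∧ IsGeodesicOn S γ' J ∧ γ =ᶠ[𝓝 t] γ') :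
    IsGeodesicOn S γ I := by
  refine ⟨fun t ht => ?_, fun t ht => ?_, fun t ht => ?_⟩
  all_goals obtain ⟨γ', J, hJ, htJ, hγ', heq⟩ := h t ht
  · exact ((hγ'.smooth.contMDiffAt (hJ.mem_nhds htJ)).congr_of_eventuallyEq heq).contMDiffWithinAt
  · rw [velocity_congr heq]
    exact hγ'.regular t htJ
  · have hev : (velocity γ : ℝ → TM n M) =ᶠ[𝓝 t] velocity γ' := by
      filter_upwards [eventually_eventually_nhds.2 heq] with u hu
      exact velocity_congr hu
    rw [hev.mfderiv_eq, velocity_congr heq]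
    exact hγ'.eqn t htJ

theorem IsGeodesicOn.mono {J : Set ℝ} (h : IsGeodesicOn S γ I) (hJ : J ⊆ I) :
    IsGeodesicOn S γ J :=
  ⟨h.smooth.mono hJ, fun t ht => h.regular t (hJ ht), fun t ht => h.eqn t (hJ ht)⟩

end Geodesics

end SprayGeometry
end

/-! ### Variational equation and dynamical covariant derivative. -/

noncomputable section

namespace SprayGeometry

/-- The variational equation of an ordinary differential equation. -/
theorem hasDerivAt_variation {E F : Type*} [NormedAddCommGroup E] [NormedSpace ℝ E]
    [NormedAddCommGroup F] [NormedSpace ℝ F] {z : ℝ × F → E} {f : E → E} {t : ℝ} {s : F}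
    (hz : ContDiffAt ℝ ∞ z (t, s)) (hf : DifferentiableAt ℝ f (z (t, s)))
    (hode : ∀ᶠ q in 𝓝 (t, s), HasDerivAt (fun u => z (u, q.2)) (f (z q)) q.1) (e : F) :
    HasDerivAt (fun u => fderiv ℝ (fun σ => z (u, σ)) s e)
      (fderiv ℝ f (z (t, s)) (fderiv ℝ (fun σ => z (t, σ)) s e)) t := by
  have hdiff : ∀ᶠ q in 𝓝 (t, s), DifferentiableAt ℝ z q := by
    have h1 : ContDiffAt ℝ 1 z (t, s) := hz.of_le ENat.LEInfty.out
    filter_upwards [h1.eventually (by simp)] with q hq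
    exact hq.differentiableAt (by simp)
  have hpart : ∀ q : ℝ × F, DifferentiableAt ℝ z q →
      fderiv ℝ (fun σ => z (q.1, σ)) q.2 e = fderiv ℝ z q (0, e) := by
    intro q hq
    have h := hq.hasFDerivAt.comp (f := fun σ => (q.1, σ)) q.2
      ((hasFDerivAt_const q.1 q.2).prodMk (hasFDerivAt_id q.2))
    have h' : fderiv ℝ (fun σ => z (q.1, σ)) q.2 = _ := h.fderiv
    rw [h']
    simp
  -- The equation as an identity between functions of `(t, s)`, which may be differentiated in `s`.
  have htime : ∀ᶠ q in 𝓝 (t, s), fderiv ℝ z q (1, 0) = f (z q) := by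
    filter_upwards [hdiff, hode] with q hq hq'
    have h := hq.hasFDerivAt.comp_hasDerivAt (f := fun u => (u, q.2)) q.1
      ((hasDerivAt_id q.1).prodMk (hasDerivAt_const q.1 q.2))
    exact h.unique hq'
  have hD : DifferentiableAt ℝ (fderiv ℝ z) (t, s) :=
    (hz.fderiv_right (m := ∞) (by simp)).differentiableAt (by simp)
  have hline : HasDerivAt (fun u : ℝ => (u, s)) ((1 : ℝ), (0 : F)) t :=
    (hasDerivAt_id t).prodMk (hasDerivAt_const t s)
  have hev : (fun u => fderiv ℝ (fun σ => z (u, σ)) s e) =ᶠ[𝓝 t]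
      fun u => fderiv ℝ z (u, s) (0, e) := by
    filter_upwards [hline.continuousAt.eventually hdiff] with u hu
    exact hpart (u, s) hu
  have h1 : HasDerivAt (fun u => fderiv ℝ z (u, s) (0, e))
      (fderiv ℝ (fderiv ℝ z) (t, s) (1, 0) (0, e)) t := by
    have h := (hD.hasFDerivAt.comp_hasDerivAt (f := fun u : ℝ => (u, s)) t hline).clm_apply
      (hasDerivAt_const t ((0 : ℝ), e))
    simpa using h
  -- Symmetry of the second derivative lets the derivative in `t` of `∂z/∂s` be computed from `∂z/∂t
  -- = f(z)`.
  have hsymm : fderiv ℝ (fderiv ℝ z) (t, s) (1, 0) (0, e)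
      = fderiv ℝ (fderiv ℝ z) (t, s) (0, e) (1, 0) :=
    (hz.isSymmSndFDerivAt (by simpa using ENat.LEInfty.out)).eq _ _
  have h2 : fderiv ℝ (fderiv ℝ z) (t, s) (0, e) (1, 0)
      = fderiv ℝ f (z (t, s)) (fderiv ℝ z (t, s) (0, e)) := by
    have ha : HasFDerivAt (fun q => fderiv ℝ z q (1, 0))
        ((fderiv ℝ (fderiv ℝ z) (t, s)).flip (1, 0)) (t, s) := by
      have h := hD.hasFDerivAt.clm_apply (hasFDerivAt_const ((1 : ℝ), (0 : F)) (t, s))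
      simpa using h
    have hb := (hf.hasFDerivAt.comp (t, s) hdiff.self_of_nhds.hasFDerivAt)
    have hc := (ha.congr_of_eventuallyEq (f₁ := f ∘ z)
      (by filter_upwards [htime] with q hq using hq.symm)).unique hb
    exact congrArg (fun L => L ((0 : ℝ), e)) hc
  have h3 := hpart (t, s) hdiff.self_of_nhds
  simp only at h3
  rw [h3, ← h2, ← hsymm]
  exact h1.congr_of_eventuallyEq hev

section CovariantDerivative

set_option linter.unusedSectionVars false

variable {n : ℕ} {M : Type*} [TopologicalSpace M] [ChartedSpace (Model n) M]
  [IsManifold 𝓘(ℝ, Model n) ∞ M] {φ : OpenPartialHomeomorph M (Model n)}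
  {S : SecondOrderField n M} {c : ℝ → M} {I U : Set ℝ} {t : ℝ}

theorem nablaField_eq_of_hasDerivWithinAt (hI : UniqueDiffOn ℝ I) (htI : t ∈ I)
    {x : ℝ → Model n} {x' : Model n} (hx : HasDerivWithinAt x x' I t) :
    nablaField S c I φ x t = x' + connCoeff S φ (coordTM φ (velocity c t)) (x t) := by
  rw [nablaField, hx.derivWithin (hI t htI)]

/-- The Leibniz rule `∇(A y) = (∇A) y + A (∇y)` with `∇y = 0`: the term `-A N y` of `∇A` is `A y'`.
-/
theorem nablaTensor_apply_parallel (hI : UniqueDiffOn ℝ I) (htI : t ∈ I)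
    {A : ℝ → Model n →L[ℝ] Model n} {y : ℝ → Model n} (hA : DifferentiableWithinAt ℝ A I t)
    (hy : HasDerivWithinAt y (-connCoeff S φ (coordTM φ (velocity c t)) (y t)) I t) :
    nablaTensor S c I φ A t (y t) = nablaField S c I φ (fun u => A u (y u)) t := by
  rw [nablaField_eq_of_hasDerivWithinAt hI htI (hA.hasDerivWithinAt.clm_apply hy), nablaTensor]
  simp only [add_apply, sub_apply,
    ContinuousLinearMap.comp_apply, map_neg]
  abel

theorem nablaField_congr {x y : ℝ → Model n} (htI : t ∈ I) (h : x =ᶠ[𝓝[I] t] y) :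
    nablaField S c I φ x t = nablaField S c I φ y t := by
  rw [nablaField, nablaField, h.derivWithin_eq (h.self_of_nhdsWithin htI),
    h.self_of_nhdsWithin htI]

/-- The second covariant derivative of a tensor, applied to a parallel field. -/
theorem nablaTensor_nablaTensor_apply_parallel (hI : UniqueDiffOn ℝ I) (htI : t ∈ I)
    {A : ℝ → Model n →L[ℝ] Model n} {y : ℝ → Model n}
    (hA : ∀ᶠ u in 𝓝[I] t, DifferentiableWithinAt ℝ A I u)
    (hA' : DifferentiableWithinAt ℝ (nablaTensor S c I φ A) I t)
    (hy : ∀ᶠ u in 𝓝[I] t,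
      HasDerivWithinAt y (-connCoeff S φ (coordTM φ (velocity c u)) (y u)) I u) :
    nablaTensor S c I φ (nablaTensor S c I φ A) t (y t)
      = nablaField S c I φ (nablaField S c I φ (fun u => A u (y u))) t := by
  rw [nablaTensor_apply_parallel hI htI hA' (hy.self_of_nhdsWithin htI)]
  apply nablaField_congr htI
  filter_upwards [hA, hy, self_mem_nhdsWithin] with u hu hu' huI
  exact nablaTensor_apply_parallel hI huI hu hu'

theorem differentiableAt_sprayCoeff (hS : IsSemispray S)
    (hφ : φ ∈ IsManifold.maximalAtlas 𝓘(ℝ, Model n) ∞ M) {z : Model n × Model n}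
    (hz : z ∈ φ.target ×ˢ ({0}ᶜ : Set (Model n))) : DifferentiableAt ℝ (sprayCoeff S φ) z :=
  ((contDiffOn_sprayCoeff hS hφ).contDiffAt
    ((isOpen_coordDomain φ).mem_nhds hz)).differentiableAt (by simp)

/-- The linearization of the geodesic equation. -/
theorem fderiv_fieldInCoord_apply (hS : IsSemispray S)
    (hφ : φ ∈ IsManifold.maximalAtlas 𝓘(ℝ, Model n) ∞ M) {z : Model n × Model n}
    (hz : z ∈ φ.target ×ˢ ({0}ᶜ : Set (Model n))) (p : Model n × Model n) :
    fderiv ℝ (fieldInCoord S φ) z p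
      = (p.2, (-2 : ℝ) • (fderiv ℝ (sprayCoeff S φ) z (p.1, 0) + connCoeff S φ z p.2)) := by
  have hev : fieldInCoord S φ =ᶠ[𝓝 z] fun z => (z.2, (-2 : ℝ) • sprayCoeff S φ z) := by
    filter_upwards [(isOpen_coordDomain φ).mem_nhds hz] with w hw
    exact fieldInCoord_eq hS hφ hw
  have h : HasFDerivAt (fun z : Model n × Model n => (z.2, (-2 : ℝ) • sprayCoeff S φ z)) _ z :=
    hasFDerivAt_snd.prodMk ((differentiableAt_sprayCoeff hS hφ hz).hasFDerivAt.const_smul (-2 : ℝ))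
  rw [hev.fderiv_eq, h.fderiv]
  have hp : fderiv ℝ (sprayCoeff S φ) z p
      = fderiv ℝ (sprayCoeff S φ) z (p.1, 0) + connCoeff S φ z p.2 := by
    change _ = _ + fderiv ℝ (sprayCoeff S φ) z (0, p.2)
    rw [← map_add]
    simp
  simp [hp, add_comm]

/-- Along a geodesic, `d/dt` is differentiation along `S`. The derivative of `N` is therefore the
term `S(∂G/∂y)` that `Φ` subtracts. -/
theorem hasDerivAt_connCoeff (hS : IsSemispray S) (hc : IsGeodesicOn S c U) (hU : IsOpen U)
    (hφ : φ ∈ IsManifold.maximalAtlas 𝓘(ℝ, Model n) ∞ M) (htU : t ∈ U) (ht : c t ∈ φ.source) :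
    HasDerivAt (fun u => connCoeff S φ (coordTM φ (velocity c u)))
      (fderiv ℝ (connCoeff S φ) (coordTM φ (velocity c t)) ((coordTM φ (velocity c t)).2,
        (-2 : ℝ) • sprayCoeff S φ (coordTM φ (velocity c t)))) t := by
  have hz := hc.coordTM_mem hφ htU ht
  have h1 := hc.hasDerivAt hU hφ htU ht
  rw [fieldInCoord_eq hS hφ hz] at h1
  exact (((contDiffOn_connCoeff hS hφ).contDiffAt ((isOpen_coordDomain φ).mem_nhds hz)
    ).differentiableAt (by simp)).hasFDerivAt.comp_hasDerivAt t h1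

/-- The Jacobi operator in terms of ordinary derivatives. -/
theorem nablaField_nablaField_add_jacobiEndo (hS : IsSemispray S) (hc : IsGeodesicOn S c U)
    (hU : IsOpen U) (hφ : φ ∈ IsManifold.maximalAtlas 𝓘(ℝ, Model n) ∞ M)
    (hI : UniqueDiffOn ℝ I) (hIU : I ⊆ U) (htI : t ∈ I) (ht : c t ∈ φ.source)
    {x x' : ℝ → Model n} {x'' : Model n} (hx : ∀ᶠ u in 𝓝[I] t, HasDerivWithinAt x (x' u) I u)
    (hx' : HasDerivWithinAt x' x'' I t) :
    nablaField S c I φ (nablaField S c I φ x) t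
        + jacobiEndo S φ (coordTM φ (velocity c t)) (x t)
      = x'' - (fderiv ℝ (fieldInCoord S φ) (coordTM φ (velocity c t)) (x t, x' t)).2 := by
  set z := coordTM φ (velocity c t) with hz
  have hzm : z ∈ φ.target ×ˢ ({0}ᶜ : Set (Model n)) := hc.coordTM_mem hφ (hIU htI) ht
  have h1 : nablaField S c I φ x =ᶠ[𝓝[I] t]
      fun u => x' u + connCoeff S φ (coordTM φ (velocity c u)) (x u) := by
    filter_upwards [hx, self_mem_nhdsWithin] with u hu huI
    exact nablaField_eq_of_hasDerivWithinAt hI huI hu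
  have hN := (hasDerivAt_connCoeff hS hc hU hφ (hIU htI) ht).hasDerivWithinAt (s := I)
  -- Here `∇²x = x'' + N'x + 2Nx' + NNx`. Adding `Φx` cancels `N'x` and `NNx` and leaves `x'' +
  -- 2(∂G/∂x · x + Nx')`.
  rw [nablaField_congr htI h1, nablaField_eq_of_hasDerivWithinAt hI htI
    (hx'.fun_add (hN.clm_apply (hx.self_of_nhdsWithin htI))), fderiv_fieldInCoord_apply hS hφ hzm,
    jacobiEndo]
  simp only [← hz, sub_apply, smul_apply,
    ContinuousLinearMap.comp_apply, ContinuousLinearMap.inl_apply, map_add]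
  module

end CovariantDerivative

end SprayGeometry
end

noncomputable section

namespace SprayGeometry

/-- The truth value of `P` is locally constant on a connected set. This carries statements proved
inside one chart along the whole curve. -/
theorem forall_of_local_propagation {I : Set ℝ} (hI : IsPreconnected I) {P : ℝ → Prop}
    (h : ∀ t ∈ I, ∃ O, IsOpen O ∧ t ∈ O ∧ ∀ u ∈ O ∩ I, P u → ∀ v ∈ O ∩ I, P v)
    {t₀ : ℝ} (ht₀ : t₀ ∈ I) (h₀ : P t₀) : ∀ t ∈ I, P t := by
  intro t ht
  refine hI.induction₂' (fun x y => P x → P y) ?_ (fun x y z _ _ _ hxy hyz hx => hyz (hxy hx))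
    ht₀ ht h₀
  intro x hx
  obtain ⟨O, hO, hxO, hP⟩ := h x hx
  filter_upwards [mem_nhdsWithin_of_mem_nhds (hO.mem_nhds hxO), self_mem_nhdsWithin] with y hyO hyI
  exact ⟨fun hPx => hP x ⟨hxO, hx⟩ hPx y ⟨hyO, hyI⟩, fun hPy => hP y ⟨hyO, hyI⟩ hPy x ⟨hxO, hx⟩⟩

theorem isOpen_cube (k : ℕ) (ε : ℝ) : IsOpen (cube k ε) := by
  have : cube k ε = ⋂ a, (fun s : Fin k → ℝ => s a) ⁻¹' Ioo (-ε) ε := by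
    ext s; simp [cube]
  rw [this]
  exact isOpen_iInter_of_finite fun a => isOpen_Ioo.preimage (continuous_apply a)

theorem zero_mem_cube {k : ℕ} {ε : ℝ} (hε : 0 < ε) : (0 : Fin k → ℝ) ∈ cube k ε := by
  intro a
  simp [hε]

/-! ### Parallel fields, Jacobi fields and variation fields. -/

section Fields

set_option linter.unusedSectionVars false

variable {n : ℕ} {M : Type*} [TopologicalSpace M] [ChartedSpace (Model n) M]
  [IsManifold 𝓘(ℝ, Model n) ∞ M] {φ : OpenPartialHomeomorph M (Model n)}
  {S : SecondOrderField n M} {c : ℝ → M} {I U : Set ℝ} {t : ℝ}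

theorem contDiffWithinAt_fieldCoord (hφ : φ ∈ IsManifold.maximalAtlas 𝓘(ℝ, Model n) ∞ M)
    {X : FieldAlong n c}
    (hX : ContMDiffWithinAt 𝓘(ℝ, ℝ) (modelTM n) ∞ (fun t => (⟨c t, X t⟩ : TM n M)) I t)
    (ht : c t ∈ φ.source) : ContDiffWithinAt ℝ ∞ (fieldCoord φ X) I t := by
  have h1 : ContMDiffAt (modelTM n) 𝓘(ℝ, Model n × Model n) ∞ (coordTM φ) (⟨c t, X t⟩ : TM n M) :=
    (contMDiffOn_coordTM hφ).contMDiffAt ((isOpen_proj_preimage φ).mem_nhds ht)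
  have h2 := ContMDiffAt.comp_contMDiffWithinAt t h1 hX
  rw [contMDiffWithinAt_iff_contDiffWithinAt] at h2
  exact h2.snd

theorem IsParallel.hasDerivWithinAt {X : FieldAlong n c} (hX : IsParallel S c I X)
    (hφ : φ ∈ IsManifold.maximalAtlas 𝓘(ℝ, Model n) ∞ M) (htI : t ∈ I) (ht : c t ∈ φ.source) :
    HasDerivWithinAt (fieldCoord φ X)
      (-connCoeff S φ (coordTM φ (velocity c t)) (fieldCoord φ X t)) I t := by
  have h1 := ((contDiffWithinAt_fieldCoord hφ (hX.smooth t htI) ht).differentiableWithinAt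
    (by simp)).hasDerivWithinAt
  have h2 := hX.parallel φ hφ t htI ht
  rw [nablaField] at h2
  rwa [eq_neg_of_add_eq_zero_left h2] at h1

/-- The velocity of a geodesic is parallel. -/
theorem IsGeodesicOn.hasDerivAt_velocity (hS : IsSpray S) (hc : IsGeodesicOn S c U)
    (hU : IsOpen U) (hφ : φ ∈ IsManifold.maximalAtlas 𝓘(ℝ, Model n) ∞ M) (htU : t ∈ U)
    (ht : c t ∈ φ.source) :
    HasDerivAt (fun u => (coordTM φ (velocity c u)).2)
      (-connCoeff S φ (coordTM φ (velocity c t)) (coordTM φ (velocity c t)).2) t := by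
  have hz := hc.coordTM_mem hφ htU ht
  have h := (ContinuousLinearMap.snd ℝ (Model n) (Model n)).hasFDerivAt.comp_hasDerivAt t
    (hc.hasDerivAt hU hφ htU ht)
  rw [fieldInCoord_eq hS.toIsSemispray hφ hz] at h
  -- Homogeneity enters here: the Euler relation rewrites `y' = -2G` as `y' = -N(y)`.
  rw [connCoeff_apply_self hS hφ hz, ← neg_smul]
  exact h

theorem continuousAt_connCoeff (hS : IsSemispray S) (hc : IsGeodesicOn S c U)
    (hU : IsOpen U) (hφ : φ ∈ IsManifold.maximalAtlas 𝓘(ℝ, Model n) ∞ M) (htU : t ∈ U)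
    (ht : c t ∈ φ.source) :
    ContinuousAt (fun u => connCoeff S φ (coordTM φ (velocity c u))) t :=
  (hasDerivAt_connCoeff hS hc hU hφ htU ht).continuousAt

theorem exists_chart_interval (hc : IsGeodesicOn S c U) (hU : IsOpen U) (htU : t ∈ U)
    (φ : OpenPartialHomeomorph M (Model n)) (ht : c t ∈ φ.source) :
    ∃ δ > 0, ∀ u ∈ Ioo (t - δ) (t + δ), u ∈ U ∧ c u ∈ φ.source := by
  have hcont : ContinuousAt c t := hc.smooth.continuousOn.continuousAt (hU.mem_nhds htU)
  obtain ⟨δ, hδ, h⟩ := Metric.eventually_nhds_iff_ball.1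
    ((hU.eventually_mem htU).and (hcont.eventually (φ.open_source.mem_nhds ht)))
  refine ⟨δ, hδ, fun u hu => h u ?_⟩
  rwa [Real.ball_eq_Ioo]

theorem mfderiv_chart_injective (hφ : φ ∈ IsManifold.maximalAtlas 𝓘(ℝ, Model n) ∞ M) {x : M}
    (hx : x ∈ φ.source) :
    Function.Injective (mfderiv 𝓘(ℝ, Model n) 𝓘(ℝ, Model n) φ x) :=
  (mdifferentiable_chart hφ).mfderiv_injective hx

/-- A parallel field that vanishes somewhere vanishes. -/
theorem eq_zero_of_parallel (hS : IsSemispray S) (hc : IsGeodesicOn S c U) (hU : IsOpen U)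
    (hI : I.OrdConnected) (hIU : I ⊆ U) {X : FieldAlong n c}
    (hX : ∀ φ ∈ IsManifold.maximalAtlas 𝓘(ℝ, Model n) ∞ M, ∀ t ∈ I, c t ∈ φ.source →
      HasDerivWithinAt (fieldCoord φ X)
        (-connCoeff S φ (coordTM φ (velocity c t)) (fieldCoord φ X t)) I t)
    {t₀ : ℝ} (ht₀ : t₀ ∈ I) (h₀ : X t₀ = 0) : ∀ t ∈ I, X t = 0 := by
  refine forall_of_local_propagation hI.isPreconnected (fun t ht => ?_) ht₀ h₀
  set φ := chartAt (Model n) (c t)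
  have hφ : φ ∈ IsManifold.maximalAtlas 𝓘(ℝ, Model n) ∞ M := IsManifold.chart_mem_maximalAtlas _
  obtain ⟨δ, hδ, hsub⟩ := exists_chart_interval hc hU (hIU ht) φ (mem_chart_source _ _)
  refine ⟨Ioo (t - δ) (t + δ), isOpen_Ioo, ⟨by linarith, by linarith⟩, fun u hu hXu v hv => ?_⟩
  have hz := eq_zero_of_hasDerivWithinAt_linear (I := Ioo (t - δ) (t + δ) ∩ I)
    (ordConnected_Ioo.inter hI)
    (A := fun u => -connCoeff S φ (coordTM φ (velocity c u))) (u := fieldCoord φ X)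
    (fun w hw => (continuousAt_connCoeff hS hc hU hφ (hsub w hw.1).1
      (hsub w hw.1).2).neg.continuousWithinAt)
    (fun w hw => (hX φ hφ w hw.2 (hsub w hw.1).2).mono inter_subset_right) hu
    (by rw [fieldCoord, hXu]; exact map_zero _) v hv
  exact mfderiv_chart_injective hφ (hsub v hv.1).2 (hz.trans (map_zero _).symm)

/-- The Jacobi equation for a vector field along a geodesic, as the linearization in coordinates of
the geodesic equation. -/
def SolvesJacobi (S : SecondOrderField n M) (c : ℝ → M) (I : Set ℝ) (X : FieldAlong n c) : Prop :=
  ∀ φ ∈ IsManifold.maximalAtlas 𝓘(ℝ, Model n) ∞ M, ∀ t ∈ I, c t ∈ φ.source →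
    HasDerivWithinAt (fun u => (fieldCoord φ X u, derivWithin (fieldCoord φ X) I u))
      (fderiv ℝ (fieldInCoord S φ) (coordTM φ (velocity c t))
        (fieldCoord φ X t, derivWithin (fieldCoord φ X) I t)) I t

/-- Within one chart the difference of the pairs `(X, X')` and `(Y, Y')` solves a homogeneous linear
equation and vanishes at `u`. -/
theorem SolvesJacobi.eq_of_chart (hS : IsSemispray S) (hc : IsGeodesicOn S c U) (hU : IsOpen U)
    (hI : I.OrdConnected) {X Y : FieldAlong n c} (hX : SolvesJacobi S c I X)
    (hY : SolvesJacobi S c I Y) (hφ : φ ∈ IsManifold.maximalAtlas 𝓘(ℝ, Model n) ∞ M)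
    {O : Set ℝ} (hO : O.OrdConnected) (hsub : ∀ u ∈ O, u ∈ U ∧ c u ∈ φ.source) {u : ℝ}
    (hu : u ∈ O ∩ I) (hval : fieldCoord φ X u = fieldCoord φ Y u)
    (hder : derivWithin (fieldCoord φ X) I u = derivWithin (fieldCoord φ Y) I u) :
    ∀ w ∈ O ∩ I, X w = Y w := by
  intro v hv
  have hz := eq_zero_of_hasDerivWithinAt_linear (I := O ∩ I) (hO.inter hI)
    (A := fun u => fderiv ℝ (fieldInCoord S φ) (coordTM φ (velocity c u)))
    (u := fun u => (fieldCoord φ X u, derivWithin (fieldCoord φ X) I u)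
      - (fieldCoord φ Y u, derivWithin (fieldCoord φ Y) I u))
    (fun w hw => ?_) (fun w hw => ?_) hu (by simp [hval, hder]) v hv
  · exact mfderiv_chart_injective hφ (hsub v hv.1).2 (congrArg Prod.fst (sub_eq_zero.1 hz))
  · have hw' := hsub w hw.1
    have hzm := hc.coordTM_mem hφ hw'.1 hw'.2
    have h1 : ContinuousAt (fderiv ℝ (fieldInCoord S φ)) (coordTM φ (velocity c w)) :=
      (((contDiffOn_fieldInCoord hS hφ).contDiffAt ((isOpen_coordDomain φ).mem_nhds hzm)
        ).fderiv_right (m := ∞) (by simp)).continuousAt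
    exact (ContinuousAt.comp (f := fun u => coordTM φ (velocity c u)) h1
      (hc.hasDerivAt hU hφ hw'.1 hw'.2).continuousAt).continuousWithinAt
  · have hw' := (hsub w hw.1).2
    have h1 := ((hX φ hφ w hw.2 hw').fun_sub (hY φ hφ w hw.2 hw')).mono
      (inter_subset_right : O ∩ I ⊆ I)
    rwa [← map_sub] at h1

/-- Two solutions of the Jacobi equation with the same initial data agree. -/
theorem SolvesJacobi.eq (hS : IsSemispray S) (hc : IsGeodesicOn S c U) (hU : IsOpen U)
    (hI : I.OrdConnected) (hIU : I ⊆ U) {X Y : FieldAlong n c} (hX : SolvesJacobi S c I X)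
    (hY : SolvesJacobi S c I Y) (hφ : φ ∈ IsManifold.maximalAtlas 𝓘(ℝ, Model n) ∞ M)
    {t₀ : ℝ} (ht₀ : t₀ ∈ I) (ht₀' : c t₀ ∈ φ.source)
    (hval : fieldCoord φ X t₀ = fieldCoord φ Y t₀)
    (hder : derivWithin (fieldCoord φ X) I t₀ = derivWithin (fieldCoord φ Y) I t₀) :
    ∀ t ∈ I, X t = Y t := by
  -- The equation has second order, so equality at a time does not propagate. Equality near a time
  -- does: it includes the derivatives and does not depend on the chart.
  suffices h : ∀ t ∈ I, ∀ᶠ u in 𝓝[I] t, X u = Y u from fun t ht => (h t ht).self_of_nhdsWithin ht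
  have hev : ∀ {O : Set ℝ}, IsOpen O → (∀ u ∈ O ∩ I, X u = Y u) → ∀ v ∈ O ∩ I,
      ∀ᶠ u in 𝓝[I] v, X u = Y u := by
    intro O hO h v hv
    filter_upwards [mem_nhdsWithin_of_mem_nhds (hO.mem_nhds hv.1), self_mem_nhdsWithin]
      with w hwO hwI
    exact h w ⟨hwO, hwI⟩
  refine forall_of_local_propagation hI.isPreconnected (fun t ht => ?_) ht₀ ?_
  · set ψ := chartAt (Model n) (c t)
    have hψ : ψ ∈ IsManifold.maximalAtlas 𝓘(ℝ, Model n) ∞ M := IsManifold.chart_mem_maximalAtlas _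
    obtain ⟨δ, hδ, hsub⟩ := exists_chart_interval hc hU (hIU ht) ψ (mem_chart_source _ _)
    refine ⟨Ioo (t - δ) (t + δ), isOpen_Ioo, ⟨by linarith, by linarith⟩, fun u hu hXu => ?_⟩
    have hXY : fieldCoord ψ X =ᶠ[𝓝[I] u] fieldCoord ψ Y := by
      filter_upwards [hXu] with w hw
      exact congrArg (mfderiv 𝓘(ℝ, Model n) 𝓘(ℝ, Model n) ψ (c w)) hw
    have hval := hXY.self_of_nhdsWithin hu.2
    exact hev isOpen_Ioo (hX.eq_of_chart hS hc hU hI hY hψ ordConnected_Ioo hsub hu hval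
      (hXY.derivWithin_eq hval))
  · obtain ⟨δ, hδ, hsub⟩ := exists_chart_interval hc hU (hIU ht₀) φ ht₀'
    have h0 : t₀ ∈ Ioo (t₀ - δ) (t₀ + δ) ∩ I := ⟨⟨by linarith, by linarith⟩, ht₀⟩
    exact hev isOpen_Ioo
      (hX.eq_of_chart hS hc hU hI hY hφ ordConnected_Ioo hsub h0 hval hder) _ h0

/-- The fibre coordinate of the velocity is the derivative of `φ ∘ V` in the direction `(1, 0)`,
hence smooth in time and parameters jointly. -/
theorem IsGeodesicVariation.contDiffAt_coordTM_velocity {k : ℕ} {V : ℝ × (Fin k → ℝ) → M} {ε : ℝ}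
    (hV : IsGeodesicVariation S c I ε V) (hI : IsOpen I)
    (hφ : φ ∈ IsManifold.maximalAtlas 𝓘(ℝ, Model n) ∞ M) {p : ℝ × (Fin k → ℝ)}
    (hp : p ∈ I ×ˢ cube k ε) (hp' : V p ∈ φ.source) :
    ContDiffAt ℝ ∞ (fun q => coordTM φ (velocity (fun u => V (u, q.2)) q.1)) p := by
  have hopen : IsOpen (I ×ˢ cube k ε) := hI.prod (isOpen_cube k ε)
  have hVs : ContMDiffAt 𝓘(ℝ, ℝ × (Fin k → ℝ)) 𝓘(ℝ, Model n) ∞ V p :=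
    hV.smooth.contMDiffAt (hopen.mem_nhds hp)
  have hx : ContDiffAt ℝ ∞ (fun q => φ (V q)) p := contDiffAt_chart_comp hφ hVs hp'
  refine (hx.prodMk ((hx.fderiv_right (m := ∞) (by simp)).clm_apply
      (contDiffAt_const (c := ((1 : ℝ), (0 : Fin k → ℝ)))))).congr_of_eventuallyEq ?_
  filter_upwards [hopen.eventually_mem hp,
    hVs.continuousAt.eventually (φ.open_source.mem_nhds hp')] with q hq hqs
  have hqd : DifferentiableAt ℝ (fun q => φ (V q)) q :=
    (contDiffAt_chart_comp hφ (hV.smooth.contMDiffAt (hopen.mem_nhds hq)) hqs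
      ).differentiableAt (by simp)
  have hg := hV.geodesic q.2 hq.2
  have h1 := coordTM_velocity hφ (γ := fun u => V (u, q.2)) (t := q.1)
    ((hg.smooth.contMDiffAt (hI.mem_nhds hq.1)).mdifferentiableAt (by simp)) hqs
  have h2 := hqd.hasFDerivAt.comp_hasDerivAt (f := fun u => (u, q.2)) q.1
    ((hasDerivAt_id q.1).prodMk (hasDerivAt_const q.1 q.2))
  exact h1.trans (Prod.ext rfl h2.deriv)

/-- The variation field of a geodesic variation satisfies the Jacobi equation in coordinates. -/
theorem IsGeodesicVariation.hasDerivAt {k : ℕ} {V : ℝ × (Fin k → ℝ) → M} {ε : ℝ}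
    (hS : IsSemispray S) (hV : IsGeodesicVariation S c I ε V) (hI : IsOpen I)
    (hφ : φ ∈ IsManifold.maximalAtlas 𝓘(ℝ, Model n) ∞ M) (htI : t ∈ I) (ht : c t ∈ φ.source)
    (e : Fin k → ℝ) :
    HasDerivAt (fun u => fderiv ℝ (fun s => coordTM φ (velocity (fun u => V (u, s)) u)) 0 e)
      (fderiv ℝ (fieldInCoord S φ) (coordTM φ (velocity c t))
        (fderiv ℝ (fun s => coordTM φ (velocity (fun u => V (u, s)) t)) 0 e)) t ∧
    (fderiv ℝ (fun s => coordTM φ (velocity (fun u => V (u, s)) t)) 0 e).1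
      = fderiv ℝ (fun s => φ (V (t, s))) 0 e ∧
    ContDiffAt ℝ ∞ (fun u => fderiv ℝ (fun s => φ (V (u, s))) 0 e) t := by
  have hopen : IsOpen (I ×ˢ cube k ε) := hI.prod (isOpen_cube k ε)
  have h0 : (t, (0 : Fin k → ℝ)) ∈ I ×ˢ cube k ε := ⟨htI, zero_mem_cube hV.pos⟩
  have hVt : V (t, 0) ∈ φ.source := by rwa [hV.base t htI]
  have hVs : ContMDiffAt 𝓘(ℝ, ℝ × (Fin k → ℝ)) 𝓘(ℝ, Model n) ∞ V (t, 0) :=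
    hV.smooth.contMDiffAt (hopen.mem_nhds h0)
  have hx : ContDiffAt ℝ ∞ (fun q => φ (V q)) (t, 0) := contDiffAt_chart_comp hφ hVs hVt
  have hdom : ∀ᶠ q in 𝓝 (t, (0 : Fin k → ℝ)), q ∈ I ×ˢ cube k ε ∧ V q ∈ φ.source :=
    (hopen.eventually_mem h0).and (hVs.continuousAt.eventually (φ.open_source.mem_nhds hVt))
  have hxd : ∀ᶠ q in 𝓝 (t, (0 : Fin k → ℝ)), DifferentiableAt ℝ (fun q => φ (V q)) q := by
    filter_upwards [hdom] with q hq
    exact (contDiffAt_chart_comp hφ (hV.smooth.contMDiffAt (hopen.mem_nhds hq.1)) hq.2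
      ).differentiableAt (by simp)
  set z : ℝ × (Fin k → ℝ) → Model n × Model n :=
    fun q => coordTM φ (velocity (fun u => V (u, q.2)) q.1) with hz
  have hzs : ContDiffAt ℝ ∞ z (t, 0) := hV.contDiffAt_coordTM_velocity hI hφ h0 hVt
  have hbase : ∀ u ∈ I, velocity (fun u => V (u, 0)) u = (velocity c u : TM n M) := fun u hu =>
    velocity_congr (by filter_upwards [hI.mem_nhds hu] with w hw using hV.base w hw)
  have hz0 : z (t, 0) = coordTM φ (velocity c t) := congrArg (coordTM φ) (hbase t htI)
  have hode : ∀ᶠ q in 𝓝 (t, (0 : Fin k → ℝ)),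
      HasDerivAt (fun u => z (u, q.2)) (fieldInCoord S φ (z q)) q.1 := by
    filter_upwards [hdom] with q hq
    exact (hV.geodesic q.2 hq.1.2).hasDerivAt hI hφ hq.1.1 hq.2
  have hzm : z (t, 0) ∈ φ.target ×ˢ ({0}ᶜ : Set (Model n)) :=
    (hV.geodesic 0 h0.2).coordTM_mem hφ htI hVt
  have hf : DifferentiableAt ℝ (fieldInCoord S φ) (z (t, 0)) :=
    ((contDiffOn_fieldInCoord hS hφ).contDiffAt ((isOpen_coordDomain φ).mem_nhds hzm)
      ).differentiableAt (by simp)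
  refine ⟨?_, ?_, ?_⟩
  · have h := hasDerivAt_variation hzs hf hode e
    rw [hz0] at h
    exact h
  · have h1 : DifferentiableAt ℝ (fun s => z (t, s)) 0 :=
      (hzs.differentiableAt (by simp)).comp (f := fun s => (t, s)) 0 (by fun_prop)
    have h2 := (hasFDerivAt_fst.comp (0 : Fin k → ℝ) h1.hasFDerivAt).fderiv
    exact (congrArg (fun L => L e) h2).symm
  · have hev : (fun u => fderiv ℝ (fun s => φ (V (u, s))) 0 e) =ᶠ[𝓝 t]
        fun u => fderiv ℝ (fun q => φ (V q)) (u, 0) (0, e) := by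
      have hc : ContinuousAt (fun u : ℝ => (u, (0 : Fin k → ℝ))) t := by fun_prop
      filter_upwards [hc.eventually hxd] with u hu
      have h := hu.hasFDerivAt.comp (f := fun s => (u, s)) (0 : Fin k → ℝ)
        ((hasFDerivAt_const u (0 : Fin k → ℝ)).prodMk (hasFDerivAt_id _))
      have h' : fderiv ℝ (fun s => φ (V (u, s))) 0 = _ := h.fderiv
      rw [h']
      simp
    refine ContDiffAt.congr_of_eventuallyEq ?_ hev
    exact (ContDiffAt.comp (f := fun u : ℝ => (u, (0 : Fin k → ℝ))) t
      (hx.fderiv_right (m := ∞) (by simp)) (by fun_prop)).clm_apply contDiffAt_const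

/-- The coordinates of the variation field of a variation. -/
theorem mfderiv_paramDeriv {k : ℕ} {V : ℝ × (Fin k → ℝ) → M} {ε : ℝ}
    (hV : IsGeodesicVariation S c I ε V) (hI : IsOpen I)
    (hφ : φ ∈ IsManifold.maximalAtlas 𝓘(ℝ, Model n) ∞ M) (htI : t ∈ I) (ht : c t ∈ φ.source)
    (a : Fin k) :
    (mfderiv 𝓘(ℝ, Model n) 𝓘(ℝ, Model n) φ (c t) : Model n →L[ℝ] Model n)
      (paramDeriv V a t : TM n M).2 = fderiv ℝ (fun s => φ (V (t, s))) 0 (Pi.single a 1) := by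
  have hVt : V (t, 0) ∈ φ.source := by rwa [hV.base t htI]
  have hVs : MDifferentiableAt 𝓘(ℝ, ℝ × (Fin k → ℝ)) 𝓘(ℝ, Model n) V (t, 0) :=
    (hV.smooth.contMDiffAt ((hI.prod (isOpen_cube k ε)).mem_nhds
      ⟨htI, zero_mem_cube hV.pos⟩)).mdifferentiableAt (by simp)
  have hVs' : MDifferentiableAt 𝓘(ℝ, Fin k → ℝ) 𝓘(ℝ, Model n) (fun s => V (t, s)) 0 :=
    hVs.comp (f := fun s : Fin k → ℝ => (t, s)) 0
      (DifferentiableAt.mdifferentiableAt (by fun_prop))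
  have h := mfderiv_comp (0 : Fin k → ℝ) (g := φ)
    ((mdifferentiable_chart hφ).mdifferentiableAt hVt) hVs'
  rw [mfderiv_eq_fderiv, hV.base t htI] at h
  exact (congrArg (fun L => L (Pi.single a (1 : ℝ))) h).symm

theorem IsGeodesicVariation.fieldCoord_eq {k : ℕ} {V : ℝ × (Fin k → ℝ) → M} {ε : ℝ}
    (hS : IsSemispray S) (hV : IsGeodesicVariation S c U ε V) (hU : IsOpen U)
    (hφ : φ ∈ IsManifold.maximalAtlas 𝓘(ℝ, Model n) ∞ M) {a : Fin k} {X : FieldAlong n c}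
    (htU : t ∈ U) (ht : c t ∈ φ.source) (hX : (X t : Model n) = (paramDeriv V a t : TM n M).2) :
    fieldCoord φ X t
      = (fderiv ℝ (fun s => coordTM φ (velocity (fun u => V (u, s)) t)) 0 (Pi.single a 1)).1 := by
  rw [(hV.hasDerivAt hS hU hφ htU ht (Pi.single a 1)).2.1, ← mfderiv_paramDeriv hV hU hφ htU ht a]
  exact congrArg (mfderiv 𝓘(ℝ, Model n) 𝓘(ℝ, Model n) φ (c t)) hX

/-- Since `F` has first component `y`, the first component of the variational equation says that the
derivative of the variation field is the parameter derivative of the fibre coordinate. -/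
theorem IsGeodesicVariation.hasDerivWithinAt_fieldCoord {k : ℕ} {V : ℝ × (Fin k → ℝ) → M} {ε : ℝ}
    (hS : IsSemispray S) (hV : IsGeodesicVariation S c U ε V) (hU : IsOpen U)
    (hφ : φ ∈ IsManifold.maximalAtlas 𝓘(ℝ, Model n) ∞ M) (hcU : IsGeodesicOn S c U)
    (hIU : I ⊆ U) {a : Fin k} {X : FieldAlong n c}
    (hX : ∀ t ∈ I, (X t : Model n) = (paramDeriv V a t : TM n M).2)
    (htI : t ∈ I) (ht : c t ∈ φ.source) :
    HasDerivWithinAt (fieldCoord φ X)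
      (fderiv ℝ (fun s => coordTM φ (velocity (fun u => V (u, s)) t)) 0 (Pi.single a 1)).2 I t := by
  have h1 := (ContinuousLinearMap.fst ℝ (Model n) (Model n)).hasFDerivAt.comp_hasDerivAt t
    (hV.hasDerivAt hS hU hφ (hIU htI) ht (Pi.single a 1)).1
  rw [fderiv_fieldInCoord_apply hS hφ (hcU.coordTM_mem hφ (hIU htI) ht)] at h1
  refine (h1.hasDerivWithinAt (s := I)).congr_of_eventuallyEq ?_
    (hV.fieldCoord_eq hS hU hφ (hIU htI) ht (hX t htI))
  have hct : ContinuousAt c t := hcU.smooth.continuousOn.continuousAt (hU.mem_nhds (hIU htI))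
  filter_upwards [self_mem_nhdsWithin,
    mem_nhdsWithin_of_mem_nhds (hct.eventually (φ.open_source.mem_nhds ht))] with u hu hus
  exact hV.fieldCoord_eq hS hU hφ (hIU hu) hus (hX u hu)

theorem IsGeodesicVariation.solvesJacobi {k : ℕ} {V : ℝ × (Fin k → ℝ) → M} {ε : ℝ}
    (hS : IsSemispray S) (hV : IsGeodesicVariation S c U ε V) (hU : IsOpen U)
    (hcU : IsGeodesicOn S c U) (hIU : I ⊆ U) (hI : UniqueDiffOn ℝ I) {a : Fin k}
    {X : FieldAlong n c} (hX : ∀ t ∈ I, (X t : Model n) = (paramDeriv V a t : TM n M).2) :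
    SolvesJacobi S c I X := by
  intro φ hφ t htI ht
  have hpair : ∀ u ∈ I, c u ∈ φ.source →
      (fieldCoord φ X u, derivWithin (fieldCoord φ X) I u)
        = fderiv ℝ (fun s => coordTM φ (velocity (fun w => V (w, s)) u)) 0 (Pi.single a 1) := by
    intro u hu hus
    exact Prod.ext (hV.fieldCoord_eq hS hU hφ (hIU hu) hus (hX u hu))
      ((hV.hasDerivWithinAt_fieldCoord hS hU hφ hcU hIU hX hu hus).derivWithin (hI u hu))
  rw [hpair t htI ht]
  refine ((hV.hasDerivAt hS hU hφ (hIU htI) ht (Pi.single a 1)).1.hasDerivWithinAt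
    (s := I)).congr_of_eventuallyEq ?_ (hpair t htI ht)
  have hct : ContinuousAt c t := hcU.smooth.continuousOn.continuousAt (hU.mem_nhds (hIU htI))
  filter_upwards [self_mem_nhdsWithin,
    mem_nhdsWithin_of_mem_nhds (hct.eventually (φ.open_source.mem_nhds ht))] with u hu hus
  exact hpair u hu hus

end Fields

end SprayGeometry
end

noncomputable section

namespace SprayGeometry

/-! ### Frames as linear maps. -/

section FrameMap

variable {n k : ℕ}

/-- The linear map with columns `v, w_1, …, w_k`. -/
def frameMap (v : Model n) (w : Fin k → Model n) : (ℝ × (Fin k → ℝ)) →L[ℝ] Model n :=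
  (ContinuousLinearMap.fst ℝ ℝ (Fin k → ℝ)).smulRight v
    + ∑ a, ((ContinuousLinearMap.proj a).comp
        (ContinuousLinearMap.snd ℝ ℝ (Fin k → ℝ))).smulRight (w a)

theorem frameMap_apply (v : Model n) (w : Fin k → Model n) (p : ℝ × (Fin k → ℝ)) :
    frameMap v w p = p.1 • v + ∑ a, p.2 a • w a := by
  simp [frameMap]

theorem frameMap_apply_fst (v : Model n) (w : Fin k → Model n) : frameMap v w (1, 0) = v := by
  simp [frameMap_apply]

theorem frameMap_apply_single (v : Model n) (w : Fin k → Model n) (a : Fin k) :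
    frameMap v w (0, Pi.single a 1) = w a := by
  simp [frameMap_apply, Pi.single_apply]

theorem comp_frameMap (L : Model n →L[ℝ] Model n) (v : Model n) (w : Fin k → Model n) :
    L.comp (frameMap v w) = frameMap (L v) (fun a => L (w a)) := by
  ext p <;> simp [frameMap_apply]

theorem contDiffWithinAt_frameMap {v : ℝ → Model n} {w : Fin k → ℝ → Model n} {I : Set ℝ} {t : ℝ}
    (hv : ContDiffWithinAt ℝ ∞ v I t) (hw : ∀ a, ContDiffWithinAt ℝ ∞ (w a) I t) :
    ContDiffWithinAt ℝ ∞ (fun u => frameMap (v u) (fun a => w a u)) I t := by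
  have h : ∀ L : (ℝ × (Fin k → ℝ)) →L[ℝ] ℝ, ∀ {x : ℝ → Model n}, ContDiffWithinAt ℝ ∞ x I t →
      ContDiffWithinAt ℝ ∞ (fun u => L.smulRight (x u)) I t := fun L x hx =>
    (ContinuousLinearMap.smulRightL ℝ (ℝ × (Fin k → ℝ)) (Model n) L).contDiff.comp_contDiffWithinAt hx
  exact (h _ hv).add (ContDiffWithinAt.sum fun a _ => h _ (hw a))

theorem isInvertible_frameMap (hk : k + 1 = n) {v : Model n} {w : Fin k → Model n}
    (h : Function.Injective (frameMap v w)) : (frameMap v w).IsInvertible := by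
  have hfin : Module.finrank ℝ (ℝ × (Fin k → ℝ)) = Module.finrank ℝ (Model n) := by
    simp [← hk, add_comm]
  have hsurj := (LinearMap.injective_iff_surjective_of_finrank_eq_finrank
    (f := (frameMap v w : (ℝ × (Fin k → ℝ)) →ₗ[ℝ] Model n)) hfin).1 h
  exact ⟨(LinearEquiv.ofBijective (frameMap v w : (ℝ × (Fin k → ℝ)) →ₗ[ℝ] Model n)
    ⟨h, hsurj⟩).toContinuousLinearEquiv, rfl⟩

end FrameMap

/-! ### The tensor of a geodesic variation is a Jacobi tensor. -/

section Jacobi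

set_option linter.unusedSectionVars false

variable {n : ℕ} {M : Type*} [TopologicalSpace M] [ChartedSpace (Model n) M]
  [IsManifold 𝓘(ℝ, Model n) ∞ M] {φ : OpenPartialHomeomorph M (Model n)}
  {S : SecondOrderField n M} {c : ℝ → M} {I U : Set ℝ} {t : ℝ}

theorem hasDerivWithinAt_prodMk_iff {E F : Type*} [NormedAddCommGroup E] [NormedSpace ℝ E]
    [NormedAddCommGroup F] [NormedSpace ℝ F] {f : ℝ → E} {g : ℝ → F} {p : E × F} :
    HasDerivWithinAt (fun u => (f u, g u)) p I t
      ↔ HasDerivWithinAt f p.1 I t ∧ HasDerivWithinAt g p.2 I t := by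
  refine ⟨fun h => ⟨?_, ?_⟩, fun h => h.1.prodMk h.2⟩
  · exact (ContinuousLinearMap.fst ℝ E F).hasFDerivAt.comp_hasDerivWithinAt t h
  · exact (ContinuousLinearMap.snd ℝ E F).hasFDerivAt.comp_hasDerivWithinAt t h

theorem eventually_mem_source (hc : IsGeodesicOn S c U) (hU : IsOpen U) (hIU : I ⊆ U)
    (htI : t ∈ I) (ht : c t ∈ φ.source) : ∀ᶠ u in 𝓝[I] t, u ∈ I ∧ c u ∈ φ.source := by
  have hct : ContinuousAt c t := hc.smooth.continuousOn.continuousAt (hU.mem_nhds (hIU htI))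
  filter_upwards [self_mem_nhdsWithin,
    mem_nhdsWithin_of_mem_nhds (hct.eventually (φ.open_source.mem_nhds ht))] with u hu hus
  exact ⟨hu, hus⟩

/-- Solutions of the linearized geodesic equation satisfy `∇²X + Φ(X) = 0`. -/
theorem SolvesJacobi.nablaField_add_eq_zero (hS : IsSemispray S) (hc : IsGeodesicOn S c U)
    (hU : IsOpen U) (hI : UniqueDiffOn ℝ I) (hIU : I ⊆ U) {X : FieldAlong n c}
    (hX : SolvesJacobi S c I X) (hφ : φ ∈ IsManifold.maximalAtlas 𝓘(ℝ, Model n) ∞ M)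
    (htI : t ∈ I) (ht : c t ∈ φ.source) :
    nablaField S c I φ (nablaField S c I φ (fieldCoord φ X)) t
      + jacobiEndo S φ (coordTM φ (velocity c t)) (fieldCoord φ X t) = 0 := by
  rw [nablaField_nablaField_add_jacobiEndo hS hc hU hφ hI hIU htI ht
    (x' := derivWithin (fieldCoord φ X) I) ?_ (hasDerivWithinAt_prodMk_iff.1 (hX φ hφ t htI ht)).2,
    sub_self]
  filter_upwards [eventually_mem_source hc hU hIU htI ht] with u hu
  have h := (hasDerivWithinAt_prodMk_iff.1 (hX φ hφ u hu.1 hu.2)).1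
  rwa [fderiv_fieldInCoord_apply hS hφ (hc.coordTM_mem hφ (hIU hu.1) hu.2)] at h

/-- Fields with `∇²X + Φ(X) = 0` solve the linearized geodesic equation. -/
theorem solvesJacobi_of_nablaField (hS : IsSemispray S) (hc : IsGeodesicOn S c U)
    (hU : IsOpen U) (hI : UniqueDiffOn ℝ I) (hIU : I ⊆ U) {X : FieldAlong n c}
    (hX : ∀ φ ∈ IsManifold.maximalAtlas 𝓘(ℝ, Model n) ∞ M, ∀ t ∈ I, c t ∈ φ.source →
      DifferentiableWithinAt ℝ (fieldCoord φ X) I t ∧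
      DifferentiableWithinAt ℝ (derivWithin (fieldCoord φ X) I) I t ∧
      nablaField S c I φ (nablaField S c I φ (fieldCoord φ X)) t
        + jacobiEndo S φ (coordTM φ (velocity c t)) (fieldCoord φ X t) = 0) :
    SolvesJacobi S c I X := by
  intro φ hφ t htI ht
  obtain ⟨h1, h2, h3⟩ := hX φ hφ t htI ht
  rw [nablaField_nablaField_add_jacobiEndo hS hc hU hφ hI hIU htI ht
    (x' := derivWithin (fieldCoord φ X) I) ?_ h2.hasDerivWithinAt, sub_eq_zero] at h3
  · rw [hasDerivWithinAt_prodMk_iff, ← h3]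
    refine ⟨?_, h2.hasDerivWithinAt⟩
    rw [fderiv_fieldInCoord_apply hS hφ (hc.coordTM_mem hφ (hIU htI) ht)]
    exact h1.hasDerivWithinAt
  · filter_upwards [eventually_mem_source hc hU hIU htI ht] with u hu
    exact (hX φ hφ u hu.1 hu.2).1.hasDerivWithinAt

theorem IsGeodesicVariation.isGeodesicOn {k : ℕ} {V : ℝ × (Fin k → ℝ) → M} {ε : ℝ}
    (hV : IsGeodesicVariation S c I ε V) (hI : IsOpen I) : IsGeodesicOn S c I := by
  refine isGeodesicOn_of_eventuallyEq fun t ht => ⟨fun u => V (u, 0), I, hI, ht,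
    hV.geodesic 0 (zero_mem_cube hV.pos), ?_⟩
  filter_upwards [hI.mem_nhds ht] with u hu
  exact (hV.base u hu).symm

/-- A tangent vector as an element of the model space. -/
def toModel {x : M} (v : TangentSpace 𝓘(ℝ, Model n) x) : Model n := v

/-- The coordinate map of a chart, as an operator on the model space. -/
def chartDeriv (φ : OpenPartialHomeomorph M (Model n)) (x : M) : Model n →L[ℝ] Model n :=
  mfderiv 𝓘(ℝ, Model n) 𝓘(ℝ, Model n) φ x

theorem isInvertible_chartDeriv (hφ : φ ∈ IsManifold.maximalAtlas 𝓘(ℝ, Model n) ∞ M) {x : M}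
    (hx : x ∈ φ.source) : (chartDeriv φ x).IsInvertible :=
  ⟨(mdifferentiable_chart hφ).mfderiv hx, rfl⟩

/-- A transversal parallel frame and the velocity are a basis at all times. -/
theorem IsTransversalFrame.injective (hS : IsSpray S) (hc : IsGeodesicOn S c U) (hU : IsOpen U)
    (hI : I.OrdConnected) (hIU : I ⊆ U) (h0 : (0 : ℝ) ∈ I) {e : Fin (n - 1) → FieldAlong n c}
    (he : IsTransversalFrame S c I e) (htI : t ∈ I) :
    Function.Injective (frameMap (toModel (velocity c t : TM n M).2) (fun a => toModel (e a t))) := by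
  rw [injective_iff_map_eq_zero]
  rintro ⟨β, α⟩ hp
  replace hp := (frameMap_apply _ _ _).symm.trans hp
  -- A relation at time `t` is extended with constant coefficients to a parallel field. It vanishes
  -- at `t`, hence at `0`, where transversality and independence force the coefficients to vanish.
  let X : FieldAlong n c := fun u =>
    β • toModel (velocity c u : TM n M).2 + ∑ a, α a • toModel (e a u)
  have hcoord : ∀ φ : OpenPartialHomeomorph M (Model n), fieldCoord φ X
      = fun u => β • (coordTM φ (velocity c u)).2 + ∑ a, α a • fieldCoord φ (e a) u := by
    intro φ
    funext u
    change chartDeriv φ (c u)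
      (β • toModel (velocity c u : TM n M).2 + ∑ a, α a • toModel (e a u)) = _
    rw [map_add, map_smul, map_sum]
    simp only [map_smul]
    rfl
  have hX : X 0 = 0 := by
    refine eq_zero_of_parallel hS.toIsSemispray hc hU hI hIU (X := X) (fun φ hφ u hu hus => ?_) htI hp 0 h0
    rw [hcoord φ]
    have h1 := ((hc.hasDerivAt_velocity hS hU hφ (hIU hu) hus).hasDerivWithinAt (s := I)).const_smul β
    have h2 := HasDerivWithinAt.fun_sum (u := Finset.univ) (A' := fun a => α a • _) fun a _ =>
      ((he.parallel a).hasDerivWithinAt hφ hu hus).const_smul (α a)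
    refine (h1.fun_add h2).congr_deriv ?_
    simp only [map_add, map_smul, map_sum, smul_neg, Finset.sum_neg_distrib, neg_add]
  let v₀ : TangentSpace 𝓘(ℝ, Model n) (c 0) := (velocity c 0 : TM n M).2
  have hX' : β • v₀ + ∑ a, α a • e a 0 = 0 := hX
  have hβ : β = 0 := by
    by_contra hne
    apply he.transversal
    have hmem : β • v₀ ∈ planeAt e 0 := by
      rw [eq_neg_of_add_eq_zero_left hX']
      exact neg_mem (Submodule.sum_mem _ fun a _ =>
        Submodule.smul_mem _ _ (Submodule.subset_span ⟨a, rfl⟩))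
    exact (Submodule.smul_mem_iff (planeAt e 0) (x := v₀) hne).1 hmem
  subst hβ
  rw [zero_smul, zero_add] at hX'
  have hα := Fintype.linearIndependent_iff.1 he.independent α hX'
  exact Prod.ext rfl (funext hα)

/-- The tensor along `c` that annihilates the velocity and maps the frame to the variation
fields. -/
def inducedTensor {k : ℕ} (c : ℝ → M) (e : Fin k → FieldAlong n c) (V : ℝ × (Fin k → ℝ) → M) :
    TensorAlong n c := fun t =>
  ((frameMap 0 (fun a => toModel (paramDeriv V a t : TM n M).2)).comp
    (frameMap (toModel (velocity c t : TM n M).2) (fun a => toModel (e a t))).inverse :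
    Model n →L[ℝ] Model n)

/-- The value of a tensor along a curve, as an operator on the model space. -/
def endoModel (J : TensorAlong n c) (t : ℝ) : Model n →L[ℝ] Model n := J t

theorem inducedTensor_comp {k : ℕ} {e : Fin k → FieldAlong n c} {V : ℝ × (Fin k → ℝ) → M}
    (h : (frameMap (toModel (velocity c t : TM n M).2) (fun a => toModel (e a t))).IsInvertible) :
    (endoModel (inducedTensor c e V) t).comp
      (frameMap (toModel (velocity c t : TM n M).2) (fun a => toModel (e a t)))
      = frameMap 0 (fun a => toModel (paramDeriv V a t : TM n M).2) := by
  refine ContinuousLinearMap.ext fun p => ?_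
  change (frameMap 0 (fun a => toModel (paramDeriv V a t : TM n M).2))
    ((frameMap (toModel (velocity c t : TM n M).2) (fun a => toModel (e a t))).inverse
      ((frameMap (toModel (velocity c t : TM n M).2) (fun a => toModel (e a t))) p)) = _
  rw [h.inverse_apply_eq.2 rfl]

theorem inducedTensor_velocity {k : ℕ} {e : Fin k → FieldAlong n c} {V : ℝ × (Fin k → ℝ) → M}
    (h : (frameMap (toModel (velocity c t : TM n M).2) (fun a => toModel (e a t))).IsInvertible) :
    endoModel (inducedTensor c e V) t (toModel (velocity c t : TM n M).2) = 0 := by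
  have h := congrArg (fun L => L (1, 0)) (inducedTensor_comp (V := V) h)
  simpa only [ContinuousLinearMap.comp_apply, frameMap_apply_fst] using h

theorem inducedTensor_frame {k : ℕ} {e : Fin k → FieldAlong n c} {V : ℝ × (Fin k → ℝ) → M}
    (h : (frameMap (toModel (velocity c t : TM n M).2) (fun a => toModel (e a t))).IsInvertible)
    (a : Fin k) : endoModel (inducedTensor c e V) t (toModel (e a t))
      = toModel (paramDeriv V a t : TM n M).2 := by
  have h := congrArg (fun L => L (0, Pi.single a 1)) (inducedTensor_comp (V := V) h)
  simpa only [ContinuousLinearMap.comp_apply, frameMap_apply_single] using h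

theorem tensorCoord_apply_fieldCoord (hφ : φ ∈ IsManifold.maximalAtlas 𝓘(ℝ, Model n) ∞ M)
    (J : TensorAlong n c) (X : FieldAlong n c) (ht : c t ∈ φ.source) :
    tensorCoord φ J t (fieldCoord φ X t) = fieldCoord φ (fun u => J u (X u)) t := by
  have h : (chartDeriv φ (c t)).inverse (chartDeriv φ (c t) (X t)) = X t :=
    (isInvertible_chartDeriv hφ ht).inverse_apply_eq.2 rfl
  change (mfderiv 𝓘(ℝ, Model n) 𝓘(ℝ, Model n) φ (c t))
    (J t ((chartDeriv φ (c t)).inverse (chartDeriv φ (c t) (X t)))) = _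
  rw [h]
  rfl

/-- Conjugation by the chart derivative is absorbed into the columns of both frame maps. The entries
are then smooth functions of time, and so is the tensor, since inversion is smooth. -/
theorem tensorCoord_inducedTensor {k : ℕ} {e : Fin k → FieldAlong n c}
    {V : ℝ × (Fin k → ℝ) → M} (hφ : φ ∈ IsManifold.maximalAtlas 𝓘(ℝ, Model n) ∞ M)
    (ht : c t ∈ φ.source) :
    tensorCoord φ (inducedTensor c e V) t
      = (frameMap 0 (fun a => chartDeriv φ (c t) (toModel (paramDeriv V a t : TM n M).2))).comp
        (frameMap (coordTM φ (velocity c t)).2 (fun a => fieldCoord φ (e a) t)).inverse := by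
  have hD := isInvertible_chartDeriv hφ ht
  set L := frameMap (toModel (velocity c t : TM n M).2) (fun a => toModel (e a t)) with hL
  set B := frameMap 0 (fun a => toModel (paramDeriv V a t : TM n M).2) with hB
  have h1 : tensorCoord φ (inducedTensor c e V) t
    = ((chartDeriv φ (c t)).comp B).comp (L.inverse.comp (chartDeriv φ (c t)).inverse) := rfl
  rw [h1, ← hD.inverse_comp_of_left, hL, hB, comp_frameMap, comp_frameMap, map_zero]
  rfl

/-- The Jacobi operator of the tensor is linear at each time, so it suffices to evaluate it on the
parallel basis formed by the velocity and the frame. There it becomes the Jacobi operator of the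
zero field or of a variation field. -/
theorem isJacobiTensor_inducedTensor (hn : 2 ≤ n) (hS : IsSpray S) {ε : ℝ}
    {V : ℝ × (Fin (n - 1) → ℝ) → M} {e : Fin (n - 1) → FieldAlong n c} (hI : IsOpenInterval I)
    (h0 : (0 : ℝ) ∈ I) (hV : IsGeodesicVariation S c I ε V) (he : IsTransversalFrame S c I e) :
    IsJacobiTensor S c I (inducedTensor c e V) := by
  have hc := hV.isGeodesicOn hI.1
  have hIu : UniqueDiffOn ℝ I := hI.1.uniqueDiffOn
  have hk : n - 1 + 1 = n := by omega
  have hinv : ∀ t ∈ I,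
      (frameMap (toModel (velocity c t : TM n M).2) (fun a => toModel (e a t))).IsInvertible :=
    fun t ht => isInvertible_frameMap hk (he.injective hS hc hI.1 hI.2 subset_rfl h0 ht)
  have hinvc : ∀ φ ∈ IsManifold.maximalAtlas 𝓘(ℝ, Model n) ∞ M, ∀ t ∈ I, c t ∈ φ.source →
      (frameMap (coordTM φ (velocity c t)).2 (fun a => fieldCoord φ (e a) t)).IsInvertible := by
    intro φ hφ t ht hts
    have h := (isInvertible_chartDeriv hφ hts).comp (hinv t ht)
    rw [comp_frameMap] at h
    exact h
  have hsm : ∀ φ ∈ IsManifold.maximalAtlas 𝓘(ℝ, Model n) ∞ M, ∀ t ∈ I, c t ∈ φ.source →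
      ContDiffAt ℝ ∞ (tensorCoord φ (inducedTensor c e V)) t := by
    intro φ hφ t ht hts
    have hB : ContDiffWithinAt ℝ ∞ (fun u => frameMap (0 : Model n) (fun a : Fin (n - 1) =>
        fderiv ℝ (fun s => φ (V (u, s))) 0 (Pi.single a 1))) I t :=
      contDiffWithinAt_frameMap contDiffWithinAt_const fun a =>
        (hV.hasDerivAt hS.toIsSemispray hI.1 hφ ht hts (Pi.single a 1)).2.2.contDiffWithinAt
    have hL : ContDiffWithinAt ℝ ∞ (fun u => frameMap (coordTM φ (velocity c u)).2
        (fun a => fieldCoord φ (e a) u)) I t :=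
      contDiffWithinAt_frameMap
        (contDiffAt_coordTM_velocity hφ hI.1 hc.smooth ht hts).snd.contDiffWithinAt
        fun a => contDiffWithinAt_fieldCoord hφ ((he.parallel a).smooth t ht) hts
    have hLi := (hinvc φ hφ t ht hts).contDiffAt_map_inverse (n := ∞)
    have h := (hB.clm_comp (hLi.comp_contDiffWithinAt t hL)).contDiffAt (hI.1.mem_nhds ht)
    refine h.congr_of_eventuallyEq ?_
    have hev := eventually_mem_source (φ := φ) hc hI.1 subset_rfl ht hts
    rw [hI.1.nhdsWithin_eq ht] at hev
    filter_upwards [hev] with u hu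
    rw [tensorCoord_inducedTensor hφ hu.2]
    have hcol : ∀ a, chartDeriv φ (c u) (toModel (paramDeriv V a u : TM n M).2)
        = fderiv ℝ (fun s => φ (V (u, s))) 0 (Pi.single a 1) :=
      fun a => mfderiv_paramDeriv hV hI.1 hφ hu.1 hu.2 a
    simp only [hcol]
    rfl
  refine ⟨fun φ hφ t ht => (hsm φ hφ t ht.1 ht.2).contDiffWithinAt, fun φ hφ t ht hts => ?_⟩
  set A := tensorCoord φ (inducedTensor c e V) with hA
  have hev := eventually_mem_source (φ := φ) hc hI.1 subset_rfl ht hts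
  have hAd : ∀ᶠ u in 𝓝[I] t, DifferentiableWithinAt ℝ A I u := by
    filter_upwards [hev] with u hu
    exact ((hsm φ hφ u hu.1 hu.2).differentiableAt (by simp)).differentiableWithinAt
  have hAd' : DifferentiableWithinAt ℝ (nablaTensor S c I φ A) I t := by
    have hd : DifferentiableWithinAt ℝ (derivWithin A I) I t :=
      ((contDiffAt_deriv_infty (hsm φ hφ t ht hts)).differentiableAt
        (by simp)).differentiableWithinAt.congr_of_eventuallyEq_of_mem (by
          filter_upwards [self_mem_nhdsWithin] with u hu
          exact derivWithin_of_isOpen hI.1 hu) ht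
    have hN : DifferentiableWithinAt ℝ (fun u => connCoeff S φ (coordTM φ (velocity c u))) I t :=
      (hasDerivAt_connCoeff hS.toIsSemispray hc hI.1 hφ ht hts).differentiableAt.differentiableWithinAt
    have hAt := hAd.self_of_nhdsWithin ht
    exact (hd.add (hN.clm_comp hAt)).sub (hAt.clm_comp hN)
  set L := frameMap (coordTM φ (velocity c t)).2 (fun a => fieldCoord φ (e a) t) with hL
  set T := nablaTensor S c I φ (nablaTensor S c I φ A) t
    + (jacobiEndo S φ (coordTM φ (velocity c t))).comp (A t) with hT
  -- For parallel `X` the covariant derivatives pass through `X`, and `T` gives the Jacobi operator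
  -- of the image field `Y`.
  have hfield : ∀ {X Y : FieldAlong n c}, (∀ u ∈ I, inducedTensor c e V u (X u) = Y u) →
      (∀ᶠ u in 𝓝[I] t, HasDerivWithinAt (fieldCoord φ X)
        (-connCoeff S φ (coordTM φ (velocity c u)) (fieldCoord φ X u)) I u) →
      SolvesJacobi S c I Y → T (fieldCoord φ X t) = 0 := by
    intro X Y hXY hX hY
    have hAX : ∀ᶠ u in 𝓝[I] t, A u (fieldCoord φ X u) = fieldCoord φ Y u := by
      filter_upwards [hev] with u hu
      rw [hA, tensorCoord_apply_fieldCoord hφ _ _ hu.2]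
      exact congrArg (mfderiv 𝓘(ℝ, Model n) 𝓘(ℝ, Model n) φ (c u)) (hXY u hu.1)
    have h1 : nablaField S c I φ (fun u => A u (fieldCoord φ X u)) =ᶠ[𝓝[I] t]
        nablaField S c I φ (fieldCoord φ Y) := by
      filter_upwards [eventually_eventually_nhdsWithin.2 hAX, self_mem_nhdsWithin] with u hu huI
      exact nablaField_congr huI hu
    rw [hT, add_apply, ContinuousLinearMap.comp_apply,
      nablaTensor_nablaTensor_apply_parallel hIu ht hAd hAd' hX, nablaField_congr ht h1,
      hAX.self_of_nhdsWithin ht]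
    exact hY.nablaField_add_eq_zero hS.toIsSemispray hc hI.1 hIu subset_rfl hφ ht hts
  have hTL : T.comp L = 0 := by
    have hfst : T (coordTM φ (velocity c t)).2 = 0 := by
      refine hfield (X := fun u => (velocity c u : TM n M).2) (Y := fun _ => 0) (fun u hu => ?_) ?_ ?_
      · exact inducedTensor_velocity (hinv u hu)
      · filter_upwards [hev] with u hu
        exact (hc.hasDerivAt_velocity hS hI.1 hφ hu.1 hu.2).hasDerivWithinAt
      · intro ψ hψ u hu hus
        have hz : fieldCoord ψ (fun _ => 0 : FieldAlong n c) = fun _ => 0 := by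
          funext w
          exact map_zero _
        simp only [hz, derivWithin_fun_const]
        exact (hasDerivWithinAt_const u I (0 : Model n × Model n)).congr_deriv (map_zero _).symm
    have hsnd : ∀ a, T (fieldCoord φ (e a) t) = 0 := by
      intro a
      refine hfield (X := e a) (Y := fun u => inducedTensor c e V u (e a u)) (fun u _ => rfl) ?_ ?_
      · filter_upwards [hev] with u hu
        exact (he.parallel a).hasDerivWithinAt hφ hu.1 hu.2
      · refine hV.solvesJacobi hS.toIsSemispray hI.1 hc subset_rfl hIu (a := a) (fun u hu => ?_)
        exact inducedTensor_frame (hinv u hu) a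
    rw [hL, comp_frameMap, hfst]
    simp only [hsnd]
    ext p <;> simp [frameMap_apply]
  -- `T` vanishes on the columns of an invertible map, so it is zero.
  obtain ⟨Le, hLe⟩ := hinvc φ hφ t ht hts
  refine ContinuousLinearMap.ext fun x => ?_
  have h := congrArg (fun K => K (Le.symm x)) hTL
  have hx : L (Le.symm x) = x := by
    rw [hL, ← hLe]
    exact Le.apply_symm_apply x
  simpa [hx] using h

end Jacobi

/-! ### Uniqueness of the induced tensor. -/

section Induced

set_option linter.unusedSectionVars false

variable {n : ℕ} {M : Type*} [TopologicalSpace M] [ChartedSpace (Model n) M]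
  [IsManifold 𝓘(ℝ, Model n) ∞ M] {S : SecondOrderField n M} {c : ℝ → M} {I : Set ℝ}

theorem isInducedTensor_inducedTensor (hn : 2 ≤ n) (hS : IsSpray S) {ε : ℝ}
    {V : ℝ × (Fin (n - 1) → ℝ) → M} {e : Fin (n - 1) → FieldAlong n c} (hI : IsOpenInterval I)
    (h0 : (0 : ℝ) ∈ I) (hV : IsGeodesicVariation S c I ε V) (he : IsTransversalFrame S c I e) :
    IsInducedTensor c I e V (inducedTensor c e V) ∧
      ∀ J' : TensorAlong n c, IsInducedTensor c I e V J' → ∀ t ∈ I, J' t = inducedTensor c e V t := by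
  have hc := hV.isGeodesicOn hI.1
  have hinv : ∀ t ∈ I,
      (frameMap (toModel (velocity c t : TM n M).2) (fun a => toModel (e a t))).IsInvertible :=
    fun t ht => isInvertible_frameMap (by omega)
      (he.injective hS hc hI.1 hI.2 subset_rfl h0 ht)
  refine ⟨fun t ht => ⟨?_, fun a => ?_⟩, fun J' hJ' t ht => ?_⟩
  · exact inducedTensor_velocity (hinv t ht)
  · exact ext_TM (hV.base t ht).symm (inducedTensor_frame (hinv t ht) a)
  · have hcomp : (endoModel J' t).comp
        (frameMap (toModel (velocity c t : TM n M).2) (fun a => toModel (e a t)))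
        = frameMap 0 (fun a => toModel (paramDeriv V a t : TM n M).2) := by
      rw [comp_frameMap]
      have h1 : (endoModel J' t) (toModel (velocity c t : TM n M).2) = 0 :=
        (hJ' t ht).1
      have h2 : ∀ a, (endoModel J' t) (toModel (e a t))
          = toModel (paramDeriv V a t : TM n M).2 := fun a =>
        congrArg (fun v : TM n M => toModel v.2) ((hJ' t ht).2 a)
      rw [h1]
      simp only [h2]
    obtain ⟨Le, hLe⟩ := hinv t ht
    have h := hcomp.trans (inducedTensor_comp (V := V) (hinv t ht)).symm
    have h2 : endoModel J' t = endoModel (inducedTensor c e V) t := by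
      refine ContinuousLinearMap.ext fun x => ?_
      have hx := congrArg (fun K => K (Le.symm x)) h
      simpa only [ContinuousLinearMap.comp_apply, ← hLe, ContinuousLinearEquiv.coe_coe,
        ContinuousLinearEquiv.apply_symm_apply] using hx
    exact h2

end Induced

end SprayGeometry
end

noncomputable section

namespace SprayGeometry

theorem cube_mono {k : ℕ} {ε ε' : ℝ} (h : ε ≤ ε') : cube k ε ⊆ cube k ε' :=
  fun _ hs a => ⟨(neg_le_neg h).trans_lt (hs a).1, (hs a).2.trans_le h⟩

theorem exists_cube_subset {k : ℕ} {N : Set (Fin k → ℝ)} (hN : N ∈ 𝓝 0) :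
    ∃ ε > 0, cube k ε ⊆ N := by
  obtain ⟨ε, hε, h⟩ := Metric.mem_nhds_iff.1 hN
  refine ⟨ε, hε, fun s hs => h ?_⟩
  rw [mem_ball_zero_iff, pi_norm_lt_iff hε]
  exact fun a => abs_lt.2 (hs a)

/-! ### Variations realizing a transversal Jacobi tensor. -/

section Existence

variable {n : ℕ} {M : Type*} [TopologicalSpace M] [ChartedSpace (Model n) M]
  [IsManifold 𝓘(ℝ, Model n) ∞ M] {φ : OpenPartialHomeomorph M (Model n)}
  {S : SecondOrderField n M} {c : ℝ → M} {I U : Set ℝ} {t : ℝ}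

/-- A Jacobi tensor maps parallel fields to Jacobi fields. -/
theorem IsJacobiTensor.solvesJacobi (hS : IsSemispray S) (hc : IsGeodesicOn S c U)
    (hU : IsOpen U) (hI : UniqueDiffOn ℝ I) (hIU : I ⊆ U) {J : TensorAlong n c}
    (hJ : IsJacobiTensor S c I J) {X : FieldAlong n c} (hX : IsParallel S c I X) :
    SolvesJacobi S c I (fun u => J u (X u)) := by
  refine solvesJacobi_of_nablaField hS hc hU hI hIU fun φ hφ t ht hts => ?_
  set A := tensorCoord φ J with hA
  set y := fieldCoord φ X with hy
  have hev := eventually_mem_source (φ := φ) hc hU hIU ht hts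
  have hsm : ∀ u ∈ I, c u ∈ φ.source → ContDiffWithinAt ℝ ∞ A I u := fun u hu hus =>
    (hJ.smooth φ hφ u ⟨hu, hus⟩).mono_of_mem_nhdsWithin
      (eventually_mem_source (φ := φ) hc hU hIU hu hus)
  have hysm : ∀ u ∈ I, c u ∈ φ.source → ContDiffWithinAt ℝ ∞ y I u := fun u hu hus =>
    contDiffWithinAt_fieldCoord hφ (hX.smooth u hu) hus
  have hAy : (fun u => A u (y u)) =ᶠ[𝓝[I] t] fieldCoord φ (fun u => J u (X u)) := by
    filter_upwards [hev] with u hu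
    exact tensorCoord_apply_fieldCoord hφ J X hu.2
  have hAyt : A t (y t) = fieldCoord φ (fun u => J u (X u)) t := hAy.self_of_nhdsWithin ht
  have hAys : ContDiffWithinAt ℝ ∞ (fieldCoord φ (fun u => J u (X u))) I t :=
    ((hsm t ht hts).clm_apply (hysm t ht hts)).congr_of_eventuallyEq hAy.symm hAyt.symm
  -- Differentiability of the relative derivative holds up to the end points because `I` has unique
  -- derivatives.
  have hder : ∀ {F : Type} [NormedAddCommGroup F] [NormedSpace ℝ F] {f : ℝ → F},
      ContDiffWithinAt ℝ ∞ f I t → DifferentiableWithinAt ℝ (derivWithin f I) I t := by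
    intro F _ _ f hf
    have h := hf.fderivWithin_right (m := ∞) hI (by simp) ht
    exact (h.clm_apply contDiffWithinAt_const).differentiableWithinAt (by simp)
  refine ⟨hAys.differentiableWithinAt (by simp), hder hAys, ?_⟩
  have hAd : ∀ᶠ u in 𝓝[I] t, DifferentiableWithinAt ℝ A I u := by
    filter_upwards [hev] with u hu
    exact (hsm u hu.1 hu.2).differentiableWithinAt (by simp)
  have hAd' : DifferentiableWithinAt ℝ (nablaTensor S c I φ A) I t := by
    have hN : DifferentiableWithinAt ℝ (fun u => connCoeff S φ (coordTM φ (velocity c u))) I t :=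
      (hasDerivAt_connCoeff hS hc hU hφ (hIU ht) hts).differentiableAt.differentiableWithinAt
    have hAt := hAd.self_of_nhdsWithin ht
    exact ((hder (hsm t ht hts)).add (hN.clm_comp hAt)).sub (hAt.clm_comp hN)
  have hyd : ∀ᶠ u in 𝓝[I] t,
      HasDerivWithinAt y (-connCoeff S φ (coordTM φ (velocity c u)) (y u)) I u := by
    filter_upwards [hev] with u hu
    exact hX.hasDerivWithinAt hφ hu.1 hu.2
  have h1 : nablaField S c I φ (fun u => A u (y u)) =ᶠ[𝓝[I] t]
      nablaField S c I φ (fieldCoord φ (fun u => J u (X u))) := by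
    filter_upwards [eventually_eventually_nhdsWithin.2 hAy, self_mem_nhdsWithin] with u hu huI
    exact nablaField_congr huI hu
  rw [← nablaField_congr ht h1, ← hAyt,
    ← nablaTensor_nablaTensor_apply_parallel hI ht hAd hAd' hyd]
  have h := congrArg (fun L => L (y t)) (hJ.jacobi φ hφ t ht hts)
  exact h

/-- A geodesic is determined by its velocity at one time. -/
theorem IsGeodesicOn.eqOn [T2Space M] (hS : IsSemispray S) {γ γ' : ℝ → M}
    (hI : IsOpen I) (hI' : IsPreconnected I)
    (hγ : IsGeodesicOn S γ I) (hγ' : IsGeodesicOn S γ' I) {t₀ : ℝ} (ht₀ : t₀ ∈ I)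
    (h₀ : (velocity γ t₀ : TM n M) = velocity γ' t₀) : EqOn γ γ' I := by
  suffices h : ∀ t ∈ I, (velocity γ t : TM n M) = velocity γ' t from
    fun t ht => congrArg (fun v : TM n M => v.proj) (h t ht)
  refine forall_of_local_propagation hI' (fun t ht => ?_) ht₀ h₀
  have hct : ContinuousAt γ t := hγ.smooth.continuousOn.continuousAt (hI.mem_nhds ht)
  have hct' : ContinuousAt γ' t := hγ'.smooth.continuousOn.continuousAt (hI.mem_nhds ht)
  -- If the base points agree, one chart contains both curves near `t` and uniqueness of integral
  -- curves applies. Otherwise the Hausdorff property keeps the curves apart near `t`, and there is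
  -- nothing to propagate.
  by_cases heq : γ t = γ' t
  · set φ := chartAt (Model n) (γ t)
    have hφ : φ ∈ IsManifold.maximalAtlas 𝓘(ℝ, Model n) ∞ M := IsManifold.chart_mem_maximalAtlas _
    have hts : γ t ∈ φ.source := mem_chart_source _ _
    obtain ⟨δ, hδ, h1⟩ := exists_chart_interval hγ hI ht φ hts
    obtain ⟨δ', hδ', h2⟩ := exists_chart_interval hγ' hI ht φ (heq ▸ hts)
    set O := Ioo (t - δ) (t + δ) ∩ Ioo (t - δ') (t + δ') with hO
    have hOo : IsOpen O := isOpen_Ioo.inter isOpen_Ioo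
    refine ⟨O, hOo, ⟨⟨by linarith, by linarith⟩, ⟨by linarith, by linarith⟩⟩,
      fun u hu huv v hv => ?_⟩
    have h3 := eqOn_of_hasDerivAt_of_contDiffOn (isOpen_coordDomain φ)
      ((contDiffOn_fieldInCoord hS hφ).of_le (ENat.LEInfty.out)) hOo
      (ordConnected_Ioo.inter ordConnected_Ioo).isPreconnected
      (z := fun u => coordTM φ (velocity γ u)) (w := fun u => coordTM φ (velocity γ' u))
      (fun w hw => ⟨hγ.coordTM_mem hφ (h1 w hw.1).1 (h1 w hw.1).2,
        hγ.hasDerivAt hI hφ (h1 w hw.1).1 (h1 w hw.1).2⟩)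
      (fun w hw => ⟨hγ'.coordTM_mem hφ (h2 w hw.2).1 (h2 w hw.2).2,
        hγ'.hasDerivAt hI hφ (h2 w hw.2).1 (h2 w hw.2).2⟩) hu.1 (congrArg (coordTM φ) huv)
    have h4 := congrArg (ofCoordTM φ : _ → TM n M) (h3 hv.1)
    simp only at h4
    rwa [ofCoordTM_coordTM hφ (v := velocity γ v) (h1 v hv.1.1).2,
      ofCoordTM_coordTM hφ (v := velocity γ' v) (h2 v hv.1.2).2] at h4
  · have hne : ∀ᶠ u in 𝓝 t, γ u ≠ γ' u := hct.ne_iff_eventually_ne hct' |>.1 heq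
    obtain ⟨O, hO, hOo, htO⟩ := eventually_nhds_iff.1 hne
    exact ⟨O, hOo, htO, fun u hu huv =>
      (hO u hu.1 (congrArg (fun v : TM n M => v.proj) huv)).elim⟩

theorem IsGeodesicVariation.mono {k : ℕ} {V : ℝ × (Fin k → ℝ) → M} {ε ε' : ℝ}
    (hV : IsGeodesicVariation S c I ε V) (hε' : 0 < ε') (h : ε' ≤ ε) :
    IsGeodesicVariation S c I ε' V :=
  ⟨hε', hV.smooth.mono (prod_mono_right (cube_mono h)), hV.base,
    fun s hs => hV.geodesic s (cube_mono h hs)⟩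

open Classical in
/-- Two geodesic variations with the same velocities at a common time can be glued. -/
theorem IsGeodesicVariation.glue [T2Space M] (hS : IsSemispray S) {k : ℕ} {I' : Set ℝ}
    {V V' : ℝ × (Fin k → ℝ) → M} {ε : ℝ} (hI : IsOpenInterval I) (hI' : IsOpenInterval I')
    (hV : IsGeodesicVariation S c I ε V) (hV' : IsGeodesicVariation S c I' ε V')
    (htI : t ∈ I) (htI' : t ∈ I')
    (h : ∀ s ∈ cube k ε, (velocity (fun u => V (u, s)) t : TM n M) = velocity (fun u => V' (u, s)) t) :
    IsGeodesicVariation S c (I ∪ I') ε (fun p => if p.1 ∈ I then V p else V' p) := by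
  set W : ℝ × (Fin k → ℝ) → M := fun p => if p.1 ∈ I then V p else V' p with hW
  have h1 : ∀ u ∈ I, ∀ s, W (u, s) = V (u, s) := fun u hu s => if_pos hu
  -- On the overlap, again an interval, the two geodesics for each `s` have the same velocity at `t`
  -- and hence coincide.
  have h2 : ∀ u ∈ I', ∀ s ∈ cube k ε, W (u, s) = V' (u, s) := by
    intro u hu s hs
    by_cases huI : u ∈ I
    · rw [h1 u huI]
      exact IsGeodesicOn.eqOn hS (hI.1.inter hI'.1) (hI.2.inter hI'.2).isPreconnected
        ((hV.geodesic s hs).mono inter_subset_left) ((hV'.geodesic s hs).mono inter_subset_right)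
        ⟨htI, htI'⟩ (h s hs) ⟨huI, hu⟩
    · exact if_neg huI
  refine ⟨hV.pos, ?_, ?_, fun s hs => isGeodesicOn_of_eventuallyEq ?_⟩
  · rintro ⟨u, s⟩ ⟨hu | hu, hs⟩
    · refine ContMDiffAt.contMDiffWithinAt ?_
      have hO := (hI.1.prod (isOpen_cube k ε)).mem_nhds (x := (u, s)) ⟨hu, hs⟩
      refine (hV.smooth.contMDiffAt hO).congr_of_eventuallyEq ?_
      filter_upwards [hO] with q hq
      exact h1 q.1 hq.1 q.2
    · refine ContMDiffAt.contMDiffWithinAt ?_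
      have hO := (hI'.1.prod (isOpen_cube k ε)).mem_nhds (x := (u, s)) ⟨hu, hs⟩
      refine (hV'.smooth.contMDiffAt hO).congr_of_eventuallyEq ?_
      filter_upwards [hO] with q hq
      exact h2 q.1 hq.1 q.2 hq.2
  · rintro u (hu | hu)
    · rw [h1 u hu, hV.base u hu]
    · rw [h2 u hu 0 (zero_mem_cube hV.pos), hV'.base u hu]
  · rintro u (hu | hu)
    · refine ⟨_, I, hI.1, hu, hV.geodesic s hs, ?_⟩
      filter_upwards [hI.1.mem_nhds hu] with w hw
      exact h1 w hw s
    · refine ⟨_, I', hI'.1, hu, hV'.geodesic s hs, ?_⟩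
      filter_upwards [hI'.1.mem_nhds hu] with w hw
      exact h2 w hw s hs

/-- Near each time, a geodesic has variations with prescribed initial velocities. -/
theorem IsGeodesicOn.exists_variation (hS : IsSemispray S) (hc : IsGeodesicOn S c U)
    (hU : IsOpen U) (hφ : φ ∈ IsManifold.maximalAtlas 𝓘(ℝ, Model n) ∞ M) (htU : t ∈ U)
    (ht : c t ∈ φ.source) :
    ∃ δ > 0, (∀ u ∈ Ioo (t - δ) (t + δ), u ∈ U ∧ c u ∈ φ.source) ∧
      ∀ τ ∈ Ioo (t - δ) (t + δ), ∀ {k : ℕ} (N : Set (Fin k → ℝ)) (ζ : (Fin k → ℝ) → Model n × Model n),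
        IsOpen N → 0 ∈ N → ContDiffOn ℝ ∞ ζ N → ζ 0 = coordTM φ (velocity c τ) →
        ∃ ε > 0, ∃ V : ℝ × (Fin k → ℝ) → M, cube k ε ⊆ N ∧
          IsGeodesicVariation S c (Ioo (t - δ) (t + δ)) ε V ∧
          ∀ s ∈ cube k ε, (velocity (fun u => V (u, s)) τ : TM n M) = ofCoordTM φ (ζ s) := by
  obtain ⟨δ₁, hδ₁, hsub⟩ := exists_chart_interval hc hU htU φ ht
  set z : ℝ → Model n × Model n := fun u => coordTM φ (velocity c u) with hz
  obtain ⟨δ₂, hδ₂, W, hW, htW, Fl, hFl, hFl0, hFlder⟩ := exists_smooth_flow (isOpen_coordDomain φ)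
    (contDiffOn_fieldInCoord hS hφ) (hc.coordTM_mem hφ htU ht)
  have hzc : ContinuousAt z t := (hc.hasDerivAt hU hφ htU ht).continuousAt
  obtain ⟨δ₃, hδ₃, hzW⟩ := Metric.mem_nhds_iff.1 (hzc.preimage_mem_nhds (hW.mem_nhds htW))
  -- The bounds keep `c` in the chart, put differences of two times in the interval into the time
  -- domain of the flow, and put all velocities of `c` into the flow's space domain. So one `δ`
  -- serves every starting time `τ`.
  obtain ⟨δ, hδ, hd1, hd2, hd3⟩ : ∃ δ > 0, δ ≤ δ₁ ∧ 2 * δ ≤ δ₂ ∧ δ ≤ δ₃ :=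
    ⟨min δ₁ (min (δ₂ / 2) δ₃), by positivity, min_le_left _ _, by
      have := (min_le_right δ₁ (min (δ₂ / 2) δ₃)).trans (min_le_left _ _)
      linarith, (min_le_right _ _).trans (min_le_right _ _)⟩
  set O := Ioo (t - δ) (t + δ) with hO
  have hOsub : ∀ u ∈ O, u ∈ U ∧ c u ∈ φ.source := fun u hu =>
    hsub u ⟨by linarith [hu.1], by linarith [hu.2]⟩
  have hshift : ∀ τ ∈ O, ∀ u ∈ O, u - τ ∈ Ioo (-δ₂) δ₂ := fun τ hτ u hu =>
    ⟨by linarith [hu.1, hτ.2], by linarith [hu.2, hτ.1]⟩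
  refine ⟨δ, hδ, hOsub, fun τ hτ k N ζ hN h0N hζ hζ0 => ?_⟩
  have hzτ : z τ ∈ W := hzW (by
    rw [Metric.mem_ball, Real.dist_eq, abs_lt]
    exact ⟨by linarith [hτ.1], by linarith [hτ.2]⟩)
  obtain ⟨ε, hε, hcube⟩ := exists_cube_subset (Filter.inter_mem (hN.mem_nhds h0N)
    ((hζ.continuousOn.continuousAt (hN.mem_nhds h0N)).preimage_mem_nhds
      (hW.mem_nhds (by rw [hζ0]; exact hzτ))))
  set Z : ℝ × (Fin k → ℝ) → Model n × Model n := fun p => Fl (p.1 - τ, ζ p.2) with hZ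
  have hZs : ContDiffOn ℝ ∞ Z (O ×ˢ cube k ε) := by
    refine hFl.comp (ContDiffOn.prodMk (by fun_prop) (hζ.comp contDiffOn_snd fun p hp =>
      (hcube hp.2).1)) fun p hp => ⟨hshift τ hτ p.1 hp.1, (hcube hp.2).2⟩
  have hZd : ∀ s ∈ cube k ε, ∀ u ∈ O, Z (u, s) ∈ φ.target ×ˢ ({0}ᶜ : Set (Model n)) ∧
      HasDerivAt (fun u => Z (u, s)) (fieldInCoord S φ (Z (u, s))) u := by
    intro s hs u hu
    obtain ⟨h1, h2⟩ := hFlder (ζ s) (hcube hs).2 (u - τ) (hshift τ hτ u hu)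
    exact ⟨h1, h2.comp_sub_const u τ⟩
  have hZ0 : ∀ s ∈ cube k ε, Z (τ, s) = ζ s := by
    intro s hs
    have h := hFl0 (ζ s) (hcube hs).2
    simpa [hZ] using h
  have hgeo : ∀ s ∈ cube k ε, IsGeodesicOn S (fun u => φ.symm (Z (u, s)).1) O ∧
      ∀ u ∈ O, velocity (fun u => φ.symm (Z (u, s)).1) u = (ofCoordTM φ (Z (u, s)) : TM n M) :=
    fun s hs => isGeodesicOn_of_hasDerivAt hS hφ isOpen_Ioo (z := fun u => Z (u, s))
      (hZs.comp (f := fun u : ℝ => (u, s)) (by fun_prop) fun u hu => ⟨hu, hs⟩)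
      (fun u hu => (hZd s hs u hu).1) (fun u hu => (hZd s hs u hu).2)
  have h0c : (0 : Fin k → ℝ) ∈ cube k ε := zero_mem_cube hε
  refine ⟨ε, hε, fun p => φ.symm (Z p).1, fun s hs => (hcube hs).1,
    ⟨hε, ?_, fun u hu => ?_, fun s hs => (hgeo s hs).1⟩, fun s hs => ?_⟩
  · exact (contMDiffOn_symm_of_mem_maximalAtlas hφ).comp hZs.fst.contMDiffOn
      fun p hp => (hZd p.2 hp.2 p.1 hp.1).1.1
  -- At `s = 0` the flow line and `c` have the same velocity at `τ`, so the variation is one of `c`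
  -- itself.
  · have h := eqOn_of_hasDerivAt_of_contDiffOn (isOpen_coordDomain φ)
      ((contDiffOn_fieldInCoord hS hφ).of_le (ENat.LEInfty.out)) isOpen_Ioo isPreconnected_Ioo
      (z := fun u => Z (u, 0)) (w := z) (hZd 0 h0c)
      (fun w hw => ⟨hc.coordTM_mem hφ (hOsub w hw).1 (hOsub w hw).2,
        hc.hasDerivAt hU hφ (hOsub w hw).1 (hOsub w hw).2⟩) hτ ((hZ0 0 h0c).trans hζ0) hu
    have h' : (Z (u, 0)).1 = φ (c u) := congrArg Prod.fst h
    change φ.symm (Z (u, 0)).1 = c u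
    rw [h', φ.left_inv (hOsub u hu).2]
  · rw [(hgeo s hs).2 τ hτ, hZ0 s hs]

/-- A geodesic has variations with prescribed initial velocities on neighbourhoods of compact
intervals. -/
theorem IsGeodesicOn.exists_variation_Icc [T2Space M] (hS : IsSemispray S)
    (hc : IsGeodesicOn S c U) (hU : IsOpenInterval U)
    (hφ : φ ∈ IsManifold.maximalAtlas 𝓘(ℝ, Model n) ∞ M) {a b : ℝ} (h0 : t ∈ Icc a b)
    (hab : Icc a b ⊆ U) (ht : c t ∈ φ.source) {k : ℕ} {ζ : (Fin k → ℝ) → Model n × Model n}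
    (hζ : ContDiff ℝ ∞ ζ) (hζ0 : ζ 0 = coordTM φ (velocity c t)) :
    ∃ I, IsOpenInterval I ∧ Icc a b ⊆ I ∧ I ⊆ U ∧ ∃ ε, ∃ V : ℝ × (Fin k → ℝ) → M,
      IsGeodesicVariation S c I ε V ∧
      ∀ s ∈ cube k ε, (velocity (fun u => V (u, s)) t : TM n M) = ofCoordTM φ (ζ s) := by
  set P : ℝ → Prop := fun T => ∃ I, IsOpenInterval I ∧ t ∈ I ∧ T ∈ I ∧ I ⊆ U ∧ ∃ ε,
    ∃ V : ℝ × (Fin k → ℝ) → M, IsGeodesicVariation S c I ε V ∧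
      ∀ s ∈ cube k ε, (velocity (fun u => V (u, s)) t : TM n M) = ofCoordTM φ (ζ s) with hP
  have hunion : ∀ {I I' : Set ℝ} {τ : ℝ}, IsOpenInterval I → IsOpenInterval I' → τ ∈ I → τ ∈ I' →
      IsOpenInterval (I ∪ I') := fun hI hI' h h' => ⟨hI.1.union hI'.1,
    isPreconnected_iff_ordConnected.1
      (hI.2.isPreconnected.union _ h h' hI'.2.isPreconnected)⟩
  have hIoo : ∀ x y : ℝ, IsOpenInterval (Ioo x y) := fun x y => ⟨isOpen_Ioo, ordConnected_Ioo⟩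
  have hall : ∀ T ∈ U, P T := by
    refine forall_of_local_propagation hU.2.isPreconnected (fun t₀ ht₀ => ?_) (hab h0) ?_
    · set ψ := chartAt (Model n) (c t₀)
      have hψ : ψ ∈ IsManifold.maximalAtlas 𝓘(ℝ, Model n) ∞ M :=
        IsManifold.chart_mem_maximalAtlas _
      obtain ⟨δ, hδ, hsub, hex⟩ := hc.exists_variation hS hU.1 hψ ht₀ (mem_chart_source _ _)
      refine ⟨Ioo (t₀ - δ) (t₀ + δ), isOpen_Ioo, ⟨by linarith, by linarith⟩, ?_⟩
      rintro u hu ⟨I, hI, htI, huI, hIU, ε, V, hV, hVt⟩ v hv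
      have hus := (hsub u hu.1).2
      have hcont : ContinuousOn (fun s => V (u, s)) (cube k ε) :=
        hV.smooth.continuousOn.comp (f := fun s => (u, s)) (by fun_prop) fun s hs => ⟨huI, hs⟩
      have hNo : IsOpen (cube k ε ∩ (fun s => V (u, s)) ⁻¹' ψ.source) :=
        hcont.isOpen_inter_preimage (isOpen_cube k ε) ψ.open_source
      have h0c := zero_mem_cube (k := k) hV.pos
      -- The flow is restarted at time `u` from the velocities already reached by `V`; these are
      -- smooth in `s` and, for small `s`, lie over the chart at `c t₀`.
      obtain ⟨ε', hε', V', hN', hV', hVu⟩ := hex u hu.1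
        (cube k ε ∩ (fun s => V (u, s)) ⁻¹' ψ.source)
        (fun s => coordTM ψ (velocity (fun w => V (w, s)) u)) hNo
        ⟨h0c, by change V (u, 0) ∈ ψ.source; rwa [hV.base u huI]⟩
        (fun s hs => ((hV.contDiffAt_coordTM_velocity hI.1 hψ (p := (u, s)) ⟨huI, hs.1⟩ hs.2).comp
          (f := fun s => (u, s)) s (by fun_prop)).contDiffWithinAt)
        (congrArg (coordTM ψ) (velocity_congr (by
          filter_upwards [hI.1.mem_nhds huI] with w hw using hV.base w hw)))
      set η := min ε ε' with hη
      have hη0 : 0 < η := lt_min hV.pos hε'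
      have hglue := (hV.mono hη0 (min_le_left _ _)).glue hS hI (hIoo _ _)
        (hV'.mono hη0 (min_le_right _ _)) huI hu.1 fun s hs => by
          rw [hVu s (cube_mono (min_le_right _ _) hs), ofCoordTM_coordTM hψ]
          exact (hN' (cube_mono (min_le_right _ _) hs)).2
      refine ⟨_, hunion hI (hIoo _ _) huI hu.1, Or.inl htI, Or.inr hv.1,
        union_subset hIU fun w hw => (hsub w hw).1, η, _, hglue, fun s hs => ?_⟩
      rw [← hVt s (cube_mono (min_le_left _ _) hs)]
      refine velocity_congr ?_
      filter_upwards [hI.1.mem_nhds htI] with w hw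
      exact if_pos hw
    · obtain ⟨δ, hδ, hsub, hex⟩ := hc.exists_variation hS hU.1 hφ (hab h0) ht
      have htm : t ∈ Ioo (t - δ) (t + δ) := ⟨by linarith, by linarith⟩
      obtain ⟨ε, hε, V, -, hV, hVt⟩ := hex t htm univ ζ isOpen_univ (mem_univ _)
        hζ.contDiffOn hζ0
      exact ⟨_, hIoo _ _, htm, htm, fun u hu => (hsub u hu).1, ε, V, hV, hVt⟩
  have hab' : a ≤ b := h0.1.trans h0.2
  obtain ⟨I, hI, htI, haI, hIU, ε, V, hV, hVt⟩ := hall a (hab ⟨le_rfl, hab'⟩)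
  obtain ⟨I', hI', htI', hbI', hIU', ε', V', hV', hVt'⟩ := hall b (hab ⟨hab', le_rfl⟩)
  set η := min ε ε' with hη
  have hη0 : 0 < η := lt_min hV.pos hV'.pos
  -- The variations reaching `a` and `b` both have initial velocities given by `ζ` at time `t`, so
  -- they glue there.
  have hglue := (hV.mono hη0 (min_le_left _ _)).glue hS hI hI'
    (hV'.mono hη0 (min_le_right _ _)) htI htI' fun s hs => by
      rw [hVt s (cube_mono (min_le_left _ _) hs), hVt' s (cube_mono (min_le_right _ _) hs)]
  have hII' := hunion hI hI' htI htI'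
  refine ⟨_, hII', hII'.2.out (Or.inl haI) (Or.inr hbI'),
    union_subset hIU hIU', η, _, hglue, fun s hs => ?_⟩
  rw [← hVt s (cube_mono (min_le_left _ _) hs)]
  refine velocity_congr ?_
  filter_upwards [hI.1.mem_nhds htI] with w hw
  exact if_pos hw

/-- Every transversal Jacobi tensor along a compact geodesic comes from a geodesic variation. -/
theorem IsJacobiTensor.exists_variation [T2Space M] (hS : IsSpray S) {a b : ℝ} (hab : a < b)
    (h0 : (0 : ℝ) ∈ Icc a b) (hc : IsGeodesicOnCompact S c (Icc a b))
    {e : Fin (n - 1) → FieldAlong n c} {J : TensorAlong n c}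
    (he : IsTransversalFrame S c (Icc a b) e) (hJ : IsJacobiTensor S c (Icc a b) J)
    (hJe : IsTransversalTensor c (Icc a b) e J) :
    ∃ (I : Set ℝ) (ε : ℝ) (V : ℝ × (Fin (n - 1) → ℝ) → M), IsOpenInterval I ∧ Icc a b ⊆ I ∧
      IsGeodesicVariation S c I ε V ∧ IsInducedTensor c (Icc a b) e V J := by
  obtain ⟨U, hU, hsub, hcU⟩ := hc
  have hS' := hS.toIsSemispray
  have hIu : UniqueDiffOn ℝ (Icc a b) := uniqueDiffOn_Icc hab
  set φ := chartAt (Model n) (c 0)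
  have hφ : φ ∈ IsManifold.maximalAtlas 𝓘(ℝ, Model n) ∞ M := IsManifold.chart_mem_maximalAtlas _
  have h0s : c 0 ∈ φ.source := mem_chart_source _ _
  set Y : Fin (n - 1) → FieldAlong n c := fun i u => J u (e i u) with hY
  have hYJ : ∀ i, SolvesJacobi S c (Icc a b) (Y i) := fun i =>
    hJ.solvesJacobi hS' hcU hU.1 hIu hsub (he.parallel i)
  set p : Fin (n - 1) → Model n × Model n := fun i =>
    (fieldCoord φ (Y i) 0, derivWithin (fieldCoord φ (Y i)) (Icc a b) 0) with hp
  set L : (Fin (n - 1) → ℝ) →L[ℝ] Model n × Model n :=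
    ∑ i, (ContinuousLinearMap.proj i : (Fin (n - 1) → ℝ) →L[ℝ] ℝ).smulRight (p i) with hL
  have hLi : ∀ i, L (Pi.single i 1) = p i := by
    intro i
    simp [hL, Pi.single_apply]
  -- Initial velocities affine in `s` have the prescribed data `p i` as their partial derivatives.
  obtain ⟨I, hI, habI, hIU, ε, V, hV, hV0⟩ := hcU.exists_variation_Icc hS' hU hφ h0 hsub h0s
    (ζ := fun s => coordTM φ (velocity c 0) + L s) (by fun_prop) (by simp)
  have hcI := hcU.mono hIU
  have hd : ∀ i, fderiv ℝ (fun s => coordTM φ (velocity (fun u => V (u, s)) 0)) 0 (Pi.single i 1)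
      = p i := by
    intro i
    -- The coordinates of the initial velocities are recovered only while their base point stays in
    -- the target of the chart, that is, for small `s`.
    have hev : (fun s => coordTM φ (velocity (fun u => V (u, s)) 0)) =ᶠ[𝓝 0]
        fun s => coordTM φ (velocity c 0) + L s := by
      have hm : ∀ᶠ s in 𝓝 (0 : Fin (n - 1) → ℝ), (coordTM φ (velocity c 0) + L s).1 ∈ φ.target := by
        have hcont : ContinuousAt (fun s => (coordTM φ (velocity c 0) + L s).1) 0 := by fun_prop
        refine hcont.eventually (φ.open_target.mem_nhds ?_)
        have h := φ.map_source h0s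
        change (coordTM φ (velocity c 0) + L 0).1 ∈ φ.target
        rw [map_zero, add_zero]
        exact h
      filter_upwards [(isOpen_cube _ ε).mem_nhds (zero_mem_cube hV.pos), hm] with s hs hs'
      rw [hV0 s hs, coordTM_ofCoordTM hφ hs']
    rw [hev.fderiv_eq, fderiv_const_add, L.fderiv, hLi]
  have hval : ∀ i, ∀ t ∈ Icc a b, (Y i t : Model n) = (paramDeriv V i t : TM n M).2 := by
    intro i
    set X : FieldAlong n c := fun t => ((paramDeriv V i t : TM n M).2 : Model n) with hX
    have hXV : ∀ t ∈ Icc a b, (X t : Model n) = (paramDeriv V i t : TM n M).2 := fun t _ => rfl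
    have hXJ := hV.solvesJacobi hS' hI.1 hcI habI hIu hXV
    have h1 := hV.fieldCoord_eq hS' hI.1 hφ (habI h0) h0s (hXV 0 h0)
    have h2 := (hV.hasDerivWithinAt_fieldCoord hS' hI.1 hφ hcI habI hXV h0 h0s).derivWithin
      (hIu 0 h0)
    rw [hd i] at h1 h2
    -- The variation field and `J(e_i)` solve the same linear equation with the same value and
    -- derivative at time `0`.
    exact (hYJ i).eq hS' hcI hI.1 ordConnected_Icc habI hXJ hφ h0 h0s h1.symm h2.symm
  refine ⟨I, ε, V, hI, habI, hV, fun t ht => ⟨(hJe t ht).1, fun i => ?_⟩⟩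
  exact ext_TM (hV.base t (habI ht)).symm (hval i t ht)

end Existence

end SprayGeometry
end

open SprayGeometry in
theorem mainTheorem2 {n : ℕ} (hn : 2 ≤ n) {M : Type*} [TopologicalSpace M] [T2Space M]
    [SecondCountableTopology M] [ChartedSpace (Model n) M] [IsManifold 𝓘(ℝ, Model n) ∞ M]
    (S : SecondOrderField n M) (hS : IsSpray S) :
    (∀ (I : Set ℝ) (c : ℝ → M) (ε : ℝ) (V : ℝ × (Fin (n - 1) → ℝ) → M)
        (e : Fin (n - 1) → FieldAlong n c),
      IsOpenInterval I → 0 ∈ I → IsGeodesicVariation S c I ε V → IsTransversalFrame S c I e →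
      ∃ J : TensorAlong n c, IsInducedTensor c I e V J ∧ IsJacobiTensor S c I J ∧
        ∀ J' : TensorAlong n c, IsInducedTensor c I e V J' → ∀ t ∈ I, J' t = J t) ∧
    (∀ (a b : ℝ) (c : ℝ → M) (e : Fin (n - 1) → FieldAlong n c) (J : TensorAlong n c),
      a < b → 0 ∈ Icc a b → IsGeodesicOnCompact S c (Icc a b) →
      IsTransversalFrame S c (Icc a b) e → IsJacobiTensor S c (Icc a b) J →
      IsTransversalTensor c (Icc a b) e J →
      ∃ (Istar : Set ℝ) (cstar : ℝ → M) (ε : ℝ) (V : ℝ × (Fin (n - 1) → ℝ) → M),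
        IsOpenInterval Istar ∧ Icc a b ⊆ Istar ∧ EqOn cstar c (Icc a b) ∧
        IsGeodesicVariation S cstar Istar ε V ∧ IsInducedTensor c (Icc a b) e V J) := by
  refine ⟨fun I c ε V e hI h0 hV he => ?_, fun a b c e J hab h0 hc he hJ hJe => ?_⟩
  · obtain ⟨h1, h2⟩ := isInducedTensor_inducedTensor hn hS hI h0 hV he
    exact ⟨_, h1, isJacobiTensor_inducedTensor hn hS hI h0 hV he, h2⟩
  · obtain ⟨I, ε, V, hI, hsub, hV, hVJ⟩ := hJ.exists_variation hS hab h0 hc he hJe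
    -- The curve `c` is defined on all of `ℝ` and is a geodesic on a neighbourhood of `[a, b]`, so
    -- it serves as its own extension.
    exact ⟨I, c, ε, V, hI, hsub, eqOn_refl c _, hV, hVJ⟩
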